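/- **Setting.** Fix $N$, $q,t\in[0,1)$ and $a_1,\dots,a_N>0$ (with $0^0=1$). $\mathbb{GT}_k$ is the set of signatures $\lambda=(\lambda_1\ge\dots\ge\lambda_k)\in\mathbb Z^k$, $|\lambda|=\sum_i\lambda_i$, $\mathbb{GT}_0=\{\varnothing\}$. For $\mu\in\mathbb{GT}_{k-1}$, $\lambda\in\mathbb{GT}_k$ write $\mu\prec\lambda$ if $\lambda_{i+1}\le\mu_i\le\lambda_i$ for all $i$. $\mathbb{GT}(m)$ is the set of arrays $\boldsymbol\lambda=(\lambda^{(1)}\prec\dots\prec\lambda^{(m)})$, $\lambda^{(k)}\in\mathbb{GT}_k$. Write $\nu=\lambda+e_j$ if $\nu$ is obtained from $\lambda$ by adding $1$ to the $j$-th coordinate (both being signatures). Bars denote signatures in $\mathbb{GT}_{k-1}$. Let $f(u)=(tu;q)_\infty/(qu;q)_\infty$. For $\mu\prec\lambda$, $\mu\in\mathbb{GT}_{k-1}$, put $$\psi_{\lambda/\mu}=\prod_{1\le i\le j\le k-1}\frac{f(q^{\mu_i-\mu_j}t^{j-i})f(q^{\lambda_i-\lambda_{j+1}}t^{j-i})}{f(q^{\lambda_i-\mu_j}t^{j-i})f(q^{\mu_i-\lambda_{j+1}}t^{j-i})},\qquad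 P_{\lambda/\mu}(x)=\psi_{\lambda/\mu}x^{|\lambda|-|\mu|},$$ and $P_{\lambda/\mu}(x)=0$ if $\mu\not\prec\lambda$. The Macdonald (Laurent) polynomials are $P_\lambda(a_1,\dots,a_k)=\sum\prod_{i=1}^kP_{\lambda^{(i)}/\lambda^{(i-1)}}(a_i)$, the sum being over arrays in $\mathbb{GT}(k)$ with $\lambda^{(k)}=\lambda$, $\lambda^{(0)}=\varnothing$. For $\nu=\lambda+e_j$ put $$\psi'_{\nu/\lambda}=\prod_{i=1}^{j-1}\frac{(1-q^{\lambda_i-\lambda_j}t^{j-i-1})(1-q^{\nu_i-\nu_j}t^{j-i+1})}{(1-q^{\lambda_i-\lambda_j}t^{j-i})(1-q^{\nu_i-\nu_j}t^{j-i})}.$$ The links are $\Lambda^k_{k-1}(\lambda,\mu)=\frac{P_\mu(a_1,\dots,a_{k-1})}{P_\lambda(a_1,\dots,a_k)}P_{\lambda/\mu}(a_k)$. The Macdonald univariate dynamics on $\mathbb{GT}_k$ has rates $\frac{P_\nu(a_1,\dots,a_k)}{P_\lambda(a_1,\dots,a_k)}\psi'_{\nu/\lambda}$ for $\nu=\lambda+e_j$,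 rate $0$ for all other $\nu\neq\lambda$, and diagonal entries making the row sums zero. **Data.** Let $W_k(\lambda,\nu\,|\,\bar\lambda)\in\mathbb R$ ($1\le k\le N$) and $V_k(\lambda,\nu\,|\,\bar\lambda,\bar\nu)\in[0,1]$ ($2\le k\le N$) be functions of $\lambda,\nu\in\mathbb{GT}_k$, $\bar\lambda,\bar\nu\in\mathbb{GT}_{k-1}$, considered for $\bar\lambda\prec\lambda$, such that: $V_k=0$ if $\bar\nu\not\prec\nu$; $W_k=0$ if $\bar\lambda\not\prec\nu$; for fixed other arguments, $V_k$ and $W_k$ are nonzero for finitely many $\nu$ only; $\sum_\nu V_k(\lambda,\nu|\bar\lambda,\bar\nu)=1$; $V_k(\lambda,\nu|\bar\lambda,\bar\lambda)=1_{\lambda=\nu}$; $W_k(\lambda,\nu|\bar\lambda)\ge0$ for $\nu\ne\lambda$; $\sum_{\nu\ne\lambda}W_k(\lambda,\nu|\bar\lambda)=-W_k(\lambda,\lambda|\bar\lambda)$. For $m\le N$ and $\boldsymbol\lambda\neq\boldsymbol\nu$ in $\mathbb{GT}(m)$ which differ for the first time in row $k$, set $$\mathbf Q^{(m)}(\boldsymbol\lambda,\boldsymbol\nu)=W_k(\lambda^{(k)},\nu^{(k)}|\lambda^{(k-1)})\prod_{i=k+1}^mV_i(\lambda^{(i)},\nu^{(i)}|\lambda^{(i-1)},\nu^{(i-1)}),$$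 and $\mathbf Q^{(m)}(\boldsymbol\lambda,\boldsymbol\lambda)=-\sum_{\boldsymbol\nu\neq\boldsymbol\lambda}\mathbf Q^{(m)}(\boldsymbol\lambda,\boldsymbol\nu)$. The projection $Q_m(x,y)$, $x,y\in\mathbb{GT}_m$, is the sum of $\mathbf Q^{(m)}(\boldsymbol\lambda,\boldsymbol\nu)\prod_{i=1}^m\Lambda^i_{i-1}(\lambda^{(i)},\lambda^{(i-1)})$ over $\boldsymbol\lambda,\boldsymbol\nu\in\mathbb{GT}(m)$ with last rows $x$ and $y$ ($Q_0=0$). We say that $W,V$ *define a multivariate dynamics* if - the $W_k$ are uniformly bounded; the entries of $\mathbf Q^{(N)}$ and of each $Q_m$ ($1\le m\le N$) are uniformly bounded, with finitely many nonzero entries in each row; - there is a semigroup of stochastic matrices $(\mathbf P(\tau))_{\tau\ge0}$ on $\mathbb{GT}(N)$, $\mathbf P(0)=1$, with $\mathbf P(\tau;X,Y)=1_{X=Y}+\mathbf Q^{(N)}(X,Y)\tau+o(\tau)$ as $\tau\to0^+$ for all $X,Y$; - for all $1\le k\le N$, $x,y\in\mathbb{GT}_k$ and $\bar y\in\mathbb{GT}_{k-1}$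 with $\Lambda^k_{k-1}(y,\bar y)\neq0$, $$\sum_{\bar x}V_k(x,y|\bar x,\bar y)\Lambda^k_{k-1}(x,\bar x)Q_{k-1}(\bar x,\bar y)+W_k(x,y|\bar y)\Lambda^k_{k-1}(x,\bar y)=Q_k(x,y)\Lambda^k_{k-1}(y,\bar y);$$ - for $1\le m\le N$, $Q_m$ is the rate matrix of the Macdonald univariate dynamics on $\mathbb{GT}_m$. **Theorem.** $W,V$ define a multivariate dynamics if and only if the following hold. 0. (One particle per row moves, by one.) If $\nu\ne\lambda$ and $\nu\neq\lambda+e_j$ for all $j$, then $W_k(\lambda,\nu|\bar\lambda)=0$ whenever $1\le k\le N$, $\bar\lambda\prec\lambda$, and $V_k(\lambda,\nu|\bar\lambda,\bar\nu)=0$ whenever $2\le k\le N$, $\bar\lambda\prec\lambda$ and $\bar\nu=\bar\lambda+e_i$ for some $i$. 1. (Short-range pushing.) For $2\le k\le N$, $1\le j\le k-1$, and $\lambda\in\mathbb{GT}_k$, $\bar\nu\in\mathbb{GT}_{k-1}$ with $\bar\nu\not\prec\lambda$, $\bar\nu\prec\lambda+e_j$, $\bar\nu-e_j\prec\lambda$: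 $V_k(\lambda,\lambda+e_j|\bar\nu-e_j,\bar\nu)=1$. 2. For $1\le k\le N$, $\bar\nu\prec\lambda$ with $\lambda\in\mathbb{GT}_k$, $\bar\nu\in\mathbb{GT}_{k-1}$, and $1\le j\le k$ with $\lambda_j<\bar\nu_{j-1}$ (no condition for $j=1$): $$\sum_{i=1}^{k-1}V_k(\lambda,\lambda+e_j|\bar\nu-e_i,\bar\nu)T_i(\bar\nu,\lambda)+a_k^{-1}W_k(\lambda,\lambda+e_j|\bar\nu)=S_j(\bar\nu,\lambda),$$ where terms with $\bar\nu-e_i$ not a signature are $0$, terms in which the numerator factor $1-q^{\bar\nu_i-\lambda_{i+1}}$ of $T_i$ vanishes are $0$, and $$T_i=\frac{(1-q^{\lambda_i-\bar\nu_i}t)(1-q^{\bar\nu_i-\lambda_{i+1}})}{(1-q^{\lambda_i-\bar\nu_i+1})(1-q^{\bar\nu_i-1-\lambda_{i+1}}t)}\prod_{r=1}^{i-1}\frac{(1-q^{\lambda_r-\bar\nu_i}t^{i-r+1})(1-q^{\bar\nu_r-\bar\nu_i+1}t^{i-r-1})}{(1-q^{\lambda_r-\bar\nu_i+1}t^{i-r})(1-q^{\bar\nu_r-\bar\nu_i}t^{i-r})}\prod_{s=i+1}^{k-1}\frac{(1-q^{\bar\nu_i-\bar\nu_s-1}t^{s-i+1})(1-q^{\bar\nu_i-\lambda_{s+1}}t^{s-i})}{(1-q^{\bar\nu_i-\bar\nu_s}t^{s-i})(1-q^{\bar\nu_i-\lambda_{s+1}-1}t^{s-i+1})},$$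 $$S_j=\prod_{r=1}^{j-1}\frac{(1-q^{\bar\nu_r-\lambda_j}t^{j-r-1})(1-q^{\lambda_r-\lambda_j-1}t^{j-r+1})}{(1-q^{\bar\nu_r-\lambda_j-1}t^{j-r})(1-q^{\lambda_r-\lambda_j}t^{j-r})}\prod_{s=j}^{k-1}\frac{(1-q^{\lambda_j-\lambda_{s+1}+1}t^{s-j})(1-q^{\lambda_j-\bar\nu_s}t^{s-j+1})}{(1-q^{\lambda_j-\lambda_{s+1}}t^{s-j+1})(1-q^{\lambda_j-\bar\nu_s+1}t^{s-j})}.$$ -/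

import Mathlib

/-!
Levels are counted from `0`: the families `W k`, `V k`, `a k`, `link k`, `k = 0, 1, …`, belong to
the `(k+1)`-st row of an interlacing array.  All `∑'` below have finitely many nonzero terms:
a row has finitely many rows interlacing below it, and rates and triggered-move probabilities
are assumed to have finite support.
-/

namespace MacdonaldDynamics

noncomputable section

/-- Signatures of length `k`: nonincreasing `k`-tuples of integers. -/
abbrev Sig (k : ℕ) : Type := {x : Fin k → ℤ // Antitone x}

/-- `|lam|`, the sum of the parts. -/
def Sig.size {k : ℕ} (lam : Sig k) : ℤ := ∑ i, lam.1 i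

/-- `mu ≺ lam`: the interlacing relation `lam_{i+1} ≤ mu_i ≤ lam_i`. -/
def Interlaces {k : ℕ} (mu : Sig k) (lam : Sig (k + 1)) : Prop :=
  ∀ i : Fin k, lam.1 i.succ ≤ mu.1 i ∧ mu.1 i ≤ lam.1 i.castSucc

/-- `lam = mu + e_j`. -/
def IsAddBox {k : ℕ} (mu lam : Sig k) (j : Fin k) : Prop :=
  lam.1 = mu.1 + Pi.single j 1

/-- Gelfand–Tsetlin schemes of depth `N` (interlacing integer arrays). The row of length `0`
is the empty signature. -/
@[ext]
structure GTScheme (N : ℕ) where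
  row : (k : Fin (N + 1)) → Sig k
  interlaces : ∀ k : Fin N, Interlaces (k := k) (row k.castSucc) (row k.succ)

/-- The last row of a scheme. -/
def GTScheme.top {N : ℕ} (X : GTScheme N) : Sig N := X.row (Fin.last N)

/-! ### Macdonald quantities -/

/-- The infinite `q`-Pochhammer symbol `(u; q)_∞`. -/
def qPochInf (q u : ℝ) : ℝ := ∏' n : ℕ, (1 - u * q ^ n)

/-- `f(u) = (t u; q)_∞ / (q u; q)_∞`. -/
def fMac (q t u : ℝ) : ℝ := qPochInf q (t * u) / qPochInf q (q * u)

/-- The coefficient `ψ_{lam/mu}`, for `mu ≺ lam`. -/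
def psi (q t : ℝ) {k : ℕ} (lam : Sig (k + 1)) (mu : Sig k) : ℝ :=
  ∏ i : Fin k, ∏ j ∈ Finset.Ici i,
    (fMac q t (q ^ (mu.1 i - mu.1 j) * t ^ ((j : ℤ) - i)) *
        fMac q t (q ^ (lam.1 i.castSucc - lam.1 j.succ) * t ^ ((j : ℤ) - i))) /
      (fMac q t (q ^ (lam.1 i.castSucc - mu.1 j) * t ^ ((j : ℤ) - i)) *
        fMac q t (q ^ (mu.1 i - lam.1 j.succ) * t ^ ((j : ℤ) - i)))

/-- The factor `1 - q^m t^n`. -/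
def qtFac (q t : ℝ) (m n : ℤ) : ℝ := 1 - q ^ m * t ^ n

/-- The coefficient `ψ'_{lam/mu}` for `lam = mu + e_j`. -/
def psiPrime (q t : ℝ) {k : ℕ} (lam mu : Sig k) (j : Fin k) : ℝ :=
  ∏ i ∈ Finset.Iio j,
    (qtFac q t (mu.1 i - mu.1 j) ((j : ℤ) - i - 1) *
        qtFac q t (lam.1 i - lam.1 j) ((j : ℤ) - i + 1)) /
      (qtFac q t (mu.1 i - mu.1 j) ((j : ℤ) - i) *
        qtFac q t (lam.1 i - lam.1 j) ((j : ℤ) - i))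

open scoped Classical in
/-- The skew Macdonald (Laurent) polynomial `P_{lam/mu}(x)` in one variable. -/
def skewP (q t x : ℝ) {k : ℕ} (lam : Sig (k + 1)) (mu : Sig k) : ℝ :=
  if Interlaces mu lam then psi q t lam mu * x ^ (lam.size - mu.size) else 0

/-- The Macdonald (Laurent) polynomial `P_lam(a_1, …, a_k)`: the sum over all
Gelfand–Tsetlin schemes with last row `lam` (semistandard tableaux of shape `lam`). -/
def macP (q t : ℝ) (a : ℕ → ℝ) {k : ℕ} (lam : Sig k) : ℝ :=
  ∑' X : {X : GTScheme k // X.top = lam},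
    ∏ i : Fin k, skewP q t (a i) (k := i) (X.1.row i.succ) (X.1.row i.castSucc)

/-- The stochastic link from signatures of length `k+1` to signatures of length `k`. -/
def link (q t : ℝ) (a : ℕ → ℝ) (k : ℕ) (lam : Sig (k + 1)) (mu : Sig k) : ℝ :=
  macP q t a mu / macP q t a lam * skewP q t (a k) lam mu

open scoped Classical in
/-- Off-diagonal jump rates of the univariate dynamics on signatures of length `k`
(equal to `0` on the diagonal). -/
def univOffDiag (q t : ℝ) (a : ℕ → ℝ) (k : ℕ) (lam nu : Sig k) : ℝ :=
  ∑ j : Fin k,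
    if IsAddBox lam nu j then macP q t a nu / macP q t a lam * psiPrime q t nu lam j else 0

open scoped Classical in
/-- The jump rate matrix of the univariate dynamics on signatures of length `k`. -/
def univRate (q t : ℝ) (a : ℕ → ℝ) (k : ℕ) (lam nu : Sig k) : ℝ :=
  if lam = nu then -∑' ka : Sig k, univOffDiag q t a k lam ka else univOffDiag q t a k lam nu

/-- The explicit product `T_i(nub, lam)`. -/
def Tcoef (q t : ℝ) {k : ℕ} (nub : Sig k) (lam : Sig (k + 1)) (i : Fin k) : ℝ :=
  (qtFac q t (lam.1 i.castSucc - nub.1 i) 1 * qtFac q t (nub.1 i - lam.1 i.succ) 0) /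
      (qtFac q t (lam.1 i.castSucc - nub.1 i + 1) 0 *
        qtFac q t (nub.1 i - 1 - lam.1 i.succ) 1) *
    (∏ r ∈ Finset.Iio i,
      (qtFac q t (lam.1 r.castSucc - nub.1 i) ((i : ℤ) - r + 1) *
          qtFac q t (nub.1 r - nub.1 i + 1) ((i : ℤ) - r - 1)) /
        (qtFac q t (lam.1 r.castSucc - nub.1 i + 1) ((i : ℤ) - r) *
          qtFac q t (nub.1 r - nub.1 i) ((i : ℤ) - r))) *
    ∏ s ∈ Finset.Ioi i,
      (qtFac q t (nub.1 i - nub.1 s - 1) ((s : ℤ) - i + 1) *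
          qtFac q t (nub.1 i - lam.1 s.succ) ((s : ℤ) - i)) /
        (qtFac q t (nub.1 i - nub.1 s) ((s : ℤ) - i) *
          qtFac q t (nub.1 i - lam.1 s.succ - 1) ((s : ℤ) - i + 1))

/-- The explicit product `S_j(nub, lam)`. -/
def Scoef (q t : ℝ) {k : ℕ} (nub : Sig k) (lam : Sig (k + 1)) (j : Fin (k + 1)) : ℝ :=
  (∏ r : Fin k with r.castSucc < j,
      (qtFac q t (nub.1 r - lam.1 j) ((j : ℤ) - r - 1) *
          qtFac q t (lam.1 r.castSucc - lam.1 j - 1) ((j : ℤ) - r + 1)) /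
        (qtFac q t (nub.1 r - lam.1 j - 1) ((j : ℤ) - r) *
          qtFac q t (lam.1 r.castSucc - lam.1 j) ((j : ℤ) - r))) *
    ∏ s : Fin k with j ≤ s.castSucc,
      (qtFac q t (lam.1 j - lam.1 s.succ + 1) ((s : ℤ) - j) *
          qtFac q t (lam.1 j - nub.1 s) ((s : ℤ) - j + 1)) /
        (qtFac q t (lam.1 j - lam.1 s.succ) ((s : ℤ) - j + 1) *
          qtFac q t (lam.1 j - nub.1 s + 1) ((s : ℤ) - j))

/-! ### Multivariate dynamics -/

/-- `W k lam nu lamb`: rate of the independent jump `lam → nu` in row `k+1`, given that row `k`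
is `lamb`. -/
abbrev IndepRates : Type := (k : ℕ) → Sig (k + 1) → Sig (k + 1) → Sig k → ℝ

/-- `V k lam nu lamb nub`: probability that the move `lamb → nub` in row `k` triggers the move
`lam → nu` in row `k+1`. Row `1` has no triggered moves, so `V 0` plays no role. -/
abbrev TrigProbs : Type := (k : ℕ) → Sig (k + 1) → Sig (k + 1) → Sig k → Sig k → ℝ

/-- The standing assumptions on the rates of independent jumps and the probabilities of
triggered moves. Nothing is asked about pairs of rows `lamb, lam` that do not interlace. -/
structure IsAdmissible (N : ℕ) (W : IndepRates) (V : TrigProbs) : Prop where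
  V_nonneg : ∀ k, 1 ≤ k → k < N → ∀ lam nu lamb nub, Interlaces lamb lam →
    0 ≤ V k lam nu lamb nub
  V_le_one : ∀ k, 1 ≤ k → k < N → ∀ lam nu lamb nub, Interlaces lamb lam →
    V k lam nu lamb nub ≤ 1
  V_zero : ∀ k, 1 ≤ k → k < N → ∀ lam nu lamb nub, Interlaces lamb lam →
    ¬ Interlaces nub nu → V k lam nu lamb nub = 0
  V_finite : ∀ k, 1 ≤ k → k < N → ∀ lam lamb nub, Interlaces lamb lam →
    {nu | V k lam nu lamb nub ≠ 0}.Finite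
  V_sum : ∀ k, 1 ≤ k → k < N → ∀ lam lamb nub, Interlaces lamb lam →
    ∑' nu, V k lam nu lamb nub = 1
  V_self : ∀ k, 1 ≤ k → k < N → ∀ lam lamb, Interlaces lamb lam →
    V k lam lam lamb lamb = 1
  V_ne : ∀ k, 1 ≤ k → k < N → ∀ lam nu lamb, Interlaces lamb lam → lam ≠ nu →
    V k lam nu lamb lamb = 0
  W_nonneg : ∀ k < N, ∀ lam nu lamb, Interlaces lamb lam → lam ≠ nu → 0 ≤ W k lam nu lamb
  W_zero : ∀ k < N, ∀ lam nu lamb, Interlaces lamb lam → ¬ Interlaces lamb nu →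
    W k lam nu lamb = 0
  W_finite : ∀ k < N, ∀ lam lamb, Interlaces lamb lam → {nu | W k lam nu lamb ≠ 0}.Finite
  W_sum : ∀ k < N, ∀ lam lamb, Interlaces lamb lam →
    ∑' nu : {nu // nu ≠ lam}, W k lam nu lamb = -W k lam lam lamb

open scoped Classical in
/-- Off-diagonal jump rates on schemes of depth `m`: if row `k+1` is the first one in which `X`
and `Y` differ, the rate is `W k` times the product of all `V i`, `i > k`.
For `X = Y` this is `0`. -/
def offDiagRate (W : IndepRates) (V : TrigProbs) (m : ℕ) (X Y : GTScheme m) : ℝ :=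
  ∑ k : Fin m,
    if (∀ j : Fin (m + 1), j ≤ k.castSucc → X.row j = Y.row j) ∧ X.row k.succ ≠ Y.row k.succ then
      W k (X.row k.succ) (Y.row k.succ) (X.row k.castSucc) *
        ∏ i ∈ Finset.Ioi k,
          V i (X.row i.succ) (Y.row i.succ) (X.row i.castSucc) (Y.row i.castSucc)
    else 0

open scoped Classical in
/-- The matrix of jump rates on schemes of depth `m` (for `m < N`, the `m`-th truncation). -/
def jumpRate (W : IndepRates) (V : TrigProbs) (m : ℕ) (X Y : GTScheme m) : ℝ :=
  if X = Y then -∑' Z : GTScheme m, offDiagRate W V m X Z else offDiagRate W V m X Y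

/-- The projection of the `m`-th truncation to the `m`-th row, when acting on Gibbs measures. -/
def proj (q t : ℝ) (a : ℕ → ℝ) (W : IndepRates) (V : TrigProbs) (m : ℕ) (x y : Sig m) : ℝ :=
  ∑' X : {X : GTScheme m // X.top = x}, ∑' Y : {Y : GTScheme m // Y.top = y},
    jumpRate W V m X.1 Y.1 *
      ∏ i : Fin m, link q t a i (X.1.row i.succ) (X.1.row i.castSucc)

open scoped Classical in
/-- `P` (restricted to times `≥ 0`) is a semigroup of stochastic matrices. -/
structure IsMarkovSemigroup {E : Type} (P : ℝ → E → E → ℝ) : Prop where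
  nonneg : ∀ s, 0 ≤ s → ∀ X Y, 0 ≤ P s X Y
  hasSum_one : ∀ s, 0 ≤ s → ∀ X, HasSum (fun Y => P s X Y) 1
  zero : ∀ X Y, P 0 X Y = if X = Y then 1 else 0
  add : ∀ s r, 0 ≤ s → 0 ≤ r → ∀ X Z, HasSum (fun Y => P s X Y * P r Y Z) (P (s + r) X Z)

open scoped Classical in
/-- `P τ X Y = 1_{X = Y} + Q X Y * τ + o(τ)` as `τ → 0+`. -/
def HasJumpRates {E : Type} (P : ℝ → E → E → ℝ) (Q : E → E → ℝ) : Prop :=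
  ∀ X Y, (fun s : ℝ => P s X Y - (if X = Y then 1 else 0) - Q X Y * s)
    =o[nhdsWithin 0 (Set.Ioi 0)] fun s : ℝ => s

/-- `P` is a multivariate dynamics on interlacing arrays with Macdonald parameters, with rates
of independent jumps `W` and probabilities of triggered moves `V`: a sequential update
continuous-time dynamics whose projections are the univariate dynamics. -/
structure IsMultivariateDynamics (q t : ℝ) (a : ℕ → ℝ) (N : ℕ) (W : IndepRates) (V : TrigProbs)
    (P : ℝ → GTScheme N → GTScheme N → ℝ) : Prop where
  semigroup : IsMarkovSemigroup P
  rates : HasJumpRates P (jumpRate W V N)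
  rates_finite : ∀ X, {Y | jumpRate W V N X Y ≠ 0}.Finite
  rates_bounded : ∃ C, ∀ X Y, |jumpRate W V N X Y| ≤ C
  admissible : IsAdmissible N W V
  W_bounded : ∃ C, ∀ k < N, ∀ lam nu lamb, Interlaces lamb lam → |W k lam nu lamb| ≤ C
  coherent : ∀ k < N, ∀ (x y : Sig (k + 1)) (yb : Sig k), link q t a k y yb ≠ 0 →
    ∑' xb : Sig k, V k x y xb yb * link q t a k x xb * proj q t a W V k xb yb +
        W k x y yb * link q t a k x yb =
      proj q t a W V (k + 1) x y * link q t a k y yb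
  proj_finite : ∀ m, 1 ≤ m → m ≤ N → ∀ x, {y | proj q t a W V m x y ≠ 0}.Finite
  proj_bounded : ∀ m, 1 ≤ m → m ≤ N → ∃ C, ∀ x y, |proj q t a W V m x y| ≤ C
  proj_eq : ∀ m, 1 ≤ m → m ≤ N → ∀ x y, proj q t a W V m x y = univRate q t a m x y

/-! ### The characterizing conditions -/

/-- In each row a move raises one coordinate by one: independent jumps, and moves triggered by
such a move of the row below. -/
def OneParticleMoves (N : ℕ) (W : IndepRates) (V : TrigProbs) : Prop :=
  (∀ k < N, ∀ lam nu lamb, Interlaces lamb lam → lam ≠ nu → (∀ j, ¬ IsAddBox lam nu j) →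
    W k lam nu lamb = 0) ∧
  (∀ k, 1 ≤ k → k < N → ∀ lam nu lamb nub i, Interlaces lamb lam → IsAddBox lamb nub i →
    lam ≠ nu → (∀ j, ¬ IsAddBox lam nu j) → V k lam nu lamb nub = 0)

/-- A move in row `k` that breaks the interlacing pushes the particle above with
probability one. -/
def ShortRangePushing (N : ℕ) (V : TrigProbs) : Prop :=
  ∀ k, 1 ≤ k → k < N → ∀ (lam nu : Sig (k + 1)) (lamb nub : Sig k) (j : Fin k),
    ¬ Interlaces nub lam → IsAddBox lam nu j.castSucc → Interlaces nub nu →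
    IsAddBox lamb nub j → Interlaces lamb lam → V k lam nu lamb nub = 1

open scoped Classical in
/-- The linear identities on the slice formed by rows `k` and `k+1`.
The condition on `r` says `lam_j < nub_{j-1}`. -/
def SliceIdentities (q t : ℝ) (a : ℕ → ℝ) (N : ℕ) (W : IndepRates) (V : TrigProbs) : Prop :=
  ∀ k < N, ∀ (lam nu : Sig (k + 1)) (nub : Sig k) (j : Fin (k + 1)),
    Interlaces nub lam → (∀ r : Fin k, r.succ = j → lam.1 j < nub.1 r) → IsAddBox lam nu j →
    (∑ i : Fin k,
        if h : Antitone (nub.1 - Pi.single i 1) then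
          V k lam nu ⟨nub.1 - Pi.single i 1, h⟩ nub * Tcoef q t nub lam i
        else 0) +
      (a k)⁻¹ * W k lam nu nub = Scoef q t nub lam j

end

end MacdonaldDynamics

namespace MacdonaldDynamics

/-! ### The function `f` and the factors `1 - q^m t^n` -/

/-! Everything happens on a slice formed by two adjacent rows. Since the links are stochastic,
summing the left side of the coherence relation over `yb` gives exactly the projection one level up
(`IsAdmissible.proj_succ`). By induction on the level, coherence together with univariate
projections therefore amounts to `SliceCoherent` on every slice, that is, the coherence relation
with univariate rates in place of the projections. For given `x`, `y`, `yb` this relation is then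
compared with the three conditions, according to the type of `y`.

If `y` is neither `x` nor some `x + e_j`, the right side is 0 and the left side is a sum of
nonnegative terms in which the links and the one-box rates are positive, so every `W` and `V` in it
vanishes: condition 0. If `y = x + e_j` and `yb ≺ x`, division by `a k * link q t a k x yb` turns
the ratios of ψ and ψ' into T_i and S_j, and the relation becomes condition 2. If `y = x + e_j` but
`yb` does not interlace with `x`, the independent jump has zero link and a single row `xb`
contributes; the remaining coefficients on the two sides agree (`psi_mul_psiPrime_push`), so the
relation says that `V = 1`: condition 1. The case `y = x` needs no condition of its own: summing
over all `y`, where `V` has total mass 1 and `W` total mass 0, derives it from the other cases and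
the fact that the links intertwine the univariate rates (`sum_univRate_mul_link`).

The intertwining is the commutation of the Pieri operators with the branching operators
(`sum_pieri_mul_skewP`). For `yb ≺ x` all its terms are multiples of one skew polynomial, and what
remains is ∑ S_j − ∑ T_i = 1 (`sum_Scoef_sub_sum_Tcoef`): a residue identity for a rational function
with poles at 0, at the points q^{λ_j} t^{-j} and at q^{μ_i − 1} t^{-i}, proved for generic
parameters and extended by continuity. The same commutation yields the Pieri rule by induction on
the number of variables, so the univariate exit rate is the sum of the parameters and is bounded.

The process itself exists because in condition 2 all terms are nonnegative and S_j is bounded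
uniformly in the signatures. Hence `W`, and with it the whole rate matrix, is bounded, and a bounded
rate matrix with zero row sums generates a stochastic semigroup: run a discrete chain at Poisson
times (`exists_semigroup`). -/

theorem summable_norm_mul_pow {q : ℝ} (hq0 : 0 ≤ q) (hq1 : q < 1) (u : ℝ) :
    Summable fun n : ℕ => ‖-(u * q ^ n)‖ := by
  have := (summable_geometric_of_lt_one hq0 hq1).mul_left |u|
  refine this.congr fun n => ?_
  simp [abs_of_nonneg hq0]

theorem qPochInf_eq_mul {q : ℝ} (hq0 : 0 ≤ q) (hq1 : q < 1) (u : ℝ) :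
    qPochInf q u = (1 - u) * qPochInf q (q * u) := by
  have hs : Multipliable fun n : ℕ => 1 - u * q * q ^ n := by
    simp only [sub_eq_add_neg]
    exact multipliable_one_add_of_summable (summable_norm_mul_pow hq0 hq1 (u * q))
  have e : ∀ n : ℕ, 1 - u * q * q ^ n = 1 - u * q ^ (n + 1) := fun n => by ring
  have h := tprod_eq_zero_mul' (f := fun n : ℕ => 1 - u * q ^ n) (by simpa only [e] using hs)
  rw [qPochInf, h, qPochInf]
  simp only [pow_zero, mul_one, mul_comm q u, e]

/-- All factors are positive and their logarithms are summable, so the product is an exponential. -/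
theorem qPochInf_pos {q u : ℝ} (hq0 : 0 ≤ q) (hq1 : q < 1) (hu : u < 1) :
    0 < qPochInf q u := by
  have hpos : ∀ n : ℕ, 0 < 1 + -(u * q ^ n) := by
    intro n
    have h0 : 0 ≤ q ^ n := pow_nonneg hq0 n
    have h1 : q ^ n ≤ 1 := pow_le_one₀ hq0 hq1.le
    rcases le_total u 0 with h | h
    · nlinarith [mul_nonneg (neg_nonneg.2 h) h0]
    · nlinarith [mul_le_mul_of_nonneg_left h1 h]
  have hlog : Summable fun n : ℕ => Real.log (1 + -(u * q ^ n)) :=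
    Real.summable_log_one_add_of_summable (summable_norm_mul_pow hq0 hq1 u).of_norm
  have := Real.rexp_tsum_eq_tprod hpos hlog
  unfold qPochInf
  simp only [sub_eq_add_neg]
  rw [← this]
  exact Real.exp_pos _

theorem fMac_pos {q t u : ℝ} (hq0 : 0 ≤ q) (hq1 : q < 1) (ht0 : 0 ≤ t) (ht1 : t < 1)
    (hu1 : u ≤ 1) : 0 < fMac q t u :=
  div_pos (qPochInf_pos hq0 hq1 ((mul_le_of_le_one_right ht0 hu1).trans_lt ht1))
    (qPochInf_pos hq0 hq1 ((mul_le_of_le_one_right hq0 hu1).trans_lt hq1))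

/-- Peeling the first factor off both Pochhammer symbols moves u to q u. This is the only property
of f, besides positivity, that enters the ratios of ψ. -/
theorem fMac_eq_mul {q t u : ℝ} (hq0 : 0 ≤ q) (hq1 : q < 1) :
    fMac q t u = (1 - t * u) / (1 - q * u) * fMac q t (q * u) := by
  unfold fMac
  rw [qPochInf_eq_mul hq0 hq1 (t * u), qPochInf_eq_mul hq0 hq1 (q * u), mul_left_comm q t u,
    div_mul_div_comm]

theorem zpow_mul_zpow_nonneg {q t : ℝ} (hq0 : 0 ≤ q) (ht0 : 0 ≤ t) (m n : ℤ) :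
    0 ≤ q ^ m * t ^ n := by positivity

theorem zpow_le_one_of_nonneg_exp {q : ℝ} (hq0 : 0 ≤ q) (hq1 : q < 1) {m : ℤ} (hm : 0 ≤ m) :
    q ^ m ≤ 1 := by
  lift m to ℕ using hm
  rw [zpow_natCast]
  exact pow_le_one₀ hq0 hq1.le

theorem zpow_le_self {q : ℝ} (hq0 : 0 ≤ q) (hq1 : q < 1) {m : ℤ} (hm : 1 ≤ m) :
    q ^ m ≤ q := by
  lift m to ℕ using by lia
  rw [zpow_natCast]
  exact pow_le_of_le_one hq0 hq1.le (by lia)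

theorem zpow_mul_zpow_le_one {q t : ℝ} (hq0 : 0 ≤ q) (hq1 : q < 1) (ht0 : 0 ≤ t) (ht1 : t < 1)
    {m n : ℤ} (hm : 0 ≤ m) (hn : 0 ≤ n) : q ^ m * t ^ n ≤ 1 :=
  mul_le_one₀ (zpow_le_one_of_nonneg_exp hq0 hq1 hm) (zpow_nonneg ht0 n) (zpow_le_one_of_nonneg_exp ht0 ht1 hn)

theorem qtFac_nonneg {q t : ℝ} (hq0 : 0 ≤ q) (hq1 : q < 1) (ht0 : 0 ≤ t) (ht1 : t < 1)
    {m n : ℤ} (hm : 0 ≤ m) (hn : 0 ≤ n) : 0 ≤ qtFac q t m n :=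
  sub_nonneg.2 (zpow_mul_zpow_le_one hq0 hq1 ht0 ht1 hm hn)

theorem qtFac_le_one {q t : ℝ} (hq0 : 0 ≤ q) (ht0 : 0 ≤ t) (m n : ℤ) : qtFac q t m n ≤ 1 :=
  sub_le_self _ (zpow_mul_zpow_nonneg hq0 ht0 m n)

/-- The bound is independent of the exponents; every uniform estimate on the rates goes back to it.
-/
theorem le_qtFac {q t : ℝ} (hq0 : 0 ≤ q) (hq1 : q < 1) (ht0 : 0 ≤ t) (ht1 : t < 1)
    {m n : ℤ} (hm : 0 ≤ m) (hn : 0 ≤ n) (h : 1 ≤ m ∨ 1 ≤ n) :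
    (1 - q) * (1 - t) ≤ qtFac q t m n := by
  have hqm := zpow_le_one_of_nonneg_exp hq0 hq1 hm
  have htn := zpow_le_one_of_nonneg_exp ht0 ht1 hn
  have hqm0 : 0 ≤ q ^ m := zpow_nonneg hq0 m
  have htn0 : 0 ≤ t ^ n := zpow_nonneg ht0 n
  unfold qtFac
  rcases h with h | h
  · have := zpow_le_self hq0 hq1 h
    nlinarith
  · have := zpow_le_self ht0 ht1 h
    nlinarith

theorem qtFac_pos {q t : ℝ} (hq0 : 0 ≤ q) (hq1 : q < 1) (ht0 : 0 ≤ t) (ht1 : t < 1)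
    {m n : ℤ} (hm : 0 ≤ m) (hn : 0 ≤ n) (h : 1 ≤ m ∨ 1 ≤ n) : 0 < qtFac q t m n :=
  (mul_pos (sub_pos.2 hq1) (sub_pos.2 ht1)).trans_le (le_qtFac hq0 hq1 ht0 ht1 hm hn h)

@[simp]
theorem qtFac_zero_zero (q t : ℝ) : qtFac q t 0 0 = 0 := by simp [qtFac]

/-- The value q = 0 is allowed, so the exponent has to be nonnegative: at m = -1 the two sides would
be 1 and 0. -/
theorem zpow_succ_of_nonneg (q : ℝ) {m : ℤ} (hm : 0 ≤ m) : q ^ (m + 1) = q * q ^ m := by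
  lift m to ℕ using hm
  rw [← Nat.cast_succ, zpow_natCast, zpow_natCast, pow_succ']

/-- The basic recursion for `f` at the points `q^m t^n`. -/
theorem fMac_zpow_succ {q t : ℝ} (hq0 : 0 ≤ q) (hq1 : q < 1) (ht0 : 0 ≤ t) (ht1 : t < 1)
    {m n : ℤ} (hm : 0 ≤ m) (hn : 0 ≤ n) :
    fMac q t (q ^ (m + 1) * t ^ n) =
      fMac q t (q ^ m * t ^ n) * (qtFac q t (m + 1) n / qtFac q t m (n + 1)) := by
  rw [fMac_eq_mul hq0 hq1 (u := q ^ m * t ^ n)]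
  have e1 : 1 - t * (q ^ m * t ^ n) = qtFac q t m (n + 1) := by
    rw [qtFac, zpow_succ_of_nonneg t hn]; ring
  have e2 : 1 - q * (q ^ m * t ^ n) = qtFac q t (m + 1) n := by
    rw [qtFac, zpow_succ_of_nonneg q hm]; ring
  have e3 : q * (q ^ m * t ^ n) = q ^ (m + 1) * t ^ n := by
    rw [zpow_succ_of_nonneg q hm]; ring
  have h1 := (qtFac_pos hq0 hq1 ht0 ht1 hm (by lia : 0 ≤ n + 1) (by lia)).ne'
  have h2 := (qtFac_pos hq0 hq1 ht0 ht1 (by lia : 0 ≤ m + 1) hn (by lia)).ne'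
  rw [e1, e2, e3]
  field_simp

theorem fMac_zpow_pos {q t : ℝ} (hq0 : 0 ≤ q) (hq1 : q < 1) (ht0 : 0 ≤ t) (ht1 : t < 1)
    {m n : ℤ} (hm : 0 ≤ m) (hn : 0 ≤ n) : 0 < fMac q t (q ^ m * t ^ n) :=
  fMac_pos hq0 hq1 ht0 ht1
    (zpow_mul_zpow_le_one hq0 hq1 ht0 ht1 hm hn)

/-! ### Interlacing -/

theorem Interlaces.le_castSucc {k : ℕ} {mu : Sig k} {lam : Sig (k + 1)} (h : Interlaces mu lam)
    {i j : Fin k} (hij : i ≤ j) : mu.1 j ≤ lam.1 i.castSucc :=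
  (mu.2 hij).trans (h i).2

theorem Interlaces.succ_le {k : ℕ} {mu : Sig k} {lam : Sig (k + 1)} (h : Interlaces mu lam)
    {i j : Fin k} (hij : i ≤ j) : lam.1 j.succ ≤ mu.1 i :=
  (h j).1.trans (mu.2 hij)

theorem Interlaces.succ_le_castSucc {k : ℕ} {mu : Sig k} {lam : Sig (k + 1)}
    (h : Interlaces mu lam) {i j : Fin k} (hij : i ≤ j) : lam.1 j.succ ≤ lam.1 i.castSucc :=
  (h.succ_le hij).trans (h i).2

/-- Interlacing makes every exponent in ψ nonnegative, so f is evaluated only at points of [0, 1],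
where it is positive. -/
theorem psi_pos {q t : ℝ} (hq0 : 0 ≤ q) (hq1 : q < 1) (ht0 : 0 ≤ t) (ht1 : t < 1) {k : ℕ}
    {mu : Sig k} {lam : Sig (k + 1)} (h : Interlaces mu lam) : 0 < psi q t lam mu := by
  refine Finset.prod_pos fun i _ => Finset.prod_pos fun j hj => ?_
  have hij : i ≤ j := Finset.mem_Ici.1 hj
  have hn : (0 : ℤ) ≤ (j : ℤ) - i := by have : (i : ℕ) ≤ j := hij; lia
  have h1 := mu.2 hij
  have h2 := h.le_castSucc hij
  have h3 := h.succ_le hij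
  have h4 := h.succ_le_castSucc hij
  have p : ∀ m : ℤ, 0 ≤ m → 0 < fMac q t (q ^ m * t ^ ((j : ℤ) - i)) :=
    fun m hm => fMac_zpow_pos hq0 hq1 ht0 ht1 hm hn
  exact div_pos (mul_pos (p _ (by lia)) (p _ (by lia))) (mul_pos (p _ (by lia)) (p _ (by lia)))

theorem IsAddBox.apply_self {k : ℕ} {mu lam : Sig k} {j : Fin k} (h : IsAddBox mu lam j) :
    lam.1 j = mu.1 j + 1 := by
  rw [show lam.1 = _ from h]; simp

theorem IsAddBox.apply_ne {k : ℕ} {mu lam : Sig k} {j : Fin k} (h : IsAddBox mu lam j)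
    {i : Fin k} (hi : i ≠ j) : lam.1 i = mu.1 i := by
  rw [show lam.1 = _ from h]; simp [hi]

/-- The exponent of t in the first numerator factor is 0 when i = j - 1, but then the exponent of q
is at least 1, because `lam` is a signature and `mu` has one box less at j. -/
theorem psiPrime_pos {q t : ℝ} (hq0 : 0 ≤ q) (hq1 : q < 1) (ht0 : 0 ≤ t) (ht1 : t < 1) {k : ℕ}
    {mu lam : Sig k} {j : Fin k} (h : IsAddBox mu lam j) : 0 < psiPrime q t lam mu j := by
  refine Finset.prod_pos fun i hi => ?_
  have hij : i < j := Finset.mem_Iio.1 hi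
  have hn : (i : ℕ) < j := hij
  have h1 := lam.2 hij.le
  have h2 := h.apply_self
  have h3 := h.apply_ne hij.ne
  have p : ∀ m n : ℤ, 0 ≤ m → 0 ≤ n → (1 ≤ m ∨ 1 ≤ n) → 0 < qtFac q t m n :=
    fun m n => qtFac_pos hq0 hq1 ht0 ht1
  exact div_pos (mul_pos (p _ _ (by lia) (by lia) (by lia)) (p _ _ (by lia) (by lia) (by lia)))
    (mul_pos (p _ _ (by lia) (by lia) (by lia)) (p _ _ (by lia) (by lia) (by lia)))

end MacdonaldDynamics

namespace MacdonaldDynamics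

/-! ### Ratios of the coefficients `ψ` -/

/-- Changing the c-th coordinate of the lower signature affects only row c and column c of the
double product ψ. They meet in the diagonal entry, which collects both `u c` and `v c`. -/
theorem prod_Ici_row_col {k : ℕ} (c : Fin k) (u v : Fin k → ℝ) :
    ∏ i : Fin k, ∏ j ∈ Finset.Ici i,
        ((if i = c then u j else 1) * (if j = c then v i else 1)) =
      (∏ j ∈ Finset.Ici c, u j) * ∏ i ∈ Finset.Iic c, v i := by
  simp only [Finset.prod_mul_distrib]
  congr 1
  · rw [Finset.prod_eq_single c]
    · simp
    · intro i _ hi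
      simp [hi]
    · simp
  · simp only [Finset.prod_ite_eq', Finset.mem_Ici]
    rw [← Finset.prod_filter]
    refine Finset.prod_congr ?_ fun _ _ => rfl
    ext i; simp

/-- The analogue for the upper signature, whose coordinate c enters row i with i = c and column j
with j + 1 = c. These do not meet within i ≤ j; the last coordinate has no row and the first one has
no column. -/
theorem prod_Ici_castSucc_succ {k : ℕ} (c : Fin (k + 1)) (u v : Fin k → ℝ) :
    ∏ i : Fin k, ∏ j ∈ Finset.Ici i,
        ((if i.castSucc = c then u j else 1) * (if j.succ = c then v i else 1)) =
      (∏ j : Fin k with c ≤ j.castSucc, u j) * ∏ i : Fin k with i.castSucc < c, v i := by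
  simp only [Finset.prod_mul_distrib]
  congr 1
  · refine Fin.lastCases ?_ (fun c => ?_) c
    · have h1 : ∀ i : Fin k, i.castSucc ≠ Fin.last k := fun i => (Fin.castSucc_lt_last i).ne
      have h2 : ∀ i : Fin k, ¬ Fin.last k ≤ i.castSucc :=
        fun i => not_le.2 (Fin.castSucc_lt_last i)
      simp [h1, h2]
    · rw [Finset.prod_eq_single c]
      · simp only [if_true, Fin.castSucc_le_castSucc_iff]
        refine Finset.prod_congr ?_ fun _ _ => rfl
        ext i; simp
      · intro i _ hi
        simp [hi]
      · simp
  · refine Fin.cases ?_ (fun c => ?_) c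
    · simp [Fin.succ_ne_zero]
    · simp only [Fin.succ_inj, Finset.prod_ite_eq', Finset.mem_Ici]
      rw [← Finset.prod_filter]
      refine Finset.prod_congr ?_ fun _ _ => rfl
      ext i; simp [Fin.castSucc_lt_succ_iff]

section

variable {q t : ℝ}

/-- Lowering one coordinate of the lower signature. -/
theorem psi_mul_psiPrime_eq_Tcoef_mul (hq0 : 0 ≤ q) (hq1 : q < 1) (ht0 : 0 ≤ t) (ht1 : t < 1)
    {k : ℕ} {mu' mu : Sig k} {lam : Sig (k + 1)} {c : Fin k}
    (hbox : IsAddBox mu' mu c) (h' : Interlaces mu' lam) (h : Interlaces mu lam) :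
    psi q t lam mu' * psiPrime q t mu mu' c = Tcoef q t mu lam c * psi q t lam mu := by
  set g : ℤ → ℤ → ℝ := fun m n => fMac q t (q ^ m * t ^ n) with hg
  have gs : ∀ {m n : ℤ}, 0 ≤ m → 0 ≤ n →
      g (m + 1) n = g m n * (qtFac q t (m + 1) n / qtFac q t m (n + 1)) :=
    fun hm hn => fMac_zpow_succ hq0 hq1 ht0 ht1 hm hn
  have gp : ∀ {m n : ℤ}, 0 ≤ m → 0 ≤ n → g m n ≠ 0 :=
    fun hm hn => (fMac_zpow_pos hq0 hq1 ht0 ht1 hm hn).ne'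
  have Qp : ∀ {m n : ℤ}, 0 ≤ m → 0 ≤ n → (1 ≤ m ∨ 1 ≤ n) → qtFac q t m n ≠ 0 :=
    fun hm hn h => (qtFac_pos hq0 hq1 ht0 ht1 hm hn h).ne'
  have hc : mu'.1 c = mu.1 c - 1 := by have := hbox.apply_self; omega
  have hne : ∀ {i}, i ≠ c → mu'.1 i = mu.1 i := fun hi => (hbox.apply_ne hi).symm
  -- `u` and `v` are the corrections to row c and column c produced by one step of the recursion for
  -- f. The correction of the diagonal entry is split between `u c` and `v c`.
  set u : Fin k → ℝ := fun s =>
    if s = c then qtFac q t (mu.1 c - lam.1 c.succ) 0 / qtFac q t (mu.1 c - 1 - lam.1 c.succ) 1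
    else (qtFac q t (mu.1 c - mu.1 s - 1) ((s : ℤ) - c + 1) *
          qtFac q t (mu.1 c - lam.1 s.succ) ((s : ℤ) - c)) /
        (qtFac q t (mu.1 c - mu.1 s) ((s : ℤ) - c) *
          qtFac q t (mu.1 c - lam.1 s.succ - 1) ((s : ℤ) - c + 1)) with hu
  set v : Fin k → ℝ := fun r =>
    if r = c then qtFac q t (lam.1 c.castSucc - mu.1 c) 1 /
      qtFac q t (lam.1 c.castSucc - mu.1 c + 1) 0
    else (qtFac q t (lam.1 r.castSucc - mu.1 c) ((c : ℤ) - r + 1) *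
          qtFac q t (mu.1 r - mu.1 c + 1) ((c : ℤ) - r)) /
        (qtFac q t (lam.1 r.castSucc - mu.1 c + 1) ((c : ℤ) - r) *
          qtFac q t (mu.1 r - mu.1 c) ((c : ℤ) - r + 1)) with hv
  have key : psi q t lam mu' =
      psi q t lam mu * ((∏ j ∈ Finset.Ici c, u j) * ∏ i ∈ Finset.Iic c, v i) := by
    rw [← prod_Ici_row_col, psi, psi, ← Finset.prod_mul_distrib]
    refine Finset.prod_congr rfl fun i _ => ?_
    rw [← Finset.prod_mul_distrib]
    refine Finset.prod_congr rfl fun j hj => ?_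
    have hij : i ≤ j := Finset.mem_Ici.1 hj
    have hn : (0 : ℤ) ≤ (j : ℤ) - i := by have : (i : ℕ) ≤ j := hij; omega
    change (g (mu'.1 i - mu'.1 j) (j - i) * g (lam.1 i.castSucc - lam.1 j.succ) (j - i)) /
        (g (lam.1 i.castSucc - mu'.1 j) (j - i) * g (mu'.1 i - lam.1 j.succ) (j - i)) =
      (g (mu.1 i - mu.1 j) (j - i) * g (lam.1 i.castSucc - lam.1 j.succ) (j - i)) /
        (g (lam.1 i.castSucc - mu.1 j) (j - i) * g (mu.1 i - lam.1 j.succ) (j - i)) * _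
    have b1 := mu.2 hij
    have b2 := h.le_castSucc hij
    have b3 := h.succ_le hij
    have b4 := h.succ_le_castSucc hij
    have c1 := mu'.2 hij
    have c2 := h'.le_castSucc hij
    have c3 := h'.succ_le hij
    have p4 := gp (show 0 ≤ lam.1 i.castSucc - lam.1 j.succ by omega) hn
    have p1 := gp (show 0 ≤ mu.1 i - mu.1 j by omega) hn
    have p2 := gp (show 0 ≤ lam.1 i.castSucc - mu.1 j by omega) hn
    have p3 := gp (show 0 ≤ mu.1 i - lam.1 j.succ by omega) hn
    have r1 := gp (show 0 ≤ mu'.1 i - mu'.1 j by omega) hn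
    have r2 := gp (show 0 ≤ lam.1 i.castSucc - mu'.1 j by omega) hn
    have r3 := gp (show 0 ≤ mu'.1 i - lam.1 j.succ by omega) hn
    -- Diagonal entry, rest of row c, rest of column c, and the remaining entries, which do not
    -- change.
    by_cases hi : i = c
    · subst hi
      by_cases hj : j = i
      · subst hj
        simp only [hu, hv, if_true, sub_self] at *
        have e2 := gs (show 0 ≤ lam.1 j.castSucc - mu.1 j by omega) le_rfl
        have e3 := gs (show 0 ≤ mu'.1 j - lam.1 j.succ by omega) le_rfl
        rw [show lam.1 j.castSucc - mu'.1 j = lam.1 j.castSucc - mu.1 j + 1 by omega, e2,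
          show mu.1 j - lam.1 j.succ = mu'.1 j - lam.1 j.succ + 1 by omega, e3,
          show mu.1 j - 1 - lam.1 j.succ = mu'.1 j - lam.1 j.succ by omega, zero_add]
        have q1 := Qp (show 0 ≤ lam.1 j.castSucc - mu.1 j by omega) (zero_le_one) (by omega)
        have q2 := Qp (show 0 ≤ lam.1 j.castSucc - mu.1 j + 1 by omega) le_rfl (by omega)
        have q3 := Qp (show 0 ≤ mu'.1 j - lam.1 j.succ by omega) (zero_le_one) (by omega)
        have q4 := Qp (show 0 ≤ mu'.1 j - lam.1 j.succ + 1 by omega) le_rfl (by omega)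
        field_simp
      · have hj' := hne hj
        simp only [hu, hj, if_true, if_false, mul_one]
        have e1 := gs (show 0 ≤ mu'.1 i - mu'.1 j by omega) hn
        have e3 := gs (show 0 ≤ mu'.1 i - lam.1 j.succ by omega) hn
        rw [hj'] at c1 c2 e1 r1 r2 ⊢
        rw [show mu.1 i - mu.1 j = mu'.1 i - mu.1 j + 1 by omega, e1,
          show mu.1 i - lam.1 j.succ = mu'.1 i - lam.1 j.succ + 1 by omega, e3,
          show mu'.1 i - mu.1 j + 1 - 1 = mu'.1 i - mu.1 j by omega,
          show mu'.1 i - lam.1 j.succ + 1 - 1 = mu'.1 i - lam.1 j.succ by omega]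
        have q1 := Qp (show 0 ≤ mu'.1 i - mu.1 j by omega) (show 0 ≤ (j : ℤ) - i + 1 by omega) (by omega)
        have q2 := Qp (show 0 ≤ mu'.1 i - mu.1 j + 1 by omega) hn (by omega)
        have q3 := Qp (show 0 ≤ mu'.1 i - lam.1 j.succ by omega)
          (show 0 ≤ (j : ℤ) - i + 1 by omega) (by omega)
        have q4 := Qp (show 0 ≤ mu'.1 i - lam.1 j.succ + 1 by omega) hn (by omega)
        field_simp
    · by_cases hj : j = c
      · subst hj
        have hi' := hne hi
        simp only [hv, hi, if_true, if_false, one_mul]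
        have e1 := gs (show 0 ≤ mu.1 i - mu.1 j by omega) hn
        have e2 := gs (show 0 ≤ lam.1 i.castSucc - mu.1 j by omega) hn
        rw [hi', show mu.1 i - mu'.1 j = mu.1 i - mu.1 j + 1 by omega, e1,
          show lam.1 i.castSucc - mu'.1 j = lam.1 i.castSucc - mu.1 j + 1 by omega, e2]
        have q1 := Qp (show 0 ≤ mu.1 i - mu.1 j by omega) (show 0 ≤ (j : ℤ) - i + 1 by omega) (by omega)
        have q2 := Qp (show 0 ≤ mu.1 i - mu.1 j + 1 by omega) hn (by omega)
        have q3 := Qp (show 0 ≤ lam.1 i.castSucc - mu.1 j by omega)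
          (show 0 ≤ (j : ℤ) - i + 1 by omega) (by omega)
        have q4 := Qp (show 0 ≤ lam.1 i.castSucc - mu.1 j + 1 by omega) hn (by omega)
        field_simp
      · simp [hi, hj, hne]
  rw [key, ← Finset.mul_prod_Ioi_eq_prod_Ici, ← Finset.mul_prod_Iio_eq_prod_Iic]
  have eu : ∏ s ∈ Finset.Ioi c, u s = ∏ s ∈ Finset.Ioi c,
      (qtFac q t (mu.1 c - mu.1 s - 1) ((s : ℤ) - c + 1) *
          qtFac q t (mu.1 c - lam.1 s.succ) ((s : ℤ) - c)) /
        (qtFac q t (mu.1 c - mu.1 s) ((s : ℤ) - c) *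
          qtFac q t (mu.1 c - lam.1 s.succ - 1) ((s : ℤ) - c + 1)) :=
    Finset.prod_congr rfl fun s hs => by simp [hu, (Finset.mem_Ioi.1 hs).ne']
  -- Two factors of `v r` cancel against ψ', which lowers the remaining powers of t to those in T_c.
  have ev : (∏ r ∈ Finset.Iio c, v r) * psiPrime q t mu mu' c = ∏ r ∈ Finset.Iio c,
      (qtFac q t (lam.1 r.castSucc - mu.1 c) ((c : ℤ) - r + 1) *
          qtFac q t (mu.1 r - mu.1 c + 1) ((c : ℤ) - r - 1)) /
        (qtFac q t (lam.1 r.castSucc - mu.1 c + 1) ((c : ℤ) - r) *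
          qtFac q t (mu.1 r - mu.1 c) ((c : ℤ) - r)) := by
    rw [psiPrime, ← Finset.prod_mul_distrib]
    refine Finset.prod_congr rfl fun r hr => ?_
    have hr : r < c := Finset.mem_Iio.1 hr
    have hr' : (r : ℕ) < c := hr
    have b1 := mu.2 hr.le
    have b2 := h.le_castSucc hr.le
    simp only [hv, hr.ne, if_false]
    rw [hne hr.ne, hc, show mu.1 r - (mu.1 c - 1) = mu.1 r - mu.1 c + 1 by omega]
    have q1 := Qp (show 0 ≤ mu.1 r - mu.1 c by omega) (show 0 ≤ (c : ℤ) - r + 1 by omega) (by omega)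
    have q2 := Qp (show 0 ≤ mu.1 r - mu.1 c + 1 by omega) (show 0 ≤ (c : ℤ) - r by omega) (by omega)
    have q3 := Qp (show 0 ≤ mu.1 r - mu.1 c by omega) (show 0 ≤ (c : ℤ) - r by omega) (by omega)
    have q4 := Qp (show 0 ≤ lam.1 r.castSucc - mu.1 c + 1 by omega)
      (show 0 ≤ (c : ℤ) - r by omega) (by omega)
    field_simp
  have euc : u c * v c =
      (qtFac q t (lam.1 c.castSucc - mu.1 c) 1 * qtFac q t (mu.1 c - lam.1 c.succ) 0) /
      (qtFac q t (lam.1 c.castSucc - mu.1 c + 1) 0 * qtFac q t (mu.1 c - 1 - lam.1 c.succ) 1) := by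
    simp only [hu, hv, if_true]
    rw [div_mul_div_comm, mul_comm (qtFac q t (mu.1 c - lam.1 c.succ) 0),
      mul_comm (qtFac q t (mu.1 c - 1 - lam.1 c.succ) 1)]
  rw [Tcoef, ← euc, ← ev, ← eu]
  ring

/-- Raising one coordinate of the upper signature. -/
theorem psiPrime_mul_psi_eq_Scoef_mul (hq0 : 0 ≤ q) (hq1 : q < 1) (ht0 : 0 ≤ t) (ht1 : t < 1)
    {k : ℕ} {mu : Sig k} {lam nu : Sig (k + 1)} {c : Fin (k + 1)}
    (hbox : IsAddBox lam nu c) (h : Interlaces mu lam) (h' : Interlaces mu nu) :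
    psiPrime q t nu lam c * psi q t nu mu = Scoef q t mu lam c * psi q t lam mu := by
  set g : ℤ → ℤ → ℝ := fun m n => fMac q t (q ^ m * t ^ n) with hg
  have gs : ∀ {m n : ℤ}, 0 ≤ m → 0 ≤ n →
      g (m + 1) n = g m n * (qtFac q t (m + 1) n / qtFac q t m (n + 1)) :=
    fun hm hn => fMac_zpow_succ hq0 hq1 ht0 ht1 hm hn
  have gp : ∀ {m n : ℤ}, 0 ≤ m → 0 ≤ n → g m n ≠ 0 :=
    fun hm hn => (fMac_zpow_pos hq0 hq1 ht0 ht1 hm hn).ne'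
  have Qp : ∀ {m n : ℤ}, 0 ≤ m → 0 ≤ n → (1 ≤ m ∨ 1 ≤ n) → qtFac q t m n ≠ 0 :=
    fun hm hn h => (qtFac_pos hq0 hq1 ht0 ht1 hm hn h).ne'
  have hc : nu.1 c = lam.1 c + 1 := hbox.apply_self
  have hne : ∀ {i}, i ≠ c → nu.1 i = lam.1 i := fun hi => hbox.apply_ne hi
  set u : Fin k → ℝ := fun s =>
    (qtFac q t (lam.1 c - lam.1 s.succ + 1) ((s : ℤ) - c) *
          qtFac q t (lam.1 c - mu.1 s) ((s : ℤ) - c + 1)) /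
        (qtFac q t (lam.1 c - lam.1 s.succ) ((s : ℤ) - c + 1) *
          qtFac q t (lam.1 c - mu.1 s + 1) ((s : ℤ) - c)) with hu
  set v : Fin k → ℝ := fun r =>
    (qtFac q t (mu.1 r - lam.1 c) ((c : ℤ) - r - 1) *
          qtFac q t (lam.1 r.castSucc - lam.1 c - 1) ((c : ℤ) - r)) /
        (qtFac q t (mu.1 r - lam.1 c - 1) ((c : ℤ) - r) *
          qtFac q t (lam.1 r.castSucc - lam.1 c) ((c : ℤ) - r - 1)) with hv
  have key : psi q t nu mu =
      psi q t lam mu * ((∏ j : Fin k with c ≤ j.castSucc, u j) *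
        ∏ i : Fin k with i.castSucc < c, v i) := by
    rw [← prod_Ici_castSucc_succ, psi, psi, ← Finset.prod_mul_distrib]
    refine Finset.prod_congr rfl fun i _ => ?_
    rw [← Finset.prod_mul_distrib]
    refine Finset.prod_congr rfl fun j hj => ?_
    have hij : i ≤ j := Finset.mem_Ici.1 hj
    have hij' : (i : ℕ) ≤ j := hij
    have hn : (0 : ℤ) ≤ (j : ℤ) - i := by omega
    change (g (mu.1 i - mu.1 j) (j - i) * g (nu.1 i.castSucc - nu.1 j.succ) (j - i)) /
        (g (nu.1 i.castSucc - mu.1 j) (j - i) * g (mu.1 i - nu.1 j.succ) (j - i)) =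
      (g (mu.1 i - mu.1 j) (j - i) * g (lam.1 i.castSucc - lam.1 j.succ) (j - i)) /
        (g (lam.1 i.castSucc - mu.1 j) (j - i) * g (mu.1 i - lam.1 j.succ) (j - i)) * _
    have b1 := mu.2 hij
    have b2 := h.le_castSucc hij
    have b3 := h.succ_le hij
    have b4 := h.succ_le_castSucc hij
    have c2 := h'.le_castSucc hij
    have c3 := h'.succ_le hij
    have c4 := h'.succ_le_castSucc hij
    have p1 := gp (show 0 ≤ mu.1 i - mu.1 j by omega) hn
    have p4 := gp (show 0 ≤ lam.1 i.castSucc - lam.1 j.succ by omega) hn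
    have p2 := gp (show 0 ≤ lam.1 i.castSucc - mu.1 j by omega) hn
    have p3 := gp (show 0 ≤ mu.1 i - lam.1 j.succ by omega) hn
    have r4 := gp (show 0 ≤ nu.1 i.castSucc - nu.1 j.succ by omega) hn
    have r2 := gp (show 0 ≤ nu.1 i.castSucc - mu.1 j by omega) hn
    have r3 := gp (show 0 ≤ mu.1 i - nu.1 j.succ by omega) hn
    by_cases hi : i.castSucc = c
    · have hic : (c : ℕ) = i := by rw [← hi]; rfl
      have hj : j.succ ≠ c := by
        intro h
        have : (j : ℕ) + 1 = c := by rw [← h]; rfl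
        omega
      have hj' := hne hj
      simp only [hu, hi, hj, if_true, if_false, mul_one, hic]
      rw [hi] at p4 p2 r4 r2 c2 c4 b2 b4
      have e1 := gs (show 0 ≤ lam.1 c - lam.1 j.succ by omega) hn
      have e2 := gs (show 0 ≤ lam.1 c - mu.1 j by omega) hn
      rw [hc, hj', show lam.1 c + 1 - lam.1 j.succ = lam.1 c - lam.1 j.succ + 1 by omega, e1,
        show lam.1 c + 1 - mu.1 j = lam.1 c - mu.1 j + 1 by omega, e2]
      have q1 := Qp (show 0 ≤ lam.1 c - lam.1 j.succ by omega)
        (show 0 ≤ (j : ℤ) - i + 1 by omega) (by omega)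
      have q2 := Qp (show 0 ≤ lam.1 c - lam.1 j.succ + 1 by omega) hn (by omega)
      have q3 := Qp (show 0 ≤ lam.1 c - mu.1 j by omega)
        (show 0 ≤ (j : ℤ) - i + 1 by omega) (by omega)
      have q4 := Qp (show 0 ≤ lam.1 c - mu.1 j + 1 by omega) hn (by omega)
      field_simp
    · by_cases hj : j.succ = c
      · have hjc : ((c : ℕ) : ℤ) = (j : ℤ) + 1 := by rw [← hj]; simp
        have hi' := hne hi
        simp only [hv, hi, hj, if_true, if_false, one_mul, hjc]
        rw [hj] at p4 p3 r4 r3 c3 c4 b3 b4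
        have e1 := gs (show 0 ≤ lam.1 i.castSucc - lam.1 c - 1 by omega) hn
        have e2 := gs (show 0 ≤ mu.1 i - lam.1 c - 1 by omega) hn
        rw [sub_add_cancel] at e1 e2
        rw [hi', hc, show (j : ℤ) + 1 - i - 1 = j - i by omega,
          show (j : ℤ) + 1 - i = j - i + 1 by omega, e1, e2,
          show lam.1 i.castSucc - (lam.1 c + 1) = lam.1 i.castSucc - lam.1 c - 1 by omega,
          show mu.1 i - (lam.1 c + 1) = mu.1 i - lam.1 c - 1 by omega]
        have s1 := gp (show 0 ≤ lam.1 i.castSucc - lam.1 c - 1 by omega) hn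
        have s2 := gp (show 0 ≤ mu.1 i - lam.1 c - 1 by omega) hn
        have q1 := Qp (show 0 ≤ lam.1 i.castSucc - lam.1 c - 1 by omega)
          (show 0 ≤ (j : ℤ) - i + 1 by omega) (by omega)
        have q2 := Qp (show 0 ≤ lam.1 i.castSucc - lam.1 c by omega) hn (by omega)
        have q3 := Qp (show 0 ≤ mu.1 i - lam.1 c - 1 by omega)
          (show 0 ≤ (j : ℤ) - i + 1 by omega) (by omega)
        have q4 := Qp (show 0 ≤ mu.1 i - lam.1 c by omega) hn (by omega)
        field_simp
      · simp [hi, hj, hne]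
  have ev : psiPrime q t nu lam c * (∏ r : Fin k with r.castSucc < c, v r) =
      ∏ r : Fin k with r.castSucc < c,
      (qtFac q t (mu.1 r - lam.1 c) ((c : ℤ) - r - 1) *
          qtFac q t (lam.1 r.castSucc - lam.1 c - 1) ((c : ℤ) - r + 1)) /
        (qtFac q t (mu.1 r - lam.1 c - 1) ((c : ℤ) - r) *
          qtFac q t (lam.1 r.castSucc - lam.1 c) ((c : ℤ) - r)) := by
    have hre : ∀ F : Fin (k + 1) → ℝ, ∏ i ∈ Finset.Iio c, F i =
        ∏ r : Fin k with r.castSucc < c, F r.castSucc := by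
      intro F
      rw [Finset.prod_filter, ← Finset.filter_gt_eq_Iio, Finset.prod_filter,
        Fin.prod_univ_castSucc, if_neg (not_lt.2 (Fin.le_last c)), mul_one]
    rw [psiPrime, hre, ← Finset.prod_mul_distrib]
    refine Finset.prod_congr rfl fun r hr => ?_
    have hr : r.castSucc < c := (Finset.mem_filter.1 hr).2
    have hr' : (r : ℕ) < c := hr
    have b1 := nu.2 hr.le
    -- Since r < c, the row `mu` separates the two coordinates of `nu`; this keeps the exponent
    -- `mu.1 r - lam.1 c - 1` nonnegative.
    have b3 : nu.1 c ≤ mu.1 r := by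
      have hle : r.succ ≤ c := by
        rw [Fin.le_def]; simpa using hr'
      exact (nu.2 hle).trans (h' r).1
    simp only [hv, Fin.val_castSucc]
    rw [hne hr.ne, hc] at b1 ⊢
    rw [hc] at b3
    rw [show lam.1 r.castSucc - (lam.1 c + 1) = lam.1 r.castSucc - lam.1 c - 1 by omega]
    have q1 := Qp (show 0 ≤ lam.1 r.castSucc - lam.1 c by omega)
      (show 0 ≤ (c : ℤ) - r - 1 by omega) (by omega)
    have q2 := Qp (show 0 ≤ lam.1 r.castSucc - lam.1 c by omega)
      (show 0 ≤ (c : ℤ) - r by omega) (by omega)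
    have q3 := Qp (show 0 ≤ lam.1 r.castSucc - lam.1 c - 1 by omega)
      (show 0 ≤ (c : ℤ) - r by omega) (by omega)
    have q4 := Qp (show 0 ≤ mu.1 r - lam.1 c - 1 by omega)
      (show 0 ≤ (c : ℤ) - r by omega) (by omega)
    field_simp
  rw [key, Scoef, ← ev]
  ring

end

end MacdonaldDynamics

namespace MacdonaldDynamics

/-! ### The coefficients S and T of a pushed particle -/

theorem Scoef_castSucc (q t : ℝ) {k : ℕ} (mu : Sig k) (lam : Sig (k + 1)) (c : Fin k) :
    Scoef q t mu lam c.castSucc =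
      (∏ r ∈ Finset.Iio c,
        (qtFac q t (mu.1 r - lam.1 c.castSucc) ((c : ℤ) - r - 1) *
          qtFac q t (lam.1 r.castSucc - lam.1 c.castSucc - 1) ((c : ℤ) - r + 1)) /
        (qtFac q t (mu.1 r - lam.1 c.castSucc - 1) ((c : ℤ) - r) *
          qtFac q t (lam.1 r.castSucc - lam.1 c.castSucc) ((c : ℤ) - r))) *
      ∏ s ∈ Finset.Ici c,
        (qtFac q t (lam.1 c.castSucc - lam.1 s.succ + 1) ((s : ℤ) - c) *
          qtFac q t (lam.1 c.castSucc - mu.1 s) ((s : ℤ) - c + 1)) /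
        (qtFac q t (lam.1 c.castSucc - lam.1 s.succ) ((s : ℤ) - c + 1) *
          qtFac q t (lam.1 c.castSucc - mu.1 s + 1) ((s : ℤ) - c)) := by
  unfold Scoef
  congr 1
  · refine Finset.prod_congr ?_ fun _ _ => rfl
    ext r; simp
  · refine Finset.prod_congr ?_ fun _ _ => rfl
    ext r; simp

/-- When a move of the lower row breaks the interlacing, the two factors match. -/
theorem Scoef_eq_Tcoef_of_push (q t : ℝ) {k : ℕ} {mu' mu : Sig k} {lam nu : Sig (k + 1)}
    {c : Fin k} (hmu : IsAddBox mu' mu c) (hlam : IsAddBox lam nu c.castSucc)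
    (hc : lam.1 c.castSucc = mu'.1 c) :
    Scoef q t mu' lam c.castSucc = Tcoef q t mu nu c := by
  have e1 : mu.1 c = mu'.1 c + 1 := hmu.apply_self
  have e2 : nu.1 c.castSucc = mu'.1 c + 1 := by rw [hlam.apply_self, hc]
  have n1 : ∀ {i}, i ≠ c → mu.1 i = mu'.1 i := fun hi => hmu.apply_ne hi
  have n2 : ∀ {i}, i ≠ c.castSucc → nu.1 i = lam.1 i := fun hi => hlam.apply_ne hi
  have n3 : ∀ {s : Fin k}, c ≤ s → nu.1 s.succ = lam.1 s.succ := fun {s} hs =>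
    n2 (Fin.castSucc_lt_succ_iff.2 hs).ne'
  rw [Scoef_castSucc, ← Finset.mul_prod_Ioi_eq_prod_Ici, Tcoef, e1, e2, hc, n3 le_rfl]
  have h1 : ∏ r ∈ Finset.Iio c,
        (qtFac q t (mu'.1 r - mu'.1 c) ((c : ℤ) - r - 1) *
          qtFac q t (lam.1 r.castSucc - mu'.1 c - 1) ((c : ℤ) - r + 1)) /
        (qtFac q t (mu'.1 r - mu'.1 c - 1) ((c : ℤ) - r) *
          qtFac q t (lam.1 r.castSucc - mu'.1 c) ((c : ℤ) - r)) =
      ∏ r ∈ Finset.Iio c,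
      (qtFac q t (nu.1 r.castSucc - (mu'.1 c + 1)) ((c : ℤ) - r + 1) *
          qtFac q t (mu.1 r - (mu'.1 c + 1) + 1) ((c : ℤ) - r - 1)) /
        (qtFac q t (nu.1 r.castSucc - (mu'.1 c + 1) + 1) ((c : ℤ) - r) *
          qtFac q t (mu.1 r - (mu'.1 c + 1)) ((c : ℤ) - r)) := by
    refine Finset.prod_congr rfl fun r hr => ?_
    have hr := Finset.mem_Iio.1 hr
    rw [n1 hr.ne, n2 (Fin.castSucc_lt_castSucc_iff.2 hr).ne, sub_add_eq_sub_sub,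
      sub_add_eq_sub_sub, sub_add_cancel, sub_add_cancel, mul_comm, mul_comm (qtFac q t _ _)
      (qtFac q t (lam.1 r.castSucc - mu'.1 c) _)]
  have h2 : ∏ s ∈ Finset.Ioi c,
        (qtFac q t (mu'.1 c - lam.1 s.succ + 1) ((s : ℤ) - c) *
          qtFac q t (mu'.1 c - mu'.1 s) ((s : ℤ) - c + 1)) /
        (qtFac q t (mu'.1 c - lam.1 s.succ) ((s : ℤ) - c + 1) *
          qtFac q t (mu'.1 c - mu'.1 s + 1) ((s : ℤ) - c)) =
      ∏ s ∈ Finset.Ioi c,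
      (qtFac q t (mu'.1 c + 1 - mu.1 s - 1) ((s : ℤ) - c + 1) *
          qtFac q t (mu'.1 c + 1 - nu.1 s.succ) ((s : ℤ) - c)) /
        (qtFac q t (mu'.1 c + 1 - mu.1 s) ((s : ℤ) - c) *
          qtFac q t (mu'.1 c + 1 - nu.1 s.succ - 1) ((s : ℤ) - c + 1)) := by
    refine Finset.prod_congr rfl fun s hs => ?_
    have hs := Finset.mem_Ioi.1 hs
    rw [n1 hs.ne', n3 hs.le]
    simp only [add_sub_right_comm _ (1 : ℤ), sub_add_cancel]
    rw [mul_comm, mul_comm (qtFac q t (mu'.1 c - lam.1 s.succ) _)]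
  have h3 : (qtFac q t (mu'.1 c - lam.1 c.succ + 1) ((c : ℤ) - c) *
          qtFac q t (mu'.1 c - mu'.1 c) ((c : ℤ) - c + 1)) /
        (qtFac q t (mu'.1 c - lam.1 c.succ) ((c : ℤ) - c + 1) *
          qtFac q t (mu'.1 c - mu'.1 c + 1) ((c : ℤ) - c)) =
      (qtFac q t (mu'.1 c + 1 - (mu'.1 c + 1)) 1 * qtFac q t (mu'.1 c + 1 - lam.1 c.succ) 0) /
      (qtFac q t (mu'.1 c + 1 - (mu'.1 c + 1) + 1) 0 *
        qtFac q t (mu'.1 c + 1 - 1 - lam.1 c.succ) 1) := by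
    simp only [sub_self, zero_add, add_sub_cancel_right]
    simp only [add_sub_right_comm _ (1 : ℤ)]
    rw [mul_comm, mul_comm (qtFac q t (mu'.1 c - lam.1 c.succ) 1)]
  rw [h1, h2, h3, mul_left_comm, mul_assoc]

/-! ### Nonnegativity, vanishing and boundedness of the coefficients -/

/-- The numerator contains 1 - q^0 = 0, so the value is 0 whatever the denominators are, division by
zero included. This realizes the convention that such terms are absent. -/
theorem Tcoef_eq_zero (q t : ℝ) {k : ℕ} {mu : Sig k} {lam : Sig (k + 1)} {i : Fin k}
    (h : mu.1 i = lam.1 i.succ) : Tcoef q t mu lam i = 0 := by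
  simp [Tcoef, h]

/-- A blocked particle has S_j = 0: the factor for the neighbour r = j - 1 is 1 - q^0 t^0. -/
theorem Scoef_eq_zero (q t : ℝ) {k : ℕ} {mu : Sig k} {lam : Sig (k + 1)} {r : Fin k}
    (h : mu.1 r = lam.1 r.succ) : Scoef q t mu lam r.succ = 0 := by
  refine mul_eq_zero_of_left (Finset.prod_eq_zero (i := r) (by simp) ?_) _
  simp [h]

/-- Raising the j-th coordinate can only break its upper bound, the coordinate j - 1 of the lower
row. -/
theorem Interlaces.isAddBox_right_iff {k : ℕ} {mu : Sig k} {lam nu : Sig (k + 1)}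
    {j : Fin (k + 1)} (h : Interlaces mu lam) (hbox : IsAddBox lam nu j) :
    Interlaces mu nu ↔ ∀ r : Fin k, r.succ = j → lam.1 j < mu.1 r := by
  have hs := hbox.apply_self
  constructor
  · rintro h' r rfl
    have := (h' r).1
    omega
  · intro h' i
    have hi := h i
    constructor
    · by_cases hij : i.succ = j
      · have := h' i hij
        rw [hij]; omega
      · rw [hbox.apply_ne hij]; exact hi.1
    · by_cases hij : i.castSucc = j
      · rw [hij] at hi ⊢; omega
      · rw [hbox.apply_ne hij]; exact hi.2

theorem Interlaces.isAddBox_left_iff {k : ℕ} {mu' mu : Sig k} {lam : Sig (k + 1)}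
    {i : Fin k} (h : Interlaces mu lam) (hbox : IsAddBox mu' mu i) :
    Interlaces mu' lam ↔ mu.1 i ≠ lam.1 i.succ := by
  have hs := hbox.apply_self
  constructor
  · intro h' 
    have := (h' i).1
    omega
  · intro h' j
    have hj := h j
    by_cases hij : j = i
    · subst hij; omega
    · rw [← hbox.apply_ne hij]; exact hj

/-- If `mu - e_i` is not a signature, then `mu_i = lam_{i+1}`. -/
theorem Interlaces.antitone_sub_single {k : ℕ} {mu : Sig k} {lam : Sig (k + 1)}
    (h : Interlaces mu lam) {i : Fin k} (hi : mu.1 i ≠ lam.1 i.succ) :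
    Antitone (mu.1 - Pi.single i 1) := by
  have hlt : lam.1 i.succ < mu.1 i := lt_of_le_of_ne (h i).1 hi.symm
  intro x y hxy
  have hm := mu.2 hxy
  by_cases hx : x = i
  · subst hx
    by_cases hy : y = x
    · simp [hy]
    · have hlt' : x < y := lt_of_le_of_ne hxy (Ne.symm hy)
      have h1 : mu.1 y ≤ lam.1 x.succ :=
        (h y).2.trans (lam.2 (by rw [Fin.le_def]; simpa using hlt'))
      simp [hy]; omega
  · by_cases hy : y = i
    · subst hy; simp [hx]; omega
    · simpa [hx, hy] using hm

/-- Likewise `lam + e_j` is a signature when the `j`-th particle is not blocked from below. -/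
theorem Interlaces.antitone_add_single {k : ℕ} {mu : Sig k} {lam : Sig (k + 1)}
    (h : Interlaces mu lam) {j : Fin (k + 1)} (hj : ∀ r : Fin k, r.succ = j → lam.1 j < mu.1 r) :
    Antitone (lam.1 + Pi.single j 1) := by
  intro x y hxy
  have hm := lam.2 hxy
  by_cases hy : y = j
  · subst hy
    by_cases hx : x = y
    · simp [hx]
    · have hlt : x < y := lt_of_le_of_ne hxy hx
      obtain ⟨r, rfl⟩ := Fin.exists_succ_eq.2 (Fin.ne_zero_of_lt hlt)
      have h1 := hj r rfl
      have h2 := (h r).2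
      have h3 : lam.1 r.castSucc ≤ lam.1 x := lam.2 (by
        rw [Fin.le_def]; simpa [Nat.lt_succ_iff] using (Fin.lt_def.1 hlt))
      simp [hx]; omega
  · by_cases hx : x = j
    · subst hx; simp [hy]; omega
    · simpa [hx, hy] using hm

section

variable {q t : ℝ}

/-- Make the two moves one at a time, passing through the pair `mu' ≺ nu`: raising the upper row
costs S_c, raising the lower row costs T_c, and here S_c = T_c. It is positive and cancels. -/
theorem psi_mul_psiPrime_push (hq0 : 0 ≤ q) (hq1 : q < 1) (ht0 : 0 ≤ t) (ht1 : t < 1)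
    {k : ℕ} {mu' mu : Sig k} {lam nu : Sig (k + 1)} {c : Fin k}
    (hmu : IsAddBox mu' mu c) (hlam : IsAddBox lam nu c.castSucc) (h' : Interlaces mu' lam)
    (h : Interlaces mu nu) (hc : lam.1 c.castSucc = mu'.1 c) :
    psi q t lam mu' * psiPrime q t mu mu' c =
      psiPrime q t nu lam c.castSucc * psi q t nu mu := by
  have hmid : Interlaces mu' nu := by
    refine (h.isAddBox_left_iff hmu).2 ?_
    have h1 := (h' c).1
    have h2 := hmu.apply_self
    have h3 := hlam.apply_ne (Fin.castSucc_lt_succ (i := c)).ne'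
    omega
  have e1 := psi_mul_psiPrime_eq_Tcoef_mul hq0 hq1 ht0 ht1 hmu hmid h
  have e2 := psiPrime_mul_psi_eq_Scoef_mul hq0 hq1 ht0 ht1 hlam h' hmid
  rw [Scoef_eq_Tcoef_of_push q t hmu hlam hc] at e2
  have hT : Tcoef q t mu nu c ≠ 0 := by
    intro h0
    rw [h0, zero_mul] at e1
    exact (mul_pos (psi_pos hq0 hq1 ht0 ht1 hmid) (psiPrime_pos hq0 hq1 ht0 ht1 hmu)).ne' e1
  refine mul_left_cancel₀ hT ?_
  linear_combination psiPrime q t nu lam c.castSucc * e1 - psiPrime q t mu mu' c * e2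

end

end MacdonaldDynamics

namespace MacdonaldDynamics

/-! ### The identity `∑ S_j - ∑ T_i = 1` -/

open Polynomial in
/-- Sum of residues of `∏ (z - y_i) / (z ∏ (z - x_i))`. -/
theorem sum_residues {ι : Type} [Fintype ι] [DecidableEq ι] {x y : ι → ℝ}
    (hx : Function.Injective x) (hx0 : ∀ i, x i ≠ 0) :
    ∑ i, (x i - y i) / x i * ∏ m, (if m = i then 1 else (x i - y m) / (x i - x m)) =
      1 - ∏ i, y i / x i := by
  set P : ℝ[X] := ∏ i, (X - C (y i)) with hP
  have hmonic : P.Monic := monic_prod_of_monic _ _ fun i _ => monic_X_sub_C _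
  have hdeg : P.degree = Fintype.card ι := by
    rw [hP, degree_prod]; simp
  -- The interpolation nodes are the poles: 0, indexed by `none`, and the `x i`.
  set v : Option ι → ℝ := fun o => o.elim 0 x with hv
  have hvinj : Set.InjOn v (Finset.univ : Finset (Option ι)) := by
    rintro (_ | i) _ (_ | j) _ h
    · rfl
    · exact absurd h.symm (hx0 j)
    · exact absurd h (hx0 i)
    · exact congrArg some (hx h)
  -- A monic polynomial of degree n interpolated at n + 1 nodes: its leading coefficient 1 is the
  -- sum of all the residues.
  have hsum := Lagrange.leadingCoeff_eq_sum hvinj (P := P) (by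
    rw [hdeg, Finset.card_univ, Fintype.card_option]; norm_cast)
  have heval : ∀ z, P.eval z = ∏ i, (z - y i) := fun z => by
    rw [hP, eval_prod]; simp
  rw [hmonic.leadingCoeff, Fintype.sum_option] at hsum
  have e0 : P.eval (v none) / ∏ j ∈ Finset.univ.erase none, (v none - v j) =
      ∏ i, y i / x i := by
    rw [heval, show (Finset.univ : Finset (Option ι)).erase none =
      Finset.univ.map Function.Embedding.some from by ext o; cases o <;> simp, Finset.prod_map,
      ← Finset.prod_div_distrib]
    refine Finset.prod_congr rfl fun i _ => ?_
    simp [hv, neg_div_neg_eq]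
  have e1 : ∀ i, P.eval (v (some i)) / ∏ j ∈ Finset.univ.erase (some i), (v (some i) - v j) =
      (x i - y i) / x i * ∏ m, (if m = i then 1 else (x i - y m) / (x i - x m)) := by
    intro i
    have h1 : ∏ j ∈ Finset.univ.erase (some i), (v (some i) - v j) =
        x i * ∏ m ∈ Finset.univ.erase i, (x i - x m) := by
      rw [show (Finset.univ : Finset (Option ι)).erase (some i) =
        insert none ((Finset.univ.erase i).map Function.Embedding.some) from by
          ext o; cases o <;> simp, Finset.prod_insert (by simp), Finset.prod_map]
      simp [hv]
    have h2 : ∏ m, (if m = i then 1 else (x i - y m) / (x i - x m)) =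
        (∏ m ∈ Finset.univ.erase i, (x i - y m)) / ∏ m ∈ Finset.univ.erase i, (x i - x m) := by
      rw [← Finset.prod_div_distrib, ← Finset.mul_prod_erase _ _ (Finset.mem_univ i), if_pos rfl,
        one_mul]
      exact Finset.prod_congr rfl fun m hm => if_neg (Finset.ne_of_mem_erase hm)
    rw [h1, h2, heval, ← Finset.mul_prod_erase _ _ (Finset.mem_univ i), div_mul_div_comm]
    rfl
  rw [e0, Finset.sum_congr rfl fun i _ => e1 i] at hsum
  linarith

theorem zpow_mul_zpow_ne_zero {q t : ℝ} (hq : 0 < q) (ht : 0 < t) (m n : ℤ) :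
    q ^ m * t ^ n ≠ 0 := by positivity

/-- Each factor 1 - q^m t^n becomes a difference of two points q^m t^n, the form in which it occurs
in a residue. -/
theorem qtFac_eq_div {q t : ℝ} (hq : 0 < q) (ht : 0 < t) (m n : ℤ) {m₁ n₁ m₂ n₂ : ℤ}
    (hm : m = m₁ - m₂) (hn : n = n₁ - n₂) :
    qtFac q t m n = (q ^ m₂ * t ^ n₂ - q ^ m₁ * t ^ n₁) / (q ^ m₂ * t ^ n₂) := by
  rw [qtFac, hm, hn, zpow_sub₀ hq.ne', zpow_sub₀ ht.ne']
  field_simp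

theorem zpow_mul_zpow_ne {q t : ℝ} (hq : 0 < q) (ht : 0 < t) {m₁ n₁ m₂ n₂ : ℤ}
    (h : qtFac q t (m₁ - m₂) (n₁ - n₂) ≠ 0) : q ^ m₁ * t ^ n₁ ≠ q ^ m₂ * t ^ n₂ := by
  rw [qtFac_eq_div hq ht _ _ rfl rfl] at h
  exact fun h' => h (by rw [h', sub_self, zero_div])

theorem Scoef_eq_prod (q t : ℝ) {k : ℕ} (mu : Sig k) (lam : Sig (k + 1)) (j : Fin (k + 1)) :
    Scoef q t mu lam j = ∏ s : Fin k, if s.castSucc < j then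
      (qtFac q t (mu.1 s - lam.1 j) ((j : ℤ) - s - 1) *
          qtFac q t (lam.1 s.castSucc - lam.1 j - 1) ((j : ℤ) - s + 1)) /
        (qtFac q t (mu.1 s - lam.1 j - 1) ((j : ℤ) - s) *
          qtFac q t (lam.1 s.castSucc - lam.1 j) ((j : ℤ) - s))
      else (qtFac q t (lam.1 j - lam.1 s.succ + 1) ((s : ℤ) - j) *
          qtFac q t (lam.1 j - mu.1 s) ((s : ℤ) - j + 1)) /
        (qtFac q t (lam.1 j - lam.1 s.succ) ((s : ℤ) - j + 1) *
          qtFac q t (lam.1 j - mu.1 s + 1) ((s : ℤ) - j)) := by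
  rw [Finset.prod_ite, Scoef]
  simp only [not_lt]

theorem prod_eq_mul_Iio_Ioi {k : ℕ} (i : Fin k) (f : Fin k → ℝ) :
    ∏ s, f s = f i * (∏ r ∈ Finset.Iio i, f r) * ∏ s ∈ Finset.Ioi i, f s := by
  rw [← Finset.prod_filter_mul_prod_filter_not Finset.univ (· < i)]
  simp only [not_lt, Finset.filter_gt_eq_Iio, Finset.filter_le_eq_Ici]
  rw [← Finset.mul_prod_Ioi_eq_prod_Ici]
  ring

section

variable {q t : ℝ}

/-- Reversing the four differences and normalizing them introduces the factor x y / (x' y'), which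
is 1 because κ enters once above and once below. -/
theorem flip_pair {a x x' y y' κ : ℝ} (hκ : κ ≠ 0) (hx : x ≠ 0) (hy' : y' ≠ 0)
    (hxκ : x' = κ * x) (hyκ : y = κ * y') (hax : a ≠ x) (hay : a ≠ y) :
    (a - x') / (a - x) * ((a - y') / (a - y)) =
      (x' - a) / x' * ((y' - a) / y') / ((x - a) / x * ((y - a) / y)) := by
  rw [← neg_sub a x', ← neg_sub a y', ← neg_sub a x, ← neg_sub a y]
  have h1 := sub_ne_zero.2 hax
  have h2 := sub_ne_zero.2 hay
  subst hxκ hyκ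
  field_simp

/-- Apply `sum_residues` with poles A_j = q^{λ_j} t^{-j}, b_i = q^{μ_i - 1} t^{-i} and zeros κ A_j,
κ⁻¹ b_i, where κ = t / q. The residue at A_j is (1 - κ) S_j, the one at b_i is (κ - 1) T_i, and the
right side is 1 - κ. Genericity ensures that the poles are distinct and that κ ≠ 1. -/
theorem sum_Scoef_sub_sum_Tcoef_of_generic (hq0 : 0 < q) (hq1 : q < 1) (ht0 : 0 < t) (ht1 : t < 1)
    {k : ℕ} (hgen : ∀ n : ℕ, n ≤ k + 1 → t ^ n ≠ q) {mu : Sig k} {lam : Sig (k + 1)}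
    (h : Interlaces mu lam) :
    ∑ j, Scoef q t mu lam j - ∑ i, Tcoef q t mu lam i = 1 := by
  have Qp : ∀ {m n : ℤ}, 0 ≤ m → 0 ≤ n → (1 ≤ m ∨ 1 ≤ n) → qtFac q t m n ≠ 0 :=
    fun hm hn h => (qtFac_pos hq0.le hq1 ht0.le ht1 hm hn h).ne'
  set A : Fin (k + 1) → ℝ := fun j => q ^ lam.1 j * t ^ (-(j : ℤ)) with hA
  set A' : Fin (k + 1) → ℝ := fun j => q ^ (lam.1 j - 1) * t ^ (-(j : ℤ) + 1) with hA'
  set b : Fin k → ℝ := fun i => q ^ (mu.1 i - 1) * t ^ (-(i : ℤ)) with hb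
  set b' : Fin k → ℝ := fun i => q ^ mu.1 i * t ^ (-(i : ℤ) - 1) with hb'
  have A0 : ∀ j, A j ≠ 0 := fun j => zpow_mul_zpow_ne_zero hq0 ht0 _ _
  have A'0 : ∀ j, A' j ≠ 0 := fun j => zpow_mul_zpow_ne_zero hq0 ht0 _ _
  have b0 : ∀ j, b j ≠ 0 := fun j => zpow_mul_zpow_ne_zero hq0 ht0 _ _
  have b'0 : ∀ j, b' j ≠ 0 := fun j => zpow_mul_zpow_ne_zero hq0 ht0 _ _
  set κ : ℝ := t / q with hκ
  have κ0 : κ ≠ 0 := (div_pos ht0 hq0).ne'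
  have hAκ : ∀ j, A' j = κ * A j := by
    intro j
    simp only [hA, hA', hκ]
    rw [zpow_sub_one₀ hq0.ne', zpow_add_one₀ ht0.ne']
    field_simp
  have hbκ : ∀ j, b j = κ * b' j := by
    intro j
    simp only [hb, hb', hκ]
    rw [zpow_sub_one₀ hq0.ne', zpow_sub_one₀ ht0.ne']
    field_simp
  have hAA : ∀ {j m}, j < m → A j ≠ A m := by
    intro j m hjm
    have h1 := lam.2 hjm.le
    have h2 : (j : ℕ) < m := hjm
    exact zpow_mul_zpow_ne hq0 ht0 (Qp (by omega) (by omega) (by omega))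
  have hbb : ∀ {j m}, j < m → b j ≠ b m := by
    intro j m hjm
    have h1 := mu.2 hjm.le
    have h2 : (j : ℕ) < m := hjm
    exact zpow_mul_zpow_ne hq0 ht0 (Qp (by omega) (by omega) (by omega))
  -- The points can collide only when i < j and λ_j = μ_i, and then only if t^{j - i} = q.
  have hAb : ∀ j i, A j ≠ b i := by
    intro j i
    rcases le_or_gt j i.castSucc with hji | hji
    · have h1 : (j : ℕ) ≤ i := hji
      have h2 := (h i).2.trans (lam.2 hji)
      exact zpow_mul_zpow_ne hq0 ht0 (Qp (by omega) (by omega) (by omega))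
    · have h1 : (i : ℕ) < j := hji
      have h2 : lam.1 j ≤ mu.1 i :=
        (lam.2 (show i.succ ≤ j by rw [Fin.le_def]; simpa using h1)).trans (h i).1
      symm
      rcases h2.eq_or_lt with h3 | h3
      · refine zpow_mul_zpow_ne hq0 ht0 ?_
        rw [qtFac, h3, sub_right_comm, sub_self, zero_sub,
          show -(i : ℤ) - -(j : ℤ) = ((j - i : ℕ) : ℤ) by push_cast [Nat.cast_sub h1.le]; ring,
          zpow_natCast, zpow_neg_one]
        have := hgen (j - i) (by omega)
        intro h4
        apply this
        field_simp at h4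
        linarith
      · exact zpow_mul_zpow_ne hq0 ht0 (Qp (by omega) (by omega) (by omega))
  have hAinj : ∀ {j m}, j ≠ m → A j ≠ A m := fun {j m} hjm =>
    (lt_or_gt_of_ne hjm).elim hAA fun h => (hAA h).symm
  have hbinj : ∀ {j m}, j ≠ m → b j ≠ b m := fun {j m} hjm =>
    (lt_or_gt_of_ne hjm).elim hbb fun h => (hbb h).symm
  have hinj : Function.Injective (Sum.elim A b) := by
    rintro (j | i) (m | s) hx
    · exact congrArg _ (by by_contra hne; exact hAinj hne hx)
    · exact absurd hx (hAb _ _)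
    · exact absurd hx.symm (hAb _ _)
    · exact congrArg _ (by by_contra hne; exact hbinj hne hx)
  have hres := sum_residues (y := Sum.elim A' b') hinj (by rintro (j | i) <;> simp [A0, b0])
  simp only [Fintype.sum_sum_type, Fintype.prod_sum_type, Sum.elim_inl, Sum.elim_inr,
    Sum.inl.injEq, Sum.inr.injEq, reduceCtorEq, if_false] at hres
  -- There are k + 1 factors κ and k factors κ⁻¹.
  have hprod : (∏ j, A' j / A j) * ∏ i, b' i / b i = κ := by
    have h1 : ∀ j, A' j / A j = κ := fun j => by rw [hAκ]; exact mul_div_cancel_right₀ _ (A0 j)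
    have h2 : ∀ i, b' i / b i = κ⁻¹ := fun i => by
      rw [hbκ]; have := b'0 i; field_simp
    simp only [h1, h2, Finset.prod_const, Finset.card_univ, Fintype.card_fin]
    rw [pow_succ', mul_assoc, ← mul_pow, mul_inv_cancel₀ κ0, one_pow, mul_one]
  have hS : ∀ j, (∏ m, if m = j then 1 else (A j - A' m) / (A j - A m)) *
      ∏ s, (A j - b' s) / (A j - b s) = Scoef q t mu lam j := by
    intro j
    -- The remaining k points A are paired with the k points b: b_s with A_s for s < j and with
    -- A_{s+1} for s ≥ j. These pairs are the factors of S_j.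
    rw [Fin.prod_univ_succAbove _ j, if_pos rfl, one_mul, ← Finset.prod_mul_distrib,
      Scoef_eq_prod]
    refine Finset.prod_congr rfl fun s _ => ?_
    rw [if_neg (Fin.succAbove_ne j s)]
    have hbs := sub_ne_zero.2 (hAb j s)
    have hbs' := sub_ne_zero.2 (hAb j s).symm
    split_ifs with hs
    · rw [Fin.succAbove_of_castSucc_lt _ _ hs]
      have hAs := sub_ne_zero.2 (hAA hs).symm
      rw [qtFac_eq_div hq0 ht0 _ _ (m₁ := mu.1 s) (n₁ := -s - 1) (m₂ := lam.1 j) (n₂ := -j)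
          (by ring) (by ring),
        qtFac_eq_div hq0 ht0 _ ((j : ℤ) - s + 1) (m₁ := lam.1 s.castSucc - 1) (n₁ := -s + 1)
          (m₂ := lam.1 j) (n₂ := -j) (by ring) (by ring),
        qtFac_eq_div hq0 ht0 _ _ (m₁ := mu.1 s - 1) (n₁ := -s) (m₂ := lam.1 j) (n₂ := -j)
          (by ring) (by ring),
        qtFac_eq_div hq0 ht0 _ _ (m₁ := lam.1 s.castSucc) (n₁ := -s) (m₂ := lam.1 j) (n₂ := -j)
          (by ring) (by ring)]
      change _ = (A j - b' s) / A j * ((A j - A' s.castSucc) / A j) /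
        ((A j - b s) / A j * ((A j - A s.castSucc) / A j))
      have := A0 j
      field_simp
    · rw [not_lt] at hs
      rw [Fin.succAbove_of_le_castSucc _ _ hs]
      have hlt : j < s.succ := Fin.le_castSucc_iff.1 hs
      have hAs := sub_ne_zero.2 (hAA hlt)
      have hAs' := sub_ne_zero.2 (hAA hlt).symm
      rw [qtFac_eq_div hq0 ht0 _ _ (m₁ := lam.1 j) (n₁ := -j) (m₂ := lam.1 s.succ - 1)
          (n₂ := -(s.succ : ℕ) + 1) (by ring) (by push_cast [Fin.val_succ]; ring),
        qtFac_eq_div hq0 ht0 _ ((s : ℤ) - j + 1) (m₁ := lam.1 j) (n₁ := -j) (m₂ := mu.1 s)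
          (n₂ := -s - 1) (by ring) (by ring),
        qtFac_eq_div hq0 ht0 (lam.1 j - lam.1 s.succ) _ (m₁ := lam.1 j) (n₁ := -j)
          (m₂ := lam.1 s.succ)
          (n₂ := -(s.succ : ℕ)) (by ring) (by push_cast [Fin.val_succ]; ring),
        qtFac_eq_div hq0 ht0 _ _ (m₁ := lam.1 j) (n₁ := -j) (m₂ := mu.1 s - 1)
          (n₂ := -s) (by ring) (by ring)]
      change _ = (A' s.succ - A j) / A' s.succ * ((b' s - A j) / b' s) /
        ((A s.succ - A j) / A s.succ * ((b s - A j) / b s))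
      exact flip_pair κ0 (A0 _) (b'0 _) (hAκ _) (hbκ _) (hAA hlt) (hAb j s)
  have hT : ∀ i, (∏ m, (b i - A' m) / (b i - A m)) *
      ∏ s, (if s = i then 1 else (b i - b' s) / (b i - b s)) = κ * Tcoef q t mu lam i := by
    intro i
    -- Here A_i is split off first, so that b_i itself is paired with A_{i+1}; these two unpaired
    -- factors give the leading fraction of T_i and the extra κ.
    rw [Fin.prod_univ_succAbove _ i.castSucc, mul_assoc, ← Finset.prod_mul_distrib,
      prod_eq_mul_Iio_Ioi i, if_pos rfl, mul_one, Fin.succAbove_castSucc_self, Tcoef]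
    have hr : ∏ r ∈ Finset.Iio i, (b i - A' (i.castSucc.succAbove r)) /
          (b i - A (i.castSucc.succAbove r)) *
          (if r = i then 1 else (b i - b' r) / (b i - b r)) =
        ∏ r ∈ Finset.Iio i,
          (qtFac q t (lam.1 r.castSucc - mu.1 i) ((i : ℤ) - r + 1) *
          qtFac q t (mu.1 r - mu.1 i + 1) ((i : ℤ) - r - 1)) /
        (qtFac q t (lam.1 r.castSucc - mu.1 i + 1) ((i : ℤ) - r) *
          qtFac q t (mu.1 r - mu.1 i) ((i : ℤ) - r)) := by
      refine Finset.prod_congr rfl fun r hr => ?_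
      have hr := Finset.mem_Iio.1 hr
      rw [if_neg hr.ne, Fin.succAbove_of_castSucc_lt _ _ (Fin.castSucc_lt_castSucc_iff.2 hr)]
      rw [qtFac_eq_div hq0 ht0 _ ((i : ℤ) - r + 1) (m₁ := lam.1 r.castSucc - 1) (n₁ := -r + 1)
          (m₂ := mu.1 i - 1) (n₂ := -i) (by ring) (by ring),
        qtFac_eq_div hq0 ht0 _ _ (m₁ := mu.1 r) (n₁ := -r - 1)
          (m₂ := mu.1 i - 1) (n₂ := -i) (by ring) (by ring),
        qtFac_eq_div hq0 ht0 _ _ (m₁ := lam.1 r.castSucc) (n₁ := -r)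
          (m₂ := mu.1 i - 1) (n₂ := -i) (by ring) (by ring),
        qtFac_eq_div hq0 ht0 _ _ (m₁ := mu.1 r - 1) (n₁ := -r)
          (m₂ := mu.1 i - 1) (n₂ := -i) (by ring) (by ring)]
      change _ = (b i - A' r.castSucc) / b i * ((b i - b' r) / b i) /
        ((b i - A r.castSucc) / b i * ((b i - b r) / b i))
      have h1 := b0 i
      have h2 := sub_ne_zero.2 (hAb r.castSucc i).symm
      have h3 := sub_ne_zero.2 (hbb hr).symm
      field_simp
    have hs : ∏ s ∈ Finset.Ioi i, (b i - A' (i.castSucc.succAbove s)) /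
          (b i - A (i.castSucc.succAbove s)) *
          (if s = i then 1 else (b i - b' s) / (b i - b s)) =
        ∏ s ∈ Finset.Ioi i,
          (qtFac q t (mu.1 i - mu.1 s - 1) ((s : ℤ) - i + 1) *
          qtFac q t (mu.1 i - lam.1 s.succ) ((s : ℤ) - i)) /
        (qtFac q t (mu.1 i - mu.1 s) ((s : ℤ) - i) *
          qtFac q t (mu.1 i - lam.1 s.succ - 1) ((s : ℤ) - i + 1)) := by
      refine Finset.prod_congr rfl fun s hs => ?_
      have hs := Finset.mem_Ioi.1 hs
      rw [if_neg hs.ne', Fin.succAbove_of_le_castSucc _ _ (Fin.castSucc_le_castSucc_iff.2 hs.le)]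
      rw [qtFac_eq_div hq0 ht0 _ ((s : ℤ) - i + 1) (m₁ := mu.1 i - 1) (n₁ := -i)
          (m₂ := mu.1 s) (n₂ := -s - 1) (by ring) (by ring),
        qtFac_eq_div hq0 ht0 _ _ (m₁ := mu.1 i - 1) (n₁ := -i) (m₂ := lam.1 s.succ - 1)
          (n₂ := -(s.succ : ℕ) + 1) (by ring) (by push_cast [Fin.val_succ]; ring),
        qtFac_eq_div hq0 ht0 _ ((s : ℤ) - i) (m₁ := mu.1 i - 1) (n₁ := -i) (m₂ := mu.1 s - 1)
          (n₂ := -s) (by ring) (by ring),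
        qtFac_eq_div hq0 ht0 _ _ (m₁ := mu.1 i - 1) (n₁ := -i) (m₂ := lam.1 s.succ)
          (n₂ := -(s.succ : ℕ)) (by ring) (by push_cast [Fin.val_succ]; ring)]
      change _ = (b' s - b i) / b' s * ((A' s.succ - b i) / A' s.succ) /
        ((b s - b i) / b s * ((A s.succ - b i) / A s.succ))
      rw [flip_pair κ0 (A0 _) (b'0 _) (hAκ _) (hbκ _) (hAb _ i).symm (hbb hs),
        mul_comm ((b' s - b i) / b' s), mul_comm ((b s - b i) / b s)]
    have hi : (b i - A' i.castSucc) / (b i - A i.castSucc) *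
        ((b i - A' i.succ) / (b i - A i.succ)) = κ *
        ((qtFac q t (lam.1 i.castSucc - mu.1 i) 1 * qtFac q t (mu.1 i - lam.1 i.succ) 0) /
      (qtFac q t (lam.1 i.castSucc - mu.1 i + 1) 0 *
        qtFac q t (mu.1 i - 1 - lam.1 i.succ) 1)) := by
      rw [qtFac_eq_div hq0 ht0 _ _ (m₁ := lam.1 i.castSucc - 1) (n₁ := -i + 1)
          (m₂ := mu.1 i - 1) (n₂ := -i) (by ring) (by ring),
        qtFac_eq_div hq0 ht0 _ _ (m₁ := mu.1 i - 1) (n₁ := -i) (m₂ := lam.1 i.succ - 1)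
          (n₂ := -(i.succ : ℕ) + 1) (by ring) (by push_cast [Fin.val_succ]; ring),
        qtFac_eq_div hq0 ht0 _ _ (m₁ := lam.1 i.castSucc) (n₁ := -i)
          (m₂ := mu.1 i - 1) (n₂ := -i) (by ring) (by ring),
        qtFac_eq_div hq0 ht0 _ _ (m₁ := mu.1 i - 1) (n₁ := -i) (m₂ := lam.1 i.succ)
          (n₂ := -(i.succ : ℕ)) (by ring) (by push_cast [Fin.val_succ]; ring)]
      change _ = κ * ((b i - A' i.castSucc) / b i * ((A' i.succ - b i) / A' i.succ) /
        ((b i - A i.castSucc) / b i * ((A i.succ - b i) / A i.succ)))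
      have h1 := b0 i
      have h2 := sub_ne_zero.2 (hAb i.castSucc i).symm
      have h3 := sub_ne_zero.2 (hAb i.succ i).symm
      have h4 := A0 i.succ
      rw [← neg_sub (b i) (A' _), ← neg_sub (b i) (A i.succ), hAκ i.succ]
      field_simp
    rw [hr, hs, ← mul_assoc, ← mul_assoc, hi]
    ring
  have e1 : ∀ j, (A j - A' j) / A j = 1 - κ := fun j => by
    rw [hAκ]; have := A0 j; field_simp
  have e2 : ∀ i, (b i - b' i) / b i = 1 - κ⁻¹ := fun i => by
    rw [hbκ]; have := b'0 i; field_simp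
  simp only [hprod, hS, hT, e1, e2, ← Finset.mul_sum] at hres
  have hκ1 : 1 - κ ≠ 0 := by
    refine sub_ne_zero.2 fun h0 => hgen 1 (by omega) ?_
    rw [pow_one]
    exact ((eq_div_iff hq0.ne').1 h0).symm.trans (one_mul q)
  refine mul_left_cancel₀ hκ1 ?_
  have : (1 - κ⁻¹) * κ = κ - 1 := by field_simp
  linear_combination hres - (∑ i, Tcoef q t mu lam i) * this

end

end MacdonaldDynamics

namespace MacdonaldDynamics

/-! ### Removal of genericity by continuity, and the uniform bound on S_j -/

open Filter Topology

section

variable {q t : ℝ}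

theorem continuousAt_qtFac (p : ℝ × ℝ) {m n : ℤ} (hm : 0 ≤ m) (hn : 0 ≤ n) :
    ContinuousAt (fun p : ℝ × ℝ => qtFac p.1 p.2 m n) p :=
  continuousAt_const.sub ((continuousAt_fst.zpow₀ _ (Or.inr hm)).mul
    (continuousAt_snd.zpow₀ _ (Or.inr hn)))

theorem continuousAt_qtFac_div (hq0 : 0 ≤ q) (hq1 : q < 1) (ht0 : 0 ≤ t) (ht1 : t < 1)
    {m₁ n₁ m₂ n₂ m₃ n₃ m₄ n₄ : ℤ} (hm₁ : 0 ≤ m₁) (hn₁ : 0 ≤ n₁) (hm₂ : 0 ≤ m₂) (hn₂ : 0 ≤ n₂)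
    (h₃ : 0 ≤ m₃ ∧ 0 ≤ n₃ ∧ (1 ≤ m₃ ∨ 1 ≤ n₃)) (h₄ : 0 ≤ m₄ ∧ 0 ≤ n₄ ∧ (1 ≤ m₄ ∨ 1 ≤ n₄)) :
    ContinuousAt (fun p : ℝ × ℝ => (qtFac p.1 p.2 m₁ n₁ * qtFac p.1 p.2 m₂ n₂) /
      (qtFac p.1 p.2 m₃ n₃ * qtFac p.1 p.2 m₄ n₄)) (q, t) :=
  ((continuousAt_qtFac _ hm₁ hn₁).mul (continuousAt_qtFac _ hm₂ hn₂)).div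
    ((continuousAt_qtFac _ h₃.1 h₃.2.1).mul (continuousAt_qtFac _ h₄.1 h₄.2.1))
    (mul_ne_zero (qtFac_pos hq0 hq1 ht0 ht1 h₃.1 h₃.2.1 h₃.2.2).ne'
      (qtFac_pos hq0 hq1 ht0 ht1 h₄.1 h₄.2.1 h₄.2.2).ne')

theorem Interlaces.exponents_left {k : ℕ} {mu : Sig k} {lam : Sig (k + 1)} (h : Interlaces mu lam)
    {j : Fin (k + 1)} (hj : ∀ r : Fin k, r.succ = j → lam.1 j < mu.1 r) {s : Fin k}
    (hs : s.castSucc < j) :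
    (s : ℤ) + 1 ≤ j ∧ lam.1 j + 1 ≤ mu.1 s ∧ lam.1 j + 1 ≤ lam.1 s.castSucc := by
  have h1 : (s : ℕ) < j := hs
  have h2 := (h s).2
  have h3 : lam.1 j < mu.1 s := by
    obtain ⟨r, rfl⟩ := Fin.exists_succ_eq.2 (Fin.ne_zero_of_lt hs)
    exact (hj r rfl).trans_le (mu.2 (by
      rw [Fin.le_def]; simpa [Nat.lt_succ_iff] using h1))
  omega

theorem Interlaces.exponents_right {k : ℕ} {mu : Sig k} {lam : Sig (k + 1)} (h : Interlaces mu lam)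
    {j : Fin (k + 1)} {s : Fin k} (hs : ¬ s.castSucc < j) :
    (j : ℤ) ≤ s ∧ mu.1 s ≤ lam.1 j ∧ lam.1 s.succ ≤ lam.1 j := by
  have hs := not_lt.1 hs
  have h1 : (j : ℕ) ≤ s := hs
  have h2 := (h s).2.trans (lam.2 hs)
  have h3 := (h s).1
  omega

/-- If particle j is free, all exponents are nonnegative and the denominators do not vanish; if it
is blocked, S_j is identically 0 in the parameters. Thus q = 0 and t = 0 cause no trouble. -/
theorem continuousAt_Scoef (hq0 : 0 ≤ q) (hq1 : q < 1) (ht0 : 0 ≤ t) (ht1 : t < 1)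
    {k : ℕ} {mu : Sig k} {lam : Sig (k + 1)} (h : Interlaces mu lam) (j : Fin (k + 1)) :
    ContinuousAt (fun p : ℝ × ℝ => Scoef p.1 p.2 mu lam j) (q, t) := by
  by_cases hj : ∀ r : Fin k, r.succ = j → lam.1 j < mu.1 r
  · simp only [Scoef_eq_prod]
    refine tendsto_finsetProd _ fun s _ => ?_
    split_ifs with hs
    · have := h.exponents_left hj hs
      exact continuousAt_qtFac_div hq0 hq1 ht0 ht1 (by omega) (by omega) (by omega) (by omega)
        (by omega) (by omega)
    · have := h.exponents_right hs
      exact continuousAt_qtFac_div hq0 hq1 ht0 ht1 (by omega) (by omega) (by omega) (by omega)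
        (by omega) (by omega)
  · push Not at hj
    obtain ⟨r, rfl, hr⟩ := hj
    have h1 := (h r).1
    simp only [Scoef_eq_zero _ _ (show mu.1 r = lam.1 r.succ by omega)]
    exact continuousAt_const

theorem continuousAt_Tcoef (hq0 : 0 ≤ q) (hq1 : q < 1) (ht0 : 0 ≤ t) (ht1 : t < 1)
    {k : ℕ} {mu : Sig k} {lam : Sig (k + 1)} (h : Interlaces mu lam) (i : Fin k) :
    ContinuousAt (fun p : ℝ × ℝ => Tcoef p.1 p.2 mu lam i) (q, t) := by
  by_cases hi : mu.1 i = lam.1 i.succ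
  · simp only [Tcoef_eq_zero _ _ hi]
    exact continuousAt_const
  · have hlt : lam.1 i.succ < mu.1 i := lt_of_le_of_ne (h i).1 (Ne.symm hi)
    have hle := (h i).2
    unfold Tcoef
    refine ContinuousAt.mul (ContinuousAt.mul ?_ ?_) ?_
    · exact continuousAt_qtFac_div hq0 hq1 ht0 ht1 (by omega) (by omega) (by omega) (by omega)
        (by omega) (by omega)
    · refine tendsto_finsetProd _ fun r hr => ?_
      have hr := Finset.mem_Iio.1 hr
      have h1 := mu.2 hr.le
      have h2 := (h r).2
      have h3 : (r : ℕ) < i := hr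
      exact continuousAt_qtFac_div hq0 hq1 ht0 ht1 (by omega) (by omega) (by omega) (by omega)
        (by omega) (by omega)
    · refine tendsto_finsetProd _ fun s hs => ?_
      have hs := Finset.mem_Ioi.1 hs
      have h3 : (i : ℕ) < s := hs
      have h1 : mu.1 s ≤ lam.1 i.succ :=
        (h s).2.trans (lam.2 (by rw [Fin.le_def]; simpa using h3))
      have h2 := (h s).1
      exact continuousAt_qtFac_div hq0 hq1 ht0 ht1 (by omega) (by omega) (by omega) (by omega)
        (by omega) (by omega)

/-- Approaching t from the right, s^n either stays below q by continuity or lies strictly above t^n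
≥ q. -/
theorem eventually_pow_ne (ht0 : 0 ≤ t) (q : ℝ) (n : ℕ) (hn : n ≠ 0) :
    ∀ᶠ s in 𝓝[>] t, s ^ n ≠ q := by
  rcases lt_or_ge (t ^ n) q with h | h
  · have := (continuous_pow n).continuousAt.eventually_lt (continuousAt_const (y := q)) h
    exact (this.filter_mono nhdsWithin_le_nhds).mono fun s hs => ne_of_lt hs
  · filter_upwards [self_mem_nhdsWithin] with s hs
    exact (h.trans_lt (pow_lt_pow_left₀ hs ht0 hn)).ne'

/-- The key identity behind both the Pieri rule and the intertwining of the dynamics. -/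
theorem sum_Scoef_sub_sum_Tcoef (hq0 : 0 ≤ q) (hq1 : q < 1) (ht0 : 0 ≤ t) (ht1 : t < 1)
    {k : ℕ} {mu : Sig k} {lam : Sig (k + 1)} (h : Interlaces mu lam) :
    ∑ j, Scoef q t mu lam j - ∑ i, Tcoef q t mu lam i = 1 := by
  set F : ℝ × ℝ → ℝ := fun p => ∑ j, Scoef p.1 p.2 mu lam j - ∑ i, Tcoef p.1 p.2 mu lam i with hF
  have hcont : ∀ {q t : ℝ}, 0 ≤ q → q < 1 → 0 ≤ t → t < 1 → ContinuousAt F (q, t) :=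
    fun hq0 hq1 ht0 ht1 =>
      ContinuousAt.sub (tendsto_finsetSum _ fun j _ => continuousAt_Scoef hq0 hq1 ht0 ht1 h j)
        (tendsto_finsetSum _ fun i _ => continuousAt_Tcoef hq0 hq1 ht0 ht1 h i)
  -- First t is approached from the right with q > 0 fixed, where nearby points are generic; the
  -- boundary value q = 0 is reached afterwards by letting q decrease.
  have step1 : ∀ {q t : ℝ}, 0 < q → q < 1 → 0 ≤ t → t < 1 → F (q, t) = 1 := by
    intro q t hq0 hq1 ht0 ht1
    have hc : Tendsto (fun s => F (q, s)) (𝓝[>] t) (𝓝 (F (q, t))) :=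
      ((hcont hq0.le hq1 ht0 ht1).comp (f := fun s => (q, s))
        (by fun_prop)).tendsto.mono_left nhdsWithin_le_nhds
    have hgen : ∀ᶠ s in 𝓝[>] t, ∀ n ∈ Finset.range (k + 2), s ^ n ≠ q := by
      rw [Filter.eventually_all_finset]
      intro n _
      rcases eq_or_ne n 0 with rfl | hn
      · simp [hq1.ne']
      · exact eventually_pow_ne ht0 q n hn
    have hlt : ∀ᶠ s in 𝓝[>] t, s < 1 :=
      (isOpen_Iio.mem_nhds ht1 : Set.Iio 1 ∈ 𝓝 t) |> fun h => nhdsWithin_le_nhds h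
    refine tendsto_nhds_unique (hc.congr' ?_) tendsto_const_nhds
    filter_upwards [hgen, hlt, self_mem_nhdsWithin] with s hs hs1 hs0
    exact sum_Scoef_sub_sum_Tcoef_of_generic hq0 hq1 (ht0.trans_lt hs0) hs1
      (fun n hn => hs n (by simpa [Nat.lt_succ_iff] using hn)) h
  have hc : Tendsto (fun s => F (s, t)) (𝓝[>] q) (𝓝 (F (q, t))) :=
    ((hcont hq0 hq1 ht0 ht1).comp (f := fun s => (s, t))
      (by fun_prop)).tendsto.mono_left nhdsWithin_le_nhds
  have hlt : ∀ᶠ s in 𝓝[>] q, s < 1 :=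
    (isOpen_Iio.mem_nhds hq1 : Set.Iio 1 ∈ 𝓝 q) |> fun h => nhdsWithin_le_nhds h
  refine tendsto_nhds_unique (hc.congr' ?_) tendsto_const_nhds
  filter_upwards [hlt, self_mem_nhdsWithin] with s hs1 hs0
  exact step1 (hq0.trans_lt hs0) hs1 ht0 ht1

theorem qtFac_div_le (hq0 : 0 ≤ q) (hq1 : q < 1) (ht0 : 0 ≤ t) (ht1 : t < 1)
    {m₁ n₁ m₂ n₂ m₃ n₃ m₄ n₄ : ℤ} (h₁ : 0 ≤ m₁ ∧ 0 ≤ n₁) (h₂ : 0 ≤ m₂ ∧ 0 ≤ n₂)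
    (h₃ : 0 ≤ m₃ ∧ 0 ≤ n₃ ∧ (1 ≤ m₃ ∨ 1 ≤ n₃)) (h₄ : 0 ≤ m₄ ∧ 0 ≤ n₄ ∧ (1 ≤ m₄ ∨ 1 ≤ n₄)) :
    0 ≤ (qtFac q t m₁ n₁ * qtFac q t m₂ n₂) / (qtFac q t m₃ n₃ * qtFac q t m₄ n₄) ∧
    (qtFac q t m₁ n₁ * qtFac q t m₂ n₂) / (qtFac q t m₃ n₃ * qtFac q t m₄ n₄) ≤
      (((1 - q) * (1 - t)) * ((1 - q) * (1 - t)))⁻¹ := by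
  have c : 0 < (1 - q) * (1 - t) := mul_pos (sub_pos.2 hq1) (sub_pos.2 ht1)
  have l₃ := le_qtFac hq0 hq1 ht0 ht1 h₃.1 h₃.2.1 h₃.2.2
  have l₄ := le_qtFac hq0 hq1 ht0 ht1 h₄.1 h₄.2.1 h₄.2.2
  have p₁ := qtFac_nonneg hq0 hq1 ht0 ht1 h₁.1 h₁.2
  have p₂ := qtFac_nonneg hq0 hq1 ht0 ht1 h₂.1 h₂.2
  have p₃ := c.trans_le l₃
  have p₄ := c.trans_le l₄
  refine ⟨by positivity, ?_⟩
  rw [← one_div]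
  exact div_le_div₀ zero_le_one (mul_le_one₀ (qtFac_le_one hq0 ht0 _ _) p₂
    (qtFac_le_one hq0 ht0 _ _)) (by positivity) (mul_le_mul l₃ l₄ c.le p₃.le)

theorem prod_le_pow {k : ℕ} {f : Fin k → ℝ} {C : ℝ} (h : ∀ s, 0 ≤ f s ∧ f s ≤ C) :
    ∏ s, f s ≤ C ^ k := by
  simpa using Finset.prod_le_prod (fun s _ => (h s).1) fun s (_ : s ∈ Finset.univ) => (h s).2

/-- `S_j` is bounded uniformly in the signatures. -/
theorem Scoef_le (hq0 : 0 ≤ q) (hq1 : q < 1) (ht0 : 0 ≤ t) (ht1 : t < 1)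
    {k : ℕ} {mu : Sig k} {lam : Sig (k + 1)} (h : Interlaces mu lam) {j : Fin (k + 1)}
    (hj : ∀ r : Fin k, r.succ = j → lam.1 j < mu.1 r) :
    Scoef q t mu lam j ≤ ((((1 - q) * (1 - t)) * ((1 - q) * (1 - t)))⁻¹) ^ k := by
  rw [Scoef_eq_prod]
  refine prod_le_pow fun s => ?_
  split_ifs with hs
  · have := h.exponents_left hj hs
    exact qtFac_div_le hq0 hq1 ht0 ht1 (by omega) (by omega) (by omega) (by omega)
  · have := h.exponents_right hs
    exact qtFac_div_le hq0 hq1 ht0 ht1 (by omega) (by omega) (by omega) (by omega)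

end

end MacdonaldDynamics

namespace MacdonaldDynamics

noncomputable section

/-! ### Schemes: truncation and extension -/

theorem finite_below {k : ℕ} (lam : Sig (k + 1)) : {mu : Sig k | Interlaces mu lam}.Finite := by
  refine Set.Finite.of_injOn (f := Subtype.val)
    (t := Set.Icc (fun i : Fin k => lam.1 i.succ) fun i => lam.1 i.castSucc) ?_
    Subtype.val_injective.injOn (Set.finite_Icc _ _)
  exact fun mu h => ⟨fun i => (h i).1, fun i => (h i).2⟩

/-- The rows interlacing below a given row. -/
def below {k : ℕ} (lam : Sig (k + 1)) : Finset (Sig k) := (finite_below lam).toFinset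

@[simp]
theorem mem_below {k : ℕ} {lam : Sig (k + 1)} {mu : Sig k} :
    mu ∈ below lam ↔ Interlaces mu lam := by simp [below]

theorem below_nonempty {k : ℕ} (lam : Sig (k + 1)) : (below lam).Nonempty :=
  ⟨⟨fun i => lam.1 i.castSucc, fun _ _ h => lam.2 (Fin.castSucc_le_castSucc_iff.2 h)⟩,
    mem_below.2 fun i => ⟨lam.2 (Fin.castSucc_lt_succ (i := i)).le, le_rfl⟩⟩

namespace GTScheme

/-- The scheme formed by all rows but the last one. -/
def trunc {m : ℕ} (X : GTScheme (m + 1)) : GTScheme m where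
  row k := X.row k.castSucc
  interlaces k := X.interlaces k.castSucc

/-- Adding a row at the top. -/
def snoc {m : ℕ} (X : GTScheme m) (x : Sig (m + 1)) (h : Interlaces X.top x) :
    GTScheme (m + 1) where
  row := Fin.snoc (α := fun k : Fin (m + 2) => Sig k) X.row x
  interlaces := by
    intro k
    refine Fin.lastCases ?_ (fun k => ?_) k
    · have h1 := Fin.snoc_castSucc (α := fun k : Fin (m + 2) => Sig k) x X.row (Fin.last m)
      have h2 := Fin.snoc_last (α := fun k : Fin (m + 2) => Sig k) x X.row
      exact (congrArg₂ (Interlaces (k := m)) h1 h2).mpr h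
    · have h1 := Fin.snoc_castSucc (α := fun k : Fin (m + 2) => Sig k) x X.row k.castSucc
      have h2 := Fin.snoc_castSucc (α := fun k : Fin (m + 2) => Sig k) x X.row k.succ
      exact (congrArg₂ (Interlaces (k := (k : ℕ))) h1 h2).mpr (X.interlaces k)

@[simp]
theorem trunc_snoc {m : ℕ} (X : GTScheme m) (x : Sig (m + 1)) (h : Interlaces X.top x) :
    (X.snoc x h).trunc = X := by
  ext1
  funext k
  exact Fin.snoc_castSucc (α := fun k : Fin (m + 2) => Sig k) _ _ _

@[simp]
theorem top_snoc {m : ℕ} (X : GTScheme m) (x : Sig (m + 1)) (h : Interlaces X.top x) :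
    (X.snoc x h).top = x :=
  Fin.snoc_last (α := fun k : Fin (m + 2) => Sig k) _ _

theorem interlaces_top {m : ℕ} (X : GTScheme (m + 1)) : Interlaces X.trunc.top X.top :=
  X.interlaces (Fin.last m)

theorem eq_iff {m : ℕ} {X Y : GTScheme (m + 1)} :
    X = Y ↔ X.trunc = Y.trunc ∧ X.top = Y.top := by
  constructor
  · rintro rfl
    exact ⟨rfl, rfl⟩
  · rintro ⟨h1, h2⟩
    ext1
    funext k
    refine Fin.lastCases h2 (fun k => ?_) k
    exact congrFun (congrArg GTScheme.row h1) k

@[simp]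
theorem snoc_trunc_top {m : ℕ} (X : GTScheme (m + 1)) :
    X.trunc.snoc X.top X.interlaces_top = X :=
  eq_iff.2 ⟨trunc_snoc _ _ _, top_snoc _ _ _⟩

theorem eq_of_zero (X Y : GTScheme 0) : X = Y := by
  ext1
  funext k
  obtain rfl : k = 0 := Fin.fin_one_eq_zero k
  exact Subtype.ext (funext fun i => i.elim0)

instance (m : ℕ) : Inhabited (GTScheme m) :=
  ⟨⟨fun _ => ⟨fun _ => 0, fun _ _ _ => le_rfl⟩, fun _ _ => ⟨le_rfl, le_rfl⟩⟩⟩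

theorem finite_top {m : ℕ} (x : Sig m) : {X : GTScheme m | X.top = x}.Finite := by
  induction m with
  | zero => exact Set.Subsingleton.finite fun X _ Y _ => eq_of_zero X Y
  | succ m ih =>
    refine Set.Finite.of_injOn (f := trunc)
      (t := ⋃ mu ∈ below x, {X : GTScheme m | X.top = mu}) ?_ ?_
      ((below x).finite_toSet.biUnion fun mu _ => ih mu)
    · rintro X rfl
      exact Set.mem_biUnion (mem_below.2 X.interlaces_top) rfl
    · rintro X hX Y hY h
      exact eq_iff.2 ⟨h, hX.trans hY.symm⟩

end GTScheme

/-- The schemes with a given last row. -/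
def schemes {m : ℕ} (x : Sig m) : Finset (GTScheme m) := (GTScheme.finite_top x).toFinset

@[simp]
theorem mem_schemes {m : ℕ} {x : Sig m} {X : GTScheme m} : X ∈ schemes x ↔ X.top = x := by
  simp [schemes]

theorem tsum_top {m : ℕ} (x : Sig m) (F : GTScheme m → ℝ) :
    ∑' X : {X : GTScheme m // X.top = x}, F X.1 = ∑ X ∈ schemes x, F X := by
  rw [← Finset.tsum_subtype]
  exact (Equiv.subtypeEquivRight fun X => mem_schemes.symm).tsum_eq
    (fun X : {X // X ∈ schemes x} => F X.1)

/-- Schemes with last row `x` correspond to schemes whose last row is any row below `x`, by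
truncation and adding `x` back. -/
theorem sum_schemes_succ {m : ℕ} (x : Sig (m + 1)) (F : GTScheme m → ℝ) :
    ∑ X ∈ schemes x, F X.trunc = ∑ mu ∈ below x, ∑ X ∈ schemes mu, F X := by
  rw [Finset.sum_sigma']
  refine Finset.sum_bij' (fun X _ => ⟨X.trunc.top, X.trunc⟩)
    (fun p hp => p.2.snoc x (by
      have := Finset.mem_sigma.1 hp
      rw [mem_schemes.1 this.2]; exact mem_below.1 this.1)) ?_ ?_ ?_ ?_ ?_
  · rintro X hX
    have := X.interlaces_top
    rw [mem_schemes.1 hX] at this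
    simp [this]
  · rintro p hp
    simp
  · rintro X hX
    exact GTScheme.eq_iff.2 ⟨GTScheme.trunc_snoc _ _ _,
      (GTScheme.top_snoc _ _ _).trans (mem_schemes.1 hX).symm⟩
  · rintro ⟨mu, X⟩ hp
    obtain rfl : X.top = mu := mem_schemes.1 (Finset.mem_sigma.1 hp).2
    simp
  · rintro X hX
    rfl

/-- The product over all pairs of adjacent rows. -/
def weight (f : (k : ℕ) → Sig (k + 1) → Sig k → ℝ) {m : ℕ} (X : GTScheme m) : ℝ :=
  ∏ i : Fin m, f i (X.row i.succ) (X.row i.castSucc)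

theorem weight_zero (f : (k : ℕ) → Sig (k + 1) → Sig k → ℝ) (X : GTScheme 0) :
    weight f X = 1 := Fin.prod_univ_zero _

theorem weight_succ (f : (k : ℕ) → Sig (k + 1) → Sig k → ℝ) {m : ℕ} (X : GTScheme (m + 1)) :
    weight f X = weight f X.trunc * f m X.top X.trunc.top :=
  Fin.prod_univ_castSucc _

theorem sum_weight_succ (f : (k : ℕ) → Sig (k + 1) → Sig k → ℝ) {m : ℕ} (x : Sig (m + 1)) :
    ∑ X ∈ schemes x, weight f X =
      ∑ mu ∈ below x, (∑ X ∈ schemes mu, weight f X) * f m x mu := by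
  have : ∀ X ∈ schemes x, weight f X = weight f X.trunc * f m x X.trunc.top := fun X hX => by
    rw [weight_succ, mem_schemes.1 hX]
  rw [Finset.sum_congr rfl this, sum_schemes_succ x (fun X => weight f X * f m x X.top)]
  refine Finset.sum_congr rfl fun mu _ => ?_
  rw [Finset.sum_mul]
  exact Finset.sum_congr rfl fun X hX => by rw [mem_schemes.1 hX]

/-! ### Macdonald polynomials and links -/

variable {q t : ℝ} {a : ℕ → ℝ}

theorem skewP_of_interlaces (q t x : ℝ) {k : ℕ} {lam : Sig (k + 1)} {mu : Sig k}
    (h : Interlaces mu lam) :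
    skewP q t x lam mu = psi q t lam mu * x ^ (lam.size - mu.size) := if_pos h

theorem skewP_of_not_interlaces (q t x : ℝ) {k : ℕ} {lam : Sig (k + 1)} {mu : Sig k}
    (h : ¬ Interlaces mu lam) : skewP q t x lam mu = 0 := if_neg h

theorem macP_eq_sum (q t : ℝ) (a : ℕ → ℝ) {k : ℕ} (lam : Sig k) :
    macP q t a lam = ∑ X ∈ schemes lam, weight (fun k => skewP q t (a k)) X :=
  tsum_top lam (weight fun k => skewP q t (a k))

theorem schemes_zero (x : Sig 0) : schemes x = {default} := by
  ext X
  have : X.top = x := Subtype.ext (funext fun i => i.elim0)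
  exact iff_of_true (mem_schemes.2 this) (Finset.mem_singleton.2 (GTScheme.eq_of_zero _ _))

theorem macP_zero (q t : ℝ) (a : ℕ → ℝ) (lam : Sig 0) : macP q t a lam = 1 := by
  rw [macP_eq_sum, schemes_zero, Finset.sum_singleton, weight_zero]

/-- The branching rule. -/
theorem macP_succ (q t : ℝ) (a : ℕ → ℝ) {k : ℕ} (lam : Sig (k + 1)) :
    macP q t a lam = ∑ mu ∈ below lam, macP q t a mu * skewP q t (a k) lam mu := by
  simp only [macP_eq_sum, sum_weight_succ]

theorem skewP_pos (hq0 : 0 ≤ q) (hq1 : q < 1) (ht0 : 0 ≤ t) (ht1 : t < 1) {x : ℝ} (hx : 0 < x)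
    {k : ℕ} {lam : Sig (k + 1)} {mu : Sig k} (h : Interlaces mu lam) :
    0 < skewP q t x lam mu := by
  rw [skewP_of_interlaces _ _ _ h]
  exact mul_pos (psi_pos hq0 hq1 ht0 ht1 h) (zpow_pos hx _)

theorem macP_pos (hq0 : 0 ≤ q) (hq1 : q < 1) (ht0 : 0 ≤ t) (ht1 : t < 1) {k : ℕ}
    (ha : ∀ i < k, 0 < a i) (lam : Sig k) : 0 < macP q t a lam := by
  induction k with
  | zero => rw [macP_zero]; exact one_pos
  | succ k ih =>
    rw [macP_succ]
    exact Finset.sum_pos (fun mu hmu => mul_pos (ih (fun i hi => ha i (by omega)) mu)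
      (skewP_pos hq0 hq1 ht0 ht1 (ha k (by omega)) (mem_below.1 hmu))) (below_nonempty lam)

theorem link_of_not_interlaces (q t : ℝ) (a : ℕ → ℝ) {k : ℕ} {lam : Sig (k + 1)} {mu : Sig k}
    (h : ¬ Interlaces mu lam) : link q t a k lam mu = 0 := by
  rw [link, skewP_of_not_interlaces _ _ _ h, mul_zero]

theorem link_pos (hq0 : 0 ≤ q) (hq1 : q < 1) (ht0 : 0 ≤ t) (ht1 : t < 1) {k : ℕ}
    (ha : ∀ i < k + 1, 0 < a i) {lam : Sig (k + 1)} {mu : Sig k} (h : Interlaces mu lam) :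
    0 < link q t a k lam mu :=
  mul_pos (div_pos (macP_pos hq0 hq1 ht0 ht1 (fun i hi => ha i (by omega)) _)
    (macP_pos hq0 hq1 ht0 ht1 ha _)) (skewP_pos hq0 hq1 ht0 ht1 (ha k (by omega)) h)

theorem sum_link (hq0 : 0 ≤ q) (hq1 : q < 1) (ht0 : 0 ≤ t) (ht1 : t < 1) {k : ℕ}
    (ha : ∀ i < k + 1, 0 < a i) (lam : Sig (k + 1)) :
    ∑ mu ∈ below lam, link q t a k lam mu = 1 := by
  have h := macP_succ q t a lam
  have hpos := macP_pos hq0 hq1 ht0 ht1 ha lam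
  simp only [link, div_mul_eq_mul_div]
  rw [← Finset.sum_div, ← h, div_self hpos.ne']

/-- The Gibbs weights form a probability distribution, since every link is stochastic. This is what
integrates out the lower rows in the projections. -/
theorem sum_weight_link (hq0 : 0 ≤ q) (hq1 : q < 1) (ht0 : 0 ≤ t) (ht1 : t < 1) {k : ℕ}
    (ha : ∀ i < k, 0 < a i) (lam : Sig k) :
    ∑ X ∈ schemes lam, weight (link q t a) X = 1 := by
  induction k with
  | zero => rw [schemes_zero, Finset.sum_singleton, weight_zero]
  | succ k ih =>
    rw [sum_weight_succ, ← sum_link hq0 hq1 ht0 ht1 ha lam]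
    refine Finset.sum_congr rfl fun mu _ => ?_
    rw [ih (fun i hi => ha i (by omega)), one_mul]

theorem tsum_eq_sum_below {k : ℕ} (lam : Sig (k + 1)) (F : Sig k → ℝ)
    (hF : ∀ mu, ¬ Interlaces mu lam → F mu = 0) : ∑' mu, F mu = ∑ mu ∈ below lam, F mu :=
  tsum_eq_sum fun mu hmu => hF mu fun h => hmu (mem_below.2 h)

end

end MacdonaldDynamics

namespace MacdonaldDynamics

noncomputable section

/-! ### Adding a box -/

theorem isAddBox_add {k : ℕ} (x : Sig k) (j : Fin k) (h : Antitone (x.1 + Pi.single j 1)) :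
    IsAddBox x ⟨x.1 + Pi.single j 1, h⟩ j := rfl

theorem isAddBox_sub {k : ℕ} (x : Sig k) (j : Fin k) (h : Antitone (x.1 - Pi.single j 1)) :
    IsAddBox ⟨x.1 - Pi.single j 1, h⟩ x j := (sub_add_cancel _ _).symm

theorem IsAddBox.antitone_add {k : ℕ} {x y : Sig k} {j : Fin k} (h : IsAddBox x y j) :
    Antitone (x.1 + Pi.single j 1) := by rw [← show y.1 = _ from h]; exact y.2

theorem IsAddBox.eq_add {k : ℕ} {x y : Sig k} {j : Fin k} (h : IsAddBox x y j) :
    y = ⟨x.1 + Pi.single j 1, h.antitone_add⟩ := Subtype.ext h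

theorem IsAddBox.sub_eq {k : ℕ} {x y : Sig k} {j : Fin k} (h : IsAddBox x y j) :
    y.1 - Pi.single j 1 = x.1 := sub_eq_iff_eq_add.2 h

theorem IsAddBox.antitone_sub {k : ℕ} {x y : Sig k} {j : Fin k} (h : IsAddBox x y j) :
    Antitone (y.1 - Pi.single j 1) := by rw [h.sub_eq]; exact x.2

theorem IsAddBox.eq_sub {k : ℕ} {x y : Sig k} {j : Fin k} (h : IsAddBox x y j) :
    x = ⟨y.1 - Pi.single j 1, h.antitone_sub⟩ := Subtype.ext h.sub_eq.symm

theorem IsAddBox.unique {k : ℕ} {x y : Sig k} {i j : Fin k} (hi : IsAddBox x y i)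
    (hj : IsAddBox x y j) : i = j := by
  by_contra hne
  have h1 := hi.apply_self
  have h2 := hj.apply_ne hne
  omega

theorem IsAddBox.ne {k : ℕ} {x y : Sig k} {j : Fin k} (h : IsAddBox x y j) : x ≠ y := by
  rintro rfl
  have := h.apply_self
  omega

theorem IsAddBox.size_eq {k : ℕ} {x y : Sig k} {j : Fin k} (h : IsAddBox x y j) :
    y.size = x.size + 1 := by
  rw [Sig.size, show y.1 = _ from h]
  simp [Finset.sum_add_distrib, Sig.size]

theorem finite_ups {k : ℕ} (x : Sig k) : {y : Sig k | ∃ j, IsAddBox x y j}.Finite := by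
  have : {y : Sig k | ∃ j, IsAddBox x y j} = ⋃ j, {y | IsAddBox x y j} := by
    ext; simp
  rw [this]
  refine Set.finite_iUnion fun j => Set.Subsingleton.finite ?_
  intro y hy z hz
  exact IsAddBox.eq_add hy |>.trans (IsAddBox.eq_add hz).symm

/-- The signatures obtained by adding one box. -/
def ups {k : ℕ} (x : Sig k) : Finset (Sig k) := (finite_ups x).toFinset

@[simp]
theorem mem_ups {k : ℕ} {x y : Sig k} : y ∈ ups x ↔ ∃ j, IsAddBox x y j := by simp [ups]

open scoped Classical in
theorem sum_ups_eq {k : ℕ} (x : Sig k) (F : Sig k → Fin k → ℝ) :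
    ∑ y ∈ ups x, ∑ j, (if IsAddBox x y j then F y j else 0) =
      ∑ j, if h : Antitone (x.1 + Pi.single j 1) then F ⟨x.1 + Pi.single j 1, h⟩ j else 0 := by
  rw [Finset.sum_comm]
  refine Finset.sum_congr rfl fun j _ => ?_
  split_ifs with h
  · rw [Finset.sum_eq_single ⟨x.1 + Pi.single j 1, h⟩, if_pos (isAddBox_add x j h)]
    · intro y _ hy
      exact if_neg fun hb => hy hb.eq_add
    · intro hn
      exact absurd (mem_ups.2 ⟨j, isAddBox_add x j h⟩) hn
  · exact Finset.sum_eq_zero fun y _ => if_neg fun hb => h hb.antitone_add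

open scoped Classical in
theorem sum_below_eq {k : ℕ} (lam : Sig (k + 1)) (y : Sig k) (F : Sig k → Fin k → ℝ)
    (hF : ∀ mu j, ¬ Interlaces mu lam → F mu j = 0) :
    ∑ mu ∈ below lam, ∑ j, (if IsAddBox mu y j then F mu j else 0) =
      ∑ j, if h : Antitone (y.1 - Pi.single j 1) then F ⟨y.1 - Pi.single j 1, h⟩ j else 0 := by
  rw [Finset.sum_comm]
  refine Finset.sum_congr rfl fun j _ => ?_
  split_ifs with h
  · rw [Finset.sum_eq_single ⟨y.1 - Pi.single j 1, h⟩, if_pos (isAddBox_sub y j h)]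
    · intro mu _ hmu
      exact if_neg fun hb => hmu hb.eq_sub
    · intro hn
      rw [hF _ _ fun hi => hn (mem_below.2 hi), ite_self]
  · exact Finset.sum_eq_zero fun y _ => if_neg fun hb => h hb.antitone_sub

/-! ### Pushing -/

/-- The only inequality that `lam` can violate is mu_c ≤ lam_c, repaired by the new box; so the box
sits at c and mu_c = lam_c + 1. Removing a box at c from `mu` therefore restores the interlacing
with `lam`. -/
theorem exists_push_of_right {k : ℕ} {mu : Sig k} {lam nu : Sig (k + 1)} {j : Fin (k + 1)}
    (hbox : IsAddBox lam nu j) (h : Interlaces mu nu) (hn : ¬ Interlaces mu lam) :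
    ∃ c : Fin k, j = c.castSucc ∧ ∃ mu', IsAddBox mu' mu c ∧ Interlaces mu' lam ∧
      lam.1 c.castSucc = mu'.1 c := by
  have hle : ∀ i, lam.1 i ≤ nu.1 i := fun i => by
    by_cases hi : i = j
    · rw [hi, hbox.apply_self]; omega
    · rw [hbox.apply_ne hi]
  unfold Interlaces at hn
  push Not at hn
  obtain ⟨c, hc⟩ := hn
  have h1 := h c
  have h2 := hc ((hle _).trans h1.1)
  have hj : c.castSucc = j := by
    by_contra hne
    have := hbox.apply_ne hne
    omega
  subst hj
  have h3 := hbox.apply_self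
  have h4 := hbox.apply_ne (Fin.castSucc_lt_succ (i := c)).ne'
  have h5 := lam.2 (Fin.castSucc_lt_succ (i := c)).le
  have hanti := h.antitone_sub_single (i := c) (by omega)
  have hb := isAddBox_sub mu c hanti
  refine ⟨c, rfl, _, hb, ?_, ?_⟩
  · intro i
    have hi := h i
    by_cases hic : i = c
    · subst hic
      have := hb.apply_self
      omega
    · rw [← hb.apply_ne hic]
      have := hbox.apply_ne (i := i.castSucc) (by simpa using hic)
      have := hle i.succ
      omega
  · have := hb.apply_self
    omega

/-- The mirror image: a box that breaks the interlacing sits at a coordinate equal to the one above,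
which then has room to move up. -/
theorem exists_push_of_left {k : ℕ} {mu' mu : Sig k} {lam : Sig (k + 1)} {c : Fin k}
    (hbox : IsAddBox mu' mu c) (h : Interlaces mu' lam) (hn : ¬ Interlaces mu lam) :
    lam.1 c.castSucc = mu'.1 c ∧ ∃ nu, IsAddBox lam nu c.castSucc ∧ Interlaces mu nu := by
  have hs := hbox.apply_self
  have hc : lam.1 c.castSucc = mu'.1 c := by
    by_contra hne
    apply hn
    intro i
    have hi := h i
    by_cases hic : i = c
    · subst hic; omega
    · rw [hbox.apply_ne hic]; exact hi
  have hanti := h.antitone_add_single (j := c.castSucc) fun r hr => by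
    have hrc : r < c := Fin.castSucc_lt_castSucc_iff.1 (hr ▸ Fin.castSucc_lt_succ)
    have h1 := mu.2 hrc.le
    have h2 := hbox.apply_ne hrc.ne
    omega
  have hb := isAddBox_add lam c.castSucc hanti
  refine ⟨hc, _, hb, ?_⟩
  intro i
  have hi := h i
  have e1 := hb.apply_self
  by_cases hic : i = c
  · subst hic
    rw [hb.apply_ne (Fin.castSucc_lt_succ (i := i)).ne']
    omega
  · rw [hbox.apply_ne hic, hb.apply_ne (i := i.castSucc) (by simpa using hic)]
    refine ⟨?_, hi.2⟩
    by_cases his : i.succ = c.castSucc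
    · have hlt : i < c := Fin.castSucc_lt_castSucc_iff.1 (his ▸ Fin.castSucc_lt_succ)
      have h1 := mu.2 hlt.le
      have h2 := hbox.apply_ne hic
      rw [his]
      omega
    · rw [hb.apply_ne his]; exact hi.1

/-! ### The commutation relation and the Pieri rule -/

variable {q t : ℝ} {a : ℕ → ℝ}

open scoped Classical in
/-- The coefficients of the Pieri rule. -/
def pieri (q t : ℝ) {k : ℕ} (x y : Sig k) : ℝ :=
  ∑ j : Fin k, if IsAddBox x y j then psiPrime q t y x j else 0

theorem pieri_of_isAddBox (q t : ℝ) {k : ℕ} {x y : Sig k} {j : Fin k} (h : IsAddBox x y j) :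
    pieri q t x y = psiPrime q t y x j := by
  classical
  rw [pieri, Finset.sum_eq_single j, if_pos h]
  · exact fun i _ hi => if_neg fun hb => hi (hb.unique h)
  · simp

theorem pieri_eq_zero (q t : ℝ) {k : ℕ} {x y : Sig k} (h : y ∉ ups x) : pieri q t x y = 0 := by
  classical
  exact Finset.sum_eq_zero fun j _ => if_neg fun hb => h (mem_ups.2 ⟨j, hb⟩)

theorem skewP_add_right (hq0 : 0 ≤ q) (hq1 : q < 1) (ht0 : 0 ≤ t) (ht1 : t < 1) {z : ℝ}
    (hz : 0 < z) {k : ℕ} {mu : Sig k} {lam nu : Sig (k + 1)} {j : Fin (k + 1)}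
    (hbox : IsAddBox lam nu j) (h : Interlaces mu lam) :
    psiPrime q t nu lam j * skewP q t z nu mu =
      Scoef q t mu lam j * (z * skewP q t z lam mu) := by
  by_cases h' : Interlaces mu nu
  · rw [skewP_of_interlaces _ _ _ h, skewP_of_interlaces _ _ _ h', hbox.size_eq,
      add_sub_right_comm, zpow_add_one₀ hz.ne', ← mul_assoc,
      psiPrime_mul_psi_eq_Scoef_mul hq0 hq1 ht0 ht1 hbox h h']
    ring
  · rw [skewP_of_not_interlaces _ _ _ h']
    rw [h.isAddBox_right_iff hbox] at h'
    push Not at h'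
    obtain ⟨r, rfl, hr⟩ := h'
    rw [Scoef_eq_zero q t (le_antisymm hr (h r).1)]
    ring

/-- The factor z compensates for the extra box in the exponent. When `mu'` does not interlace, both
sides vanish, which is where the vanishing of T_i is used. -/
theorem skewP_sub_left (hq0 : 0 ≤ q) (hq1 : q < 1) (ht0 : 0 ≤ t) (ht1 : t < 1) {z : ℝ}
    (hz : 0 < z) {k : ℕ} {mu' mu : Sig k} {lam : Sig (k + 1)} {i : Fin k}
    (hbox : IsAddBox mu' mu i) (h : Interlaces mu lam) :
    skewP q t z lam mu' * psiPrime q t mu mu' i =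
      Tcoef q t mu lam i * (z * skewP q t z lam mu) := by
  by_cases h' : Interlaces mu' lam
  · rw [skewP_of_interlaces _ _ _ h, skewP_of_interlaces _ _ _ h', hbox.size_eq,
      show lam.size - mu'.size = lam.size - (mu'.size + 1) + 1 by ring, zpow_add_one₀ hz.ne',
      mul_right_comm, psi_mul_psiPrime_eq_Tcoef_mul hq0 hq1 ht0 ht1 hbox h' h]
    ring
  · rw [skewP_of_not_interlaces _ _ _ h']
    rw [h.isAddBox_left_iff hbox, not_not] at h'
    rw [Tcoef_eq_zero q t h']
    ring

theorem skewP_push (hq0 : 0 ≤ q) (hq1 : q < 1) (ht0 : 0 ≤ t) (ht1 : t < 1) (z : ℝ)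
    {k : ℕ} {mu' mu : Sig k} {lam nu : Sig (k + 1)} {c : Fin k}
    (hmu : IsAddBox mu' mu c) (hlam : IsAddBox lam nu c.castSucc) (h' : Interlaces mu' lam)
    (h : Interlaces mu nu) (hc : lam.1 c.castSucc = mu'.1 c) :
    psiPrime q t nu lam c.castSucc * skewP q t z nu mu =
      skewP q t z lam mu' * psiPrime q t mu mu' c := by
  rw [skewP_of_interlaces _ _ _ h, skewP_of_interlaces _ _ _ h', hlam.size_eq, hmu.size_eq,
    add_sub_add_right_eq_sub, mul_right_comm,
    psi_mul_psiPrime_push hq0 hq1 ht0 ht1 hmu hlam h' h hc]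
  ring

/-- Commutation of the Pieri operators with the branching operators. -/
theorem sum_pieri_mul_skewP (hq0 : 0 ≤ q) (hq1 : q < 1) (ht0 : 0 ≤ t) (ht1 : t < 1) {z : ℝ}
    (hz : 0 < z) {k : ℕ} (x : Sig (k + 1)) (yb : Sig k) :
    ∑ y ∈ ups x, pieri q t x y * skewP q t z y yb =
      ∑ xb ∈ below x, skewP q t z x xb * pieri q t xb yb + z * skewP q t z x yb := by
  classical
  have eL : ∑ y ∈ ups x, pieri q t x y * skewP q t z y yb =
      ∑ j, if h : Antitone (x.1 + Pi.single j 1) then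
        psiPrime q t ⟨x.1 + Pi.single j 1, h⟩ x j * skewP q t z ⟨x.1 + Pi.single j 1, h⟩ yb
        else 0 := by
    rw [← sum_ups_eq x (fun y j => psiPrime q t y x j * skewP q t z y yb)]
    simp only [pieri, Finset.sum_mul, ite_mul, zero_mul]
  have eR : ∑ xb ∈ below x, skewP q t z x xb * pieri q t xb yb =
      ∑ j, if h : Antitone (yb.1 - Pi.single j 1) then
        skewP q t z x ⟨yb.1 - Pi.single j 1, h⟩ * psiPrime q t yb ⟨yb.1 - Pi.single j 1, h⟩ j
        else 0 := by
    rw [← sum_below_eq x yb (fun mu j => skewP q t z x mu * psiPrime q t yb mu j)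
      fun mu j h => by rw [skewP_of_not_interlaces _ _ _ h, zero_mul]]
    simp only [pieri, Finset.mul_sum, mul_ite, mul_zero]
  rw [eL, eR]
  by_cases hx : Interlaces yb x
  -- All terms are multiples of z P_{x/yb}(z), including those where no signature results, for which
  -- S_j or T_j is 0. What remains is the identity ∑ S_j - ∑ T_i = 1.
  · have hL : ∀ j : Fin (k + 1), (if h : Antitone (x.1 + Pi.single j 1) then
        psiPrime q t ⟨x.1 + Pi.single j 1, h⟩ x j * skewP q t z ⟨x.1 + Pi.single j 1, h⟩ yb
        else 0) = Scoef q t yb x j * (z * skewP q t z x yb) := by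
      intro j
      split_ifs with h
      · exact skewP_add_right hq0 hq1 ht0 ht1 hz (isAddBox_add x j h) hx
      · have : ¬ ∀ r : Fin k, r.succ = j → x.1 j < yb.1 r := fun hj =>
          h (hx.antitone_add_single hj)
        push Not at this
        obtain ⟨r, rfl, hr⟩ := this
        rw [Scoef_eq_zero q t (le_antisymm hr (hx r).1), zero_mul]
    have hR : ∀ j : Fin k, (if h : Antitone (yb.1 - Pi.single j 1) then
        skewP q t z x ⟨yb.1 - Pi.single j 1, h⟩ * psiPrime q t yb ⟨yb.1 - Pi.single j 1, h⟩ j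
        else 0) = Tcoef q t yb x j * (z * skewP q t z x yb) := by
      intro j
      split_ifs with h
      · exact skewP_sub_left hq0 hq1 ht0 ht1 hz (isAddBox_sub yb j h) hx
      · have : yb.1 j = x.1 j.succ := by
          by_contra hne
          exact h (hx.antitone_sub_single hne)
        rw [Tcoef_eq_zero q t this, zero_mul]
    simp only [hL, hR, ← Finset.sum_mul]
    linear_combination (z * skewP q t z x yb) * sum_Scoef_sub_sum_Tcoef hq0 hq1 ht0 ht1 hx
  -- Now the last summand vanishes, and the two sums agree term by term: x + e_c lies above `yb`
  -- exactly when yb - e_c lies below `x`. The last coordinate of `x` never repairs an interlacing.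
  · rw [skewP_of_not_interlaces _ _ _ hx, mul_zero, add_zero, Fin.sum_univ_castSucc]
    have hlast : (if h : Antitone (x.1 + Pi.single (Fin.last k) 1) then
        psiPrime q t ⟨x.1 + Pi.single (Fin.last k) 1, h⟩ x (Fin.last k) *
          skewP q t z ⟨x.1 + Pi.single (Fin.last k) 1, h⟩ yb else 0) = 0 := by
      split_ifs with h
      · rw [skewP_of_not_interlaces, mul_zero]
        intro hy
        obtain ⟨c, hc, -⟩ := exists_push_of_right (isAddBox_add x _ h) hy hx
        exact (Fin.castSucc_lt_last c).ne' hc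
      · rfl
    rw [hlast, add_zero]
    refine Finset.sum_congr rfl fun c _ => ?_
    by_cases hP : ∃ nu, IsAddBox x nu c.castSucc ∧ Interlaces yb nu
    · obtain ⟨nu, hnu, hi⟩ := hP
      obtain ⟨c', hc', mu', hmu, hmu', hcc⟩ := exists_push_of_right hnu hi hx
      obtain rfl := Fin.castSucc_injective _ hc'
      rw [dif_pos hnu.antitone_add, dif_pos hmu.antitone_sub, ← hnu.eq_add, ← hmu.eq_sub]
      exact skewP_push hq0 hq1 ht0 ht1 z hmu hnu hmu' hi hcc
    · have hQ : ¬ ∃ mu', IsAddBox mu' yb c ∧ Interlaces mu' x := fun ⟨mu', h1, h2⟩ =>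
        hP (exists_push_of_left h1 h2 hx).2
      rw [dite_eq_right_iff.2, dite_eq_right_iff.2]
      · intro h
        rw [skewP_of_not_interlaces _ _ _ fun hi => hQ ⟨_, isAddBox_sub yb c h, hi⟩, zero_mul]
      · intro h
        rw [skewP_of_not_interlaces _ _ _ fun hi => hP ⟨_, isAddBox_add x _ h, hi⟩, mul_zero]

/-- The Pieri rule. -/
theorem sum_pieri_mul_macP (hq0 : 0 ≤ q) (hq1 : q < 1) (ht0 : 0 ≤ t) (ht1 : t < 1) {k : ℕ}
    (ha : ∀ i < k, 0 < a i) (x : Sig k) :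
    ∑ y ∈ ups x, pieri q t x y * macP q t a y =
      (∑ i ∈ Finset.range k, a i) * macP q t a x := by
  classical
  induction k with
  | zero =>
    rw [Finset.range_zero, Finset.sum_empty, zero_mul]
    exact Finset.sum_eq_zero fun y hy => (mem_ups.1 hy).elim fun j _ => j.elim0
  | succ k ih =>
    -- A finite set containing every lower row that occurs, so that all sums can be taken over it
    -- and exchanged.
    set B : Finset (Sig k) := (ups x).biUnion below ∪ (below x ∪ (below x).biUnion ups) with hB
    have hmac : ∀ y : Sig (k + 1), below y ⊆ B → macP q t a y =
        ∑ yb ∈ B, macP q t a yb * skewP q t (a k) y yb := by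
      intro y hy
      rw [macP_succ]
      refine Finset.sum_subset hy fun yb _ hyb => ?_
      rw [skewP_of_not_interlaces _ _ _ fun h => hyb (mem_below.2 h), mul_zero]
    have h1 : ∑ y ∈ ups x, pieri q t x y * macP q t a y =
        ∑ yb ∈ B, macP q t a yb * ∑ y ∈ ups x, pieri q t x y * skewP q t (a k) y yb := by
      simp only [Finset.mul_sum]
      rw [Finset.sum_comm]
      refine Finset.sum_congr rfl fun y hy => ?_
      rw [hmac y ((Finset.subset_biUnion_of_mem below hy).trans Finset.subset_union_left),
        Finset.mul_sum]
      exact Finset.sum_congr rfl fun yb _ => mul_left_comm _ _ _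
    have h2 : ∀ xb ∈ below x, ∑ yb ∈ B, pieri q t xb yb * macP q t a yb =
        (∑ i ∈ Finset.range k, a i) * macP q t a xb := by
      intro xb hxb
      rw [← ih (fun i hi => ha i (by omega)) xb]
      symm
      refine Finset.sum_subset ?_ fun y _ hy => ?_
      · exact (Finset.subset_biUnion_of_mem ups hxb).trans
          (Finset.subset_union_right.trans Finset.subset_union_right)
      · rw [pieri_eq_zero q t hy, zero_mul]
    have h3 : ∑ yb ∈ B, macP q t a yb *
        ∑ xb ∈ below x, skewP q t (a k) x xb * pieri q t xb yb =
        (∑ i ∈ Finset.range k, a i) * macP q t a x := by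
      simp only [Finset.mul_sum]
      rw [Finset.sum_comm, macP_succ, Finset.mul_sum]
      refine Finset.sum_congr rfl fun xb hxb => ?_
      rw [← mul_assoc, ← h2 xb hxb, Finset.sum_mul]
      exact Finset.sum_congr rfl fun yb _ => by ring
    rw [h1]
    simp only [sum_pieri_mul_skewP hq0 hq1 ht0 ht1 (ha k (by omega)), mul_add,
      Finset.sum_add_distrib]
    rw [h3, Finset.sum_range_succ, add_mul,
      hmac x (Finset.subset_union_left.trans Finset.subset_union_right), Finset.mul_sum (a := a k)]
    exact congrArg _ (Finset.sum_congr rfl fun yb _ => mul_left_comm _ _ _)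

end

end MacdonaldDynamics

namespace MacdonaldDynamics

noncomputable section

variable {q t : ℝ} {a : ℕ → ℝ} {W : IndepRates} {V : TrigProbs} {N : ℕ}

/-! ### The univariate rates -/

theorem univOffDiag_eq (q t : ℝ) (a : ℕ → ℝ) {k : ℕ} (x y : Sig k) :
    univOffDiag q t a k x y = macP q t a y / macP q t a x * pieri q t x y := by
  simp only [univOffDiag, pieri, Finset.mul_sum, mul_ite, mul_zero]

theorem univOffDiag_eq_zero (q t : ℝ) (a : ℕ → ℝ) {k : ℕ} {x y : Sig k} (h : y ∉ ups x) :
    univOffDiag q t a k x y = 0 := by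
  rw [univOffDiag_eq, pieri_eq_zero q t h, mul_zero]

/-- The Pieri rule divided by P_x: the exit rate does not depend on the state. -/
theorem sum_univOffDiag (hq0 : 0 ≤ q) (hq1 : q < 1) (ht0 : 0 ≤ t) (ht1 : t < 1) {k : ℕ}
    (ha : ∀ i < k, 0 < a i) (x : Sig k) :
    ∑ y ∈ ups x, univOffDiag q t a k x y = ∑ i ∈ Finset.range k, a i := by
  have h := sum_pieri_mul_macP hq0 hq1 ht0 ht1 ha x
  have hx := (macP_pos hq0 hq1 ht0 ht1 ha x).ne'
  rw [← div_eq_iff hx] at h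
  rw [← h, Finset.sum_div]
  refine Finset.sum_congr rfl fun y _ => ?_
  rw [univOffDiag_eq]
  ring

theorem univRate_self (hq0 : 0 ≤ q) (hq1 : q < 1) (ht0 : 0 ≤ t) (ht1 : t < 1) {k : ℕ}
    (ha : ∀ i < k, 0 < a i) (x : Sig k) :
    univRate q t a k x x = -∑ i ∈ Finset.range k, a i := by
  rw [univRate, if_pos rfl, ← sum_univOffDiag hq0 hq1 ht0 ht1 ha x,
    tsum_eq_sum fun y hy => univOffDiag_eq_zero q t a hy]

theorem univRate_of_ne (q t : ℝ) (a : ℕ → ℝ) {k : ℕ} {x y : Sig k} (h : x ≠ y) :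
    univRate q t a k x y = macP q t a y / macP q t a x * pieri q t x y := by
  rw [univRate, if_neg h, univOffDiag_eq]

theorem univRate_of_isAddBox (q t : ℝ) (a : ℕ → ℝ) {k : ℕ} {x y : Sig k} {j : Fin k}
    (h : IsAddBox x y j) :
    univRate q t a k x y = macP q t a y / macP q t a x * psiPrime q t y x j := by
  rw [univRate_of_ne q t a h.ne, pieri_of_isAddBox q t h]

theorem univRate_eq_zero (q t : ℝ) (a : ℕ → ℝ) {k : ℕ} {x y : Sig k} (h : x ≠ y)
    (h' : ∀ j, ¬ IsAddBox x y j) : univRate q t a k x y = 0 := by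
  rw [univRate_of_ne q t a h, pieri_eq_zero q t (by simpa using h'), mul_zero]

theorem univRate_pos (hq0 : 0 ≤ q) (hq1 : q < 1) (ht0 : 0 ≤ t) (ht1 : t < 1) {k : ℕ}
    (ha : ∀ i < k, 0 < a i) {x y : Sig k} {j : Fin k} (h : IsAddBox x y j) :
    0 < univRate q t a k x y := by
  rw [univRate_of_isAddBox q t a h]
  exact mul_pos (div_pos (macP_pos hq0 hq1 ht0 ht1 ha y) (macP_pos hq0 hq1 ht0 ht1 ha x))
    (psiPrime_pos hq0 hq1 ht0 ht1 h)

theorem univRate_nonneg (hq0 : 0 ≤ q) (hq1 : q < 1) (ht0 : 0 ≤ t) (ht1 : t < 1) {k : ℕ}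
    (ha : ∀ i < k, 0 < a i) {x y : Sig k} (h : x ≠ y) : 0 ≤ univRate q t a k x y := by
  by_cases hb : ∃ j, IsAddBox x y j
  · obtain ⟨j, hj⟩ := hb
    exact (univRate_pos hq0 hq1 ht0 ht1 ha hj).le
  · rw [univRate_eq_zero q t a h (not_exists.1 hb)]

theorem univRate_finite (q t : ℝ) (a : ℕ → ℝ) {k : ℕ} (x : Sig k) :
    {y | univRate q t a k x y ≠ 0}.Finite := by
  classical
  refine (insert x (ups x)).finite_toSet.subset fun y hy => ?_
  by_contra h
  simp only [Finset.coe_insert, Set.mem_insert_iff, Finset.mem_coe, mem_ups, not_or,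
    not_exists] at h
  exact hy (univRate_eq_zero q t a (Ne.symm h.1) h.2)

theorem abs_univRate_le (hq0 : 0 ≤ q) (hq1 : q < 1) (ht0 : 0 ≤ t) (ht1 : t < 1) {k : ℕ}
    (ha : ∀ i < k, 0 < a i) (x y : Sig k) :
    |univRate q t a k x y| ≤ ∑ i ∈ Finset.range k, a i := by
  have hs : 0 ≤ ∑ i ∈ Finset.range k, a i :=
    Finset.sum_nonneg fun i hi => (ha i (Finset.mem_range.1 hi)).le
  by_cases hxy : x = y
  · subst hxy
    rw [univRate_self hq0 hq1 ht0 ht1 ha, abs_neg, abs_of_nonneg hs]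
  · by_cases hb : ∃ j, IsAddBox x y j
    · rw [abs_of_nonneg (univRate_nonneg hq0 hq1 ht0 ht1 ha hxy),
        ← sum_univOffDiag hq0 hq1 ht0 ht1 ha x, univRate, if_neg hxy]
      refine Finset.single_le_sum (f := fun y => univOffDiag q t a k x y) (fun z hz => ?_)
        (mem_ups.2 hb)
      obtain ⟨j, hj⟩ := mem_ups.1 hz
      have := univRate_nonneg hq0 hq1 ht0 ht1 ha hj.ne
      rwa [univRate, if_neg hj.ne] at this
    · rw [univRate_eq_zero q t a hxy (not_exists.1 hb), abs_zero]
      exact hs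

/-- The links intertwine the univariate dynamics. -/
theorem sum_univRate_mul_link (hq0 : 0 ≤ q) (hq1 : q < 1) (ht0 : 0 ≤ t) (ht1 : t < 1) {k : ℕ}
    (ha : ∀ i < k + 1, 0 < a i) (x : Sig (k + 1)) (yb : Sig k) :
    ∑ y ∈ ups x, univRate q t a (k + 1) x y * link q t a k y yb +
        univRate q t a (k + 1) x x * link q t a k x yb =
      ∑ xb ∈ below x, link q t a k x xb * univRate q t a k xb yb := by
  classical
  have ha' : ∀ i < k, 0 < a i := fun i hi => ha i (by omega)
  have hx := (macP_pos hq0 hq1 ht0 ht1 ha x).ne'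
  have hyb := (macP_pos hq0 hq1 ht0 ht1 ha' yb).ne'
  have h := sum_pieri_mul_skewP hq0 hq1 ht0 ht1 (ha k (by omega)) x yb
  have h1 : ∑ y ∈ ups x, univRate q t a (k + 1) x y * link q t a k y yb =
      macP q t a yb / macP q t a x * ∑ y ∈ ups x, pieri q t x y * skewP q t (a k) y yb := by
    rw [Finset.mul_sum]
    refine Finset.sum_congr rfl fun y hy => ?_
    obtain ⟨j, hj⟩ := mem_ups.1 hy
    have hy := (macP_pos hq0 hq1 ht0 ht1 ha y).ne'
    rw [univRate_of_ne q t a hj.ne, link]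
    field_simp
  -- The diagonal rates on the two levels differ by -a_k, which cancels the extra term a_k
  -- P_{x/yb}(a_k) of the commutation relation.
  have h2 : ∀ xb, link q t a k x xb * univRate q t a k xb yb =
      macP q t a yb / macP q t a x * (skewP q t (a k) x xb * pieri q t xb yb) +
        if xb = yb then link q t a k x yb * -∑ i ∈ Finset.range k, a i else 0 := by
    intro xb
    have hxb := (macP_pos hq0 hq1 ht0 ht1 ha' xb).ne'
    split_ifs with hxy
    · subst hxy
      rw [univRate_self hq0 hq1 ht0 ht1 ha', pieri_eq_zero q t (by
        simpa using fun j hj => IsAddBox.ne (x := xb) (y := xb) (j := j) hj rfl)]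
      ring
    · rw [univRate_of_ne q t a hxy, link]
      field_simp
      ring
  rw [h1, h, Finset.sum_congr rfl fun xb _ => h2 xb, Finset.sum_add_distrib, ← Finset.mul_sum,
    univRate_self hq0 hq1 ht0 ht1 ha, Finset.sum_range_succ, Finset.sum_ite_eq']
  split_ifs with hb
  · rw [link]
    ring
  · rw [link_of_not_interlaces q t a (fun hi => hb (mem_below.2 hi)),
      skewP_of_not_interlaces _ _ _ fun hi => hb (mem_below.2 hi)]
    ring

/-! ### The recursion for the jump rates of truncations -/

theorem offDiagRate_zero (X Y : GTScheme 0) : offDiagRate W V 0 X Y = 0 := rfl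

theorem offDiagRate_self {m : ℕ} (X : GTScheme m) : offDiagRate W V m X X = 0 :=
  Finset.sum_eq_zero fun _ _ => if_neg fun h => h.2 rfl

theorem row_eq_iff {m : ℕ} {X Y : GTScheme m} : (∀ j : Fin (m + 1), X.row j = Y.row j) ↔ X = Y :=
  ⟨fun h => GTScheme.ext (funext h), fun h => by simp [h]⟩

open scoped Classical in
-- Either the change starts below, and the last row is triggered through `V`, or the last row is the
-- first to change, at rate `W`. When the truncations agree the first term vanishes, as
-- `offDiagRate` is 0 on the diagonal.
theorem offDiagRate_succ {m : ℕ} (X Y : GTScheme (m + 1)) :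
    offDiagRate W V (m + 1) X Y =
      offDiagRate W V m X.trunc Y.trunc * V m X.top Y.top X.trunc.top Y.trunc.top +
        if X.trunc = Y.trunc ∧ X.top ≠ Y.top then W m X.top Y.top X.trunc.top else 0 := by
  rw [offDiagRate, Fin.sum_univ_castSucc]
  congr 1
  · rw [offDiagRate, Finset.sum_mul]
    refine Finset.sum_congr rfl fun k _ => ?_
    have hiff : ((∀ j : Fin (m + 1 + 1), j ≤ k.castSucc.castSucc → X.row j = Y.row j) ∧
        X.row k.castSucc.succ ≠ Y.row k.castSucc.succ) ↔
        ((∀ j : Fin (m + 1), j ≤ k.castSucc → X.trunc.row j = Y.trunc.row j) ∧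
          X.trunc.row k.succ ≠ Y.trunc.row k.succ) := by
      refine and_congr ⟨fun h j hj => h j.castSucc (by simpa using hj), fun h j hj => ?_⟩ Iff.rfl
      have hlt : j < Fin.last (m + 1) := hj.trans_lt (Fin.castSucc_lt_last _)
      obtain ⟨i, rfl⟩ := Fin.exists_castSucc_eq.2 hlt.ne
      exact h i (by simpa using hj)
    have hprod : ∏ i ∈ Finset.Ioi k.castSucc,
          V i (X.row i.succ) (Y.row i.succ) (X.row i.castSucc) (Y.row i.castSucc) =
        (∏ i ∈ Finset.Ioi k, V i (X.trunc.row i.succ) (Y.trunc.row i.succ)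
          (X.trunc.row i.castSucc) (Y.trunc.row i.castSucc)) *
          V m X.top Y.top X.trunc.top Y.trunc.top := by
      rw [← Finset.filter_lt_eq_Ioi, Finset.prod_filter, Fin.prod_univ_castSucc,
        if_pos (Fin.castSucc_lt_last k), ← Finset.filter_lt_eq_Ioi, Finset.prod_filter]
      rfl
    by_cases hc : (∀ j : Fin (m + 1), j ≤ k.castSucc → X.trunc.row j = Y.trunc.row j) ∧
          X.trunc.row k.succ ≠ Y.trunc.row k.succ
    · rw [if_pos (hiff.2 hc), if_pos hc, hprod, mul_assoc]
      rfl
    · rw [if_neg (mt hiff.1 hc), if_neg hc, zero_mul]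
  · have hiff : ((∀ j : Fin (m + 1 + 1), j ≤ (Fin.last m).castSucc → X.row j = Y.row j) ∧
        X.row (Fin.last m).succ ≠ Y.row (Fin.last m).succ) ↔
        X.trunc = Y.trunc ∧ X.top ≠ Y.top := by
      rw [← row_eq_iff]
      refine and_congr ⟨fun h j => h j.castSucc (by simpa using Fin.le_last j),
        fun h j hj => ?_⟩ Iff.rfl
      have hlt : j < Fin.last (m + 1) := hj.trans_lt (Fin.castSucc_lt_last _)
      obtain ⟨i, rfl⟩ := Fin.exists_castSucc_eq.2 hlt.ne
      exact h i
    have hIoi : Finset.Ioi (Fin.last m) = ∅ := by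
      ext i; simpa using Fin.le_last i
    by_cases hc : X.trunc = Y.trunc ∧ X.top ≠ Y.top
    · rw [if_pos (hiff.2 hc), if_pos hc, hIoi, Finset.prod_empty, mul_one]
      rfl
    · rw [if_neg (mt hiff.1 hc), if_neg hc]

theorem jumpRate_zero (X Y : GTScheme 0) : jumpRate W V 0 X Y = 0 := by
  rw [jumpRate, if_pos (GTScheme.eq_of_zero X Y)]
  simp [offDiagRate_zero]

theorem finite_succ {m : ℕ} {s : Set (GTScheme (m + 1))} (h1 : (GTScheme.trunc '' s).Finite)
    (h2 : ∀ Y ∈ s, {Z ∈ s | Z.trunc = Y.trunc}.Finite) : s.Finite := by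
  refine Set.Finite.of_finite_fibers GTScheme.trunc h1 ?_
  rintro _ ⟨Y, hY, rfl⟩
  exact (h2 Y hY).subset fun Z hZ => ⟨hZ.1, hZ.2⟩

theorem IsAdmissible.offDiagRate_finite (h : IsAdmissible N W V) {m : ℕ} (hm : m ≤ N)
    (X : GTScheme m) : {Y | offDiagRate W V m X Y ≠ 0}.Finite := by
  classical
  induction m with
  | zero => simp [offDiagRate_zero]
  | succ m ih =>
    have hX := X.interlaces_top
    refine finite_succ ?_ ?_
    · refine ((ih (by omega) X.trunc).insert X.trunc).subset ?_
      rintro _ ⟨Y, hY, rfl⟩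
      by_contra hc
      simp only [Set.mem_insert_iff, Set.mem_ofPred_eq, not_or, not_not] at hc
      refine hY ?_
      rw [offDiagRate_succ, hc.2, zero_mul, zero_add, if_neg fun hh => hc.1 hh.1.symm]
    · intro Y hY
      have hV : 1 ≤ m → {y | V m X.top y X.trunc.top Y.trunc.top ≠ 0}.Finite := fun h1 =>
        h.V_finite m h1 (by omega) _ _ _ hX
      have hW := h.W_finite m (by omega) _ _ hX
      refine Set.Finite.of_injOn (f := GTScheme.top)
        (t := {y | 1 ≤ m ∧ V m X.top y X.trunc.top Y.trunc.top ≠ 0} ∪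
          {y | W m X.top y X.trunc.top ≠ 0}) ?_ ?_ (Set.Finite.union ?_ hW)
      · rintro Z ⟨hZ, hZY⟩
        by_contra hc
        simp only [Set.mem_union, Set.mem_ofPred_eq, not_or, not_and, not_not] at hc
        refine hZ ?_
        rw [offDiagRate_succ, hZY, hc.2, ite_self, add_zero]
        -- Nothing is assumed about `V 0`; it is always multiplied by a rate on the empty scheme,
        -- which is 0.
        rcases Nat.eq_zero_or_pos m with rfl | hm
        · rw [offDiagRate_zero, zero_mul]
        · rw [hc.1 hm, mul_zero]
      · rintro Z hZ Z' hZ' hh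
        exact GTScheme.eq_iff.2 ⟨hZ.2.trans hZ'.2.symm, hh⟩
      · by_cases hm : 1 ≤ m
        · exact (hV hm).subset fun y hy => hy.2
        · simp [hm]

end

end MacdonaldDynamics

namespace MacdonaldDynamics

noncomputable section

/-! ### Row sums, and the recursion for the projections -/

variable {q t : ℝ} {a : ℕ → ℝ} {W : IndepRates} {V : TrigProbs} {N : ℕ}

/-- A scheme is a truncated scheme together with a last row. -/
def schemeEquiv (m : ℕ) :
    GTScheme (m + 1) ≃ Σ X : GTScheme m, {x : Sig (m + 1) // Interlaces X.top x} where
  toFun X := ⟨X.trunc, X.top, X.interlaces_top⟩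
  invFun p := p.1.snoc p.2.1 p.2.2
  left_inv X := X.snoc_trunc_top
  right_inv := by
    rintro ⟨X, x, h⟩
    refine Sigma.ext (GTScheme.trunc_snoc X x h) ?_
    refine (Subtype.heq_iff_coe_eq fun y => ?_).2 (GTScheme.top_snoc X x h)
    change Interlaces (X.snoc x h).trunc.top y ↔ Interlaces X.top y
    rw [GTScheme.trunc_snoc]

theorem tsum_scheme_succ {m : ℕ} {F : GTScheme (m + 1) → ℝ} (hF : Summable F) :
    ∑' X, F X = ∑' X : GTScheme m, ∑' x : {x : Sig (m + 1) // Interlaces X.top x},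
      F (X.snoc x.1 x.2) := by
  have h1 : Summable fun p => F ((schemeEquiv m).symm p) :=
    (schemeEquiv m).symm.summable_iff.2 hF
  exact ((schemeEquiv m).symm.tsum_eq F).symm.trans h1.tsum_sigma

theorem IsAdmissible.tsum_V_subtype (h : IsAdmissible N W V) {k : ℕ} (hk : 1 ≤ k) (hkN : k < N)
    {lam : Sig (k + 1)} {lamb nub : Sig k} (hi : Interlaces lamb lam) :
    ∑' nu : {nu : Sig (k + 1) // Interlaces nub nu}, V k lam nu lamb nub = 1 := by
  rw [← h.V_sum k hk hkN lam lamb nub hi]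
  exact tsum_subtype_eq_of_support_subset (f := fun nu => V k lam nu lamb nub)
    (s := {nu | Interlaces nub nu}) fun nu hnu => by
      by_contra hc
      exact hnu (h.V_zero k hk hkN _ _ _ _ hi hc)

open scoped Classical in
theorem IsAdmissible.tsum_W_subtype (h : IsAdmissible N W V) {k : ℕ} (hkN : k < N)
    {lam : Sig (k + 1)} {lamb : Sig k} (hi : Interlaces lamb lam) :
    ∑' nu : {nu : Sig (k + 1) // Interlaces lamb nu},
      (if lam ≠ nu then W k lam nu lamb else 0) = -W k lam lam lamb := by
  rw [← h.W_sum k hkN lam lamb hi]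
  have h1 := tsum_subtype_eq_of_support_subset
    (f := fun nu => if lam ≠ nu then W k lam nu lamb else 0)
    (s := {nu | Interlaces lamb nu}) fun nu hnu => by
      by_contra hc
      refine hnu ?_
      simp only [h.W_zero k hkN _ _ _ hi hc, ite_self]
  have h2 := tsum_subtype_eq_of_support_subset
    (f := fun nu => if lam ≠ nu then W k lam nu lamb else 0)
    (s := {nu | nu ≠ lam}) fun nu hnu => by
      rintro rfl
      exact hnu (if_neg (not_not.2 rfl))
  refine h1.trans (h2.symm.trans ?_)
  exact tsum_congr fun nu => if_pos nu.2.symm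

/-- For a fixed new truncation, the triggered moves have total probability 1 if it differs from the
old one; if it agrees, the independent jumps of the last row contribute their exit rate `-W`. -/
theorem IsAdmissible.tsum_offDiagRate_succ (h : IsAdmissible N W V) {m : ℕ} (hm : m + 1 ≤ N)
    (X : GTScheme (m + 1)) :
    ∑' Z, offDiagRate W V (m + 1) X Z =
      ∑' Z, offDiagRate W V m X.trunc Z - W m X.top X.top X.trunc.top := by
  classical
  have hs : Summable fun Z => offDiagRate W V (m + 1) X Z :=
    summable_of_hasFiniteSupport (h.offDiagRate_finite hm X)
  have hs' : Summable fun Z => offDiagRate W V m X.trunc Z :=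
    summable_of_hasFiniteSupport (h.offDiagRate_finite (by omega) X.trunc)
  have hX := X.interlaces_top
  have key : ∀ Z : GTScheme m, ∑' z : {z : Sig (m + 1) // Interlaces Z.top z},
      offDiagRate W V (m + 1) X (Z.snoc z.1 z.2) =
      offDiagRate W V m X.trunc Z +
        if Z = X.trunc then -W m X.top X.top X.trunc.top else 0 := by
    intro Z
    have e : ∀ z : {z : Sig (m + 1) // Interlaces Z.top z},
        offDiagRate W V (m + 1) X (Z.snoc z.1 z.2) =
        offDiagRate W V m X.trunc Z * V m X.top z X.trunc.top Z.top +
          if X.trunc = Z ∧ X.top ≠ z then W m X.top z X.trunc.top else 0 := by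
      intro z
      rw [offDiagRate_succ, GTScheme.trunc_snoc, GTScheme.top_snoc]
    rw [tsum_congr e]
    by_cases hZ : Z = X.trunc
    · subst hZ
      simp only [offDiagRate_self, zero_mul, zero_add, true_and, if_true]
      exact h.tsum_W_subtype hm hX
    · have hZ' : ¬ X.trunc = Z := fun hh => hZ hh.symm
      simp only [hZ, hZ', false_and, if_false, add_zero]
      rcases Nat.eq_zero_or_pos m with rfl | hm0
      · exact absurd (GTScheme.eq_of_zero _ _) hZ
      · rw [tsum_mul_left, h.tsum_V_subtype hm0 hm hX, mul_one]
  have hs2 : Summable fun Z : GTScheme m =>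
      if Z = X.trunc then -W m X.top X.top X.trunc.top else 0 :=
    (hasSum_ite_eq X.trunc _).summable
  rw [tsum_scheme_succ hs, tsum_congr key, hs'.tsum_add hs2, tsum_ite_eq, sub_eq_add_neg]

open scoped Classical in
/-- The recursion for the jump rates of the truncations. -/
theorem IsAdmissible.jumpRate_succ (h : IsAdmissible N W V) {m : ℕ} (hm : m + 1 ≤ N)
    (X Y : GTScheme (m + 1)) :
    jumpRate W V (m + 1) X Y =
      jumpRate W V m X.trunc Y.trunc * V m X.top Y.top X.trunc.top Y.trunc.top +
        if X.trunc = Y.trunc then W m X.top Y.top X.trunc.top else 0 := by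
  have hX := X.interlaces_top
  have hV : jumpRate W V m X.trunc X.trunc * V m X.top X.top X.trunc.top X.trunc.top =
      jumpRate W V m X.trunc X.trunc := by
    rcases Nat.eq_zero_or_pos m with rfl | hm0
    · rw [jumpRate_zero, zero_mul]
    · rw [h.V_self m hm0 hm _ _ hX, mul_one]
  by_cases hXY : X = Y
  · subst hXY
    rw [hV, if_pos rfl, jumpRate, if_pos rfl, jumpRate, if_pos rfl, h.tsum_offDiagRate_succ hm]
    ring
  · rw [jumpRate, if_neg hXY, offDiagRate_succ]
    by_cases ht : X.trunc = Y.trunc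
    · have htop : X.top ≠ Y.top := fun hh => hXY (GTScheme.eq_iff.2 ⟨ht, hh⟩)
      rw [if_pos ⟨ht, htop⟩, if_pos ht, ← ht, offDiagRate_self, zero_mul]
      rcases Nat.eq_zero_or_pos m with rfl | hm0
      · rw [jumpRate_zero, zero_mul]
      · rw [h.V_ne m hm0 hm _ _ _ hX htop, mul_zero]
    · rw [if_neg fun hh => ht hh.1, if_neg ht, jumpRate, if_neg ht]

theorem proj_eq_sum (q t : ℝ) (a : ℕ → ℝ) (W : IndepRates) (V : TrigProbs) {m : ℕ}
    (x y : Sig m) :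
    proj q t a W V m x y =
      ∑ X ∈ schemes x, ∑ Y ∈ schemes y, jumpRate W V m X Y * weight (link q t a) X := by
  refine (tsum_top x fun X => ∑' Y : {Y : GTScheme m // Y.top = y},
    jumpRate W V m X Y.1 * weight (link q t a) X).trans ?_
  exact Finset.sum_congr rfl fun X _ =>
    tsum_top y fun Y => jumpRate W V m X Y * weight (link q t a) X

theorem proj_zero (q t : ℝ) (a : ℕ → ℝ) (W : IndepRates) (V : TrigProbs) (x y : Sig 0) :
    proj q t a W V 0 x y = 0 := by
  simp [proj_eq_sum, jumpRate_zero]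

theorem univRate_zero (q t : ℝ) (a : ℕ → ℝ) (x y : Sig 0) : univRate q t a 0 x y = 0 := by
  simp [univRate, univOffDiag]

/-- The recursion for the projections. -/
theorem IsAdmissible.proj_succ (h : IsAdmissible N W V) (hq0 : 0 ≤ q) (hq1 : q < 1)
    (ht0 : 0 ≤ t) (ht1 : t < 1) (ha : ∀ k < N, 0 < a k) {m : ℕ} (hm : m + 1 ≤ N)
    (x y : Sig (m + 1)) :
    proj q t a W V (m + 1) x y = ∑ yb ∈ below y,
      (∑ xb ∈ below x, V m x y xb yb * link q t a m x xb * proj q t a W V m xb yb +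
        W m x y yb * link q t a m x yb) := by
  classical
  set F : GTScheme m → GTScheme m → ℝ := fun X Y =>
    (jumpRate W V m X Y * V m x y X.top Y.top + if X = Y then W m x y X.top else 0) *
      (weight (link q t a) X * link q t a m x X.top) with hF
  have h1 : proj q t a W V (m + 1) x y =
      ∑ X ∈ schemes x, ∑ Y ∈ schemes y, F X.trunc Y.trunc := by
    rw [proj_eq_sum]
    refine Finset.sum_congr rfl fun X hX => Finset.sum_congr rfl fun Y hY => ?_
    rw [h.jumpRate_succ hm, weight_succ, mem_schemes.1 hX, mem_schemes.1 hY]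
  have h2 : ∀ X : GTScheme (m + 1), ∑ Y ∈ schemes y, F X.trunc Y.trunc =
      ∑ yb ∈ below y, ∑ Y ∈ schemes yb, F X.trunc Y := fun X =>
    sum_schemes_succ y fun Y => F X.trunc Y
  rw [h1, Finset.sum_congr rfl fun X _ => h2 X,
    sum_schemes_succ x fun X => ∑ yb ∈ below y, ∑ Y ∈ schemes yb, F X Y, Finset.sum_add_distrib]
  have h3 : ∀ xb ∈ below x, ∑ X ∈ schemes xb, ∑ yb ∈ below y, ∑ Y ∈ schemes yb, F X Y =
      ∑ yb ∈ below y, V m x y xb yb * link q t a m x xb * proj q t a W V m xb yb +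
        if xb ∈ below y then W m x y xb * link q t a m x xb else 0 := by
    intro xb hxb
    have e1 : ∀ X ∈ schemes xb, ∑ yb ∈ below y, ∑ Y ∈ schemes yb, F X Y =
        (∑ yb ∈ below y, ∑ Y ∈ schemes yb,
          V m x y xb yb * link q t a m x xb * (jumpRate W V m X Y * weight (link q t a) X)) +
        weight (link q t a) X *
          if xb ∈ below y then W m x y xb * link q t a m x xb else 0 := by
      intro X hX
      have hX := mem_schemes.1 hX
      have e2 : ∀ yb, ∑ Y ∈ schemes yb, F X Y = (∑ Y ∈ schemes yb,
          V m x y xb yb * link q t a m x xb * (jumpRate W V m X Y * weight (link q t a) X)) +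
          if xb = yb then
            weight (link q t a) X * (W m x y xb * link q t a m x xb) else 0 := by
        intro yb
        have e3 : (if xb = yb then
            weight (link q t a) X * (W m x y xb * link q t a m x xb) else 0) =
            ∑ Y ∈ schemes yb, if X = Y then
              weight (link q t a) X * (W m x y xb * link q t a m x xb) else 0 := by
          rw [Finset.sum_ite_eq]
          simp only [mem_schemes, hX]
        rw [e3, ← Finset.sum_add_distrib]
        refine Finset.sum_congr rfl fun Y hY => ?_
        simp only [hF, hX, mem_schemes.1 hY]
        split_ifs <;> ring
      simp only [e2]
      rw [Finset.sum_add_distrib, Finset.sum_ite_eq, mul_ite, mul_zero]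
    -- In the `W` term nothing depends on the rows below `xb`, so their Gibbs weights add up to 1;
    -- in the `V` term they assemble into the projection one level down.
    rw [Finset.sum_congr rfl e1, Finset.sum_add_distrib, ← Finset.sum_mul,
      sum_weight_link hq0 hq1 ht0 ht1 (fun i hi => ha i (by omega)), one_mul, Finset.sum_comm]
    congr 1
    refine Finset.sum_congr rfl fun yb _ => ?_
    rw [proj_eq_sum, Finset.mul_sum]
    exact Finset.sum_congr rfl fun X _ => (Finset.mul_sum _ _ _).symm
  rw [Finset.sum_congr rfl h3, Finset.sum_add_distrib, Finset.sum_comm]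
  congr 1
  -- Rows below `y` but not below `x` carry a zero link, so both sums run over the common rows.
  rw [← Finset.sum_filter, ← Finset.sum_filter_add_sum_filter_not (below y) (· ∈ below x),
    Finset.sum_eq_zero (s := {yb ∈ below y | yb ∉ below x}), add_zero]
  · refine Finset.sum_congr ?_ fun _ _ => rfl
    ext; simp [and_comm]
  · intro yb hyb
    rw [link_of_not_interlaces q t a fun hi => (Finset.mem_filter.1 hyb).2 (mem_below.2 hi),
      mul_zero]

/-- If the slices are coherent with respect to the univariate dynamics, then the projections
are the univariate dynamics. -/
theorem IsAdmissible.proj_eq_univRate (h : IsAdmissible N W V) (hq0 : 0 ≤ q) (hq1 : q < 1)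
    (ht0 : 0 ≤ t) (ht1 : t < 1) (ha : ∀ k < N, 0 < a k)
    (hcoh : ∀ k < N, ∀ (x y : Sig (k + 1)) (yb : Sig k), Interlaces yb y →
      ∑ xb ∈ below x, V k x y xb yb * link q t a k x xb * univRate q t a k xb yb +
        W k x y yb * link q t a k x yb = univRate q t a (k + 1) x y * link q t a k y yb)
    {m : ℕ} (hm : m ≤ N) (x y : Sig m) : proj q t a W V m x y = univRate q t a m x y := by
  induction m with
  | zero => rw [proj_zero, univRate_zero]
  | succ m ih =>
    rw [h.proj_succ hq0 hq1 ht0 ht1 ha hm]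
    simp only [ih (by omega)]
    rw [Finset.sum_congr rfl fun yb hyb => hcoh m hm x y yb (mem_below.1 hyb), ← Finset.mul_sum,
      sum_link hq0 hq1 ht0 ht1 (fun i hi => ha i (by omega)), mul_one]

end

end MacdonaldDynamics

namespace MacdonaldDynamics

noncomputable section

/-! ### Existence of the semigroup with given bounded jump rates -/

open scoped ENNReal Nat

/-- Weights of the Poisson distribution. -/
def poissonWeight (r : ℝ) (n : ℕ) : ℝ := Real.exp (-r) * (r ^ n / n !)

theorem poissonWeight_nonneg {r : ℝ} (hr : 0 ≤ r) (n : ℕ) : 0 ≤ poissonWeight r n := by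
  unfold poissonWeight; positivity

theorem hasSum_poissonWeight (r : ℝ) : HasSum (poissonWeight r) 1 := by
  have h := (NormedSpace.expSeries_div_hasSum_exp r).mul_left (Real.exp (-r))
  rwa [← Real.exp_eq_exp_ℝ, ← Real.exp_add, neg_add_cancel, Real.exp_zero] at h

theorem poissonWeight_zero (n : ℕ) : poissonWeight 0 n = if n = 0 then 1 else 0 := by
  rcases eq_or_ne n 0 with rfl | hn
  · simp [poissonWeight]
  · simp [poissonWeight, hn]

/-- The binomial theorem: a sum of independent Poisson variables is Poisson. -/
theorem poissonWeight_add (r s : ℝ) (n : ℕ) :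
    poissonWeight (r + s) n =
      ∑ p ∈ Finset.HasAntidiagonal.antidiagonal n, poissonWeight r p.1 * poissonWeight s p.2 := by
  unfold poissonWeight
  rw [neg_add, Real.exp_add, (Commute.all r s).add_pow', Finset.sum_div, Finset.mul_sum]
  refine Finset.sum_congr rfl fun p hp => ?_
  obtain rfl := Finset.HasAntidiagonal.mem_antidiagonal.1 hp
  rw [nsmul_eq_mul, Nat.cast_add_choose ℝ]
  have h1 : ((p.1 + p.2)! : ℝ) ≠ 0 := by exact_mod_cast Nat.factorial_ne_zero _
  field_simp

/-- The Poisson distribution. -/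
def poissonDist (r : ℝ) (hr : 0 ≤ r) : PMF ℕ :=
  ⟨fun n => ENNReal.ofReal (poissonWeight r n), by
    rw [← ENNReal.ofReal_one, ← (hasSum_poissonWeight r).tsum_eq,
      ENNReal.ofReal_tsum_of_nonneg (poissonWeight_nonneg hr) (hasSum_poissonWeight r).summable]
    exact ENNReal.summable.hasSum⟩

theorem poissonDist_apply (r : ℝ) (hr : 0 ≤ r) (n : ℕ) :
    poissonDist r hr n = ENNReal.ofReal (poissonWeight r n) := rfl

theorem poissonDist_zero : poissonDist 0 le_rfl = PMF.pure 0 := by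
  ext n
  rw [poissonDist_apply, poissonWeight_zero, PMF.pure_apply]
  split_ifs <;> simp

theorem poissonDist_add {r s : ℝ} (hr : 0 ≤ r) (hs : 0 ≤ s) :
    poissonDist (r + s) (add_nonneg hr hs) =
      (poissonDist r hr).bind fun i => (poissonDist s hs).bind fun j => PMF.pure (i + j) := by
  ext n
  simp only [PMF.bind_apply, PMF.pure_apply, ← ENNReal.tsum_mul_left]
  refine Eq.trans ?_ ENNReal.tsum_prod
  rw [tsum_eq_sum (s := Finset.HasAntidiagonal.antidiagonal n) fun p hp => ?_]
  · rw [poissonDist_apply, poissonWeight_add, ENNReal.ofReal_sum_of_nonneg fun p _ =>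
      mul_nonneg (poissonWeight_nonneg hr _) (poissonWeight_nonneg hs _)]
    refine Finset.sum_congr rfl fun p hp => ?_
    rw [if_pos (Finset.HasAntidiagonal.mem_antidiagonal.1 hp).symm, mul_one,
      ENNReal.ofReal_mul (poissonWeight_nonneg hr _)]
    rfl
  · rw [if_neg fun h => hp (Finset.HasAntidiagonal.mem_antidiagonal.2 h.symm), mul_zero, mul_zero]

variable {E : Type}

/-- The distribution after `n` steps of a Markov chain. -/
def chain (K : E → PMF E) : ℕ → E → PMF E
  | 0, X => PMF.pure X
  | n + 1, X => (chain K n X).bind K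

theorem chain_add (K : E → PMF E) (m n : ℕ) (X : E) :
    chain K (m + n) X = (chain K m X).bind (chain K n) := by
  induction n with
  | zero =>
    change chain K m X = (chain K m X).bind PMF.pure
    rw [PMF.bind_pure]
  | succ n ih =>
    change (chain K (m + n) X).bind K = (chain K m X).bind fun Y => (chain K n Y).bind K
    rw [ih, PMF.bind_bind]

theorem chain_one (K : E → PMF E) (X : E) : chain K 1 X = K X := PMF.pure_bind _ _

/-- The chain run at the jump times of a Poisson process. -/
def poissonChain (K : E → PMF E) (r : ℝ) (hr : 0 ≤ r) (X : E) : PMF E :=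
  (poissonDist r hr).bind fun n => chain K n X

theorem poissonChain_zero (K : E → PMF E) (X : E) : poissonChain K 0 le_rfl X = PMF.pure X := by
  rw [poissonChain, poissonDist_zero, PMF.pure_bind]
  rfl

theorem poissonChain_add (K : E → PMF E) {r s : ℝ} (hr : 0 ≤ r) (hs : 0 ≤ s) (X : E) :
    poissonChain K (r + s) (add_nonneg hr hs) X =
      (poissonChain K r hr X).bind (poissonChain K s hs) := by
  unfold poissonChain
  rw [poissonDist_add hr hs]
  simp only [PMF.bind_bind, PMF.pure_bind, chain_add]
  congr 1
  funext i
  rw [PMF.bind_comm]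

theorem hasSum_poissonChain (K : E → PMF E) {r : ℝ} (hr : 0 ≤ r) (X Y : E) :
    HasSum (fun n => poissonWeight r n * (chain K n X Y).toReal)
      (poissonChain K r hr X Y).toReal := by
  have hne : ∑' n, poissonDist r hr n * chain K n X Y ≠ ∞ := by
    rw [← PMF.bind_apply]
    exact PMF.apply_ne_top _ _
  have h := ENNReal.hasSum_toReal hne
  rw [← ENNReal.tsum_toReal_eq fun n => ENNReal.ne_top_of_tsum_ne_top hne n,
    ← PMF.bind_apply] at h
  refine h.congr_fun fun n => ?_
  rw [ENNReal.toReal_mul, poissonDist_apply, ENNReal.toReal_ofReal (poissonWeight_nonneg hr n)]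

/-- Only zero or one step matters to first order. The Poisson mass of two or more steps, and each of
the two errors from expanding the weights of zero and one step, is at most r². -/
theorem abs_poissonChain_sub_le (K : E → PMF E) {r : ℝ} (hr : 0 ≤ r) (hr1 : r ≤ 1) (X Y : E) :
    |(poissonChain K r hr X Y).toReal - (chain K 0 X Y).toReal -
      r * ((K X Y).toReal - (chain K 0 X Y).toReal)| ≤ 3 * r ^ 2 := by
  have le1 : ∀ n, (chain K n X Y).toReal ≤ 1 := fun n =>
    ENNReal.toReal_mono ENNReal.one_ne_top (PMF.coe_le_one _ _) |>.trans_eq ENNReal.toReal_one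
  have h0 : ∀ n, 0 ≤ (chain K n X Y).toReal := fun n => ENNReal.toReal_nonneg
  have h := hasSum_poissonChain K hr X Y
  set p := (poissonChain K r hr X Y).toReal
  have hw := hasSum_poissonWeight r
  have h2 := (hasSum_nat_add_iff' 2).2 h
  have hw2 := (hasSum_nat_add_iff' 2).2 hw
  have lo : 0 ≤ p - ∑ i ∈ Finset.range 2, poissonWeight r i * (chain K i X Y).toReal :=
    h2.nonneg fun n => mul_nonneg (poissonWeight_nonneg hr _) (h0 _)
  have hi : p - ∑ i ∈ Finset.range 2, poissonWeight r i * (chain K i X Y).toReal ≤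
      1 - ∑ i ∈ Finset.range 2, poissonWeight r i :=
    hasSum_le (fun n => mul_le_of_le_one_right (poissonWeight_nonneg hr _) (le1 _)) h2 hw2
  rw [Finset.sum_range_succ, Finset.sum_range_one, chain_one] at lo hi
  rw [Finset.sum_range_succ, Finset.sum_range_one] at hi
  have w0 : poissonWeight r 0 = Real.exp (-r) := by simp [poissonWeight]
  have w1 : poissonWeight r 1 = Real.exp (-r) * r := by simp [poissonWeight]
  rw [w0, w1] at lo hi
  have k0 := h0 0
  have k0' := le1 0
  have k1 := h0 1
  have k1' := le1 1
  rw [chain_one] at k1 k1'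
  have e1 := Real.abs_exp_sub_one_sub_id_le (x := -r) (by rw [abs_neg, abs_of_nonneg hr]; exact hr1)
  rw [neg_sq] at e1
  have e2 := abs_le.1 e1
  have e3 : 1 - r ≤ Real.exp (-r) := by linarith [Real.add_one_le_exp (-r)]
  have e4 : Real.exp (-r) ≤ 1 := Real.exp_le_one_iff.2 (by linarith)
  set x := Real.exp (-r)
  set u := (chain K 0 X Y).toReal
  set v := (K X Y).toReal
  have d1 : 0 ≤ u * (x - 1 + r) := mul_nonneg k0 (by linarith)
  have d2 : u * (x - 1 + r) ≤ r ^ 2 :=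
    (mul_le_of_le_one_left (by linarith) k0').trans (by linarith)
  have d3 : 0 ≤ v * (r * (1 - x)) := mul_nonneg k1 (mul_nonneg hr (by linarith))
  have d4 : v * (r * (1 - x)) ≤ r ^ 2 :=
    (mul_le_of_le_one_left (mul_nonneg hr (by linarith)) k1').trans (by nlinarith)
  have d5 : 1 - (x + x * r) ≤ r ^ 2 := by nlinarith
  rw [abs_le]
  constructor <;> nlinarith

/-- Jump rates with finite rows, summing to zero along each row and uniformly bounded, are those
of a semigroup of stochastic matrices. -/
theorem exists_semigroup (Q : E → E → ℝ) (hfin : ∀ X, {Y | Q X Y ≠ 0}.Finite)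
    (hoff : ∀ X Y, X ≠ Y → 0 ≤ Q X Y) (hsum : ∀ X, ∑' Y, Q X Y = 0)
    {C : ℝ} (hC : ∀ X, -C ≤ Q X X) :
    ∃ P : ℝ → E → E → ℝ, IsMarkovSemigroup P ∧ HasJumpRates P Q := by
  classical
  -- Uniformization divides by C, so C is first made positive.
  obtain ⟨C, hC0, hC⟩ : ∃ C : ℝ, 0 < C ∧ ∀ X, -C ≤ Q X X :=
    ⟨max C 1, by positivity, fun X => (neg_le_neg (le_max_left C 1)).trans (hC X)⟩
  -- The stochastic matrix 1 + Q / C; its diagonal is nonnegative because Q X X ≥ -C. The chain with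
  -- this kernel, run at a Poisson clock of rate C, has jump rates Q.
  set k : E → E → ℝ := fun X Y => (if X = Y then 1 else 0) + Q X Y / C with hk
  have hk0 : ∀ X Y, 0 ≤ k X Y := by
    intro X Y
    simp only [hk]
    split_ifs with h
    · subst h
      have := hC X
      have : -1 ≤ Q X X / C := by rw [le_div_iff₀ hC0]; linarith
      linarith
    · have := div_nonneg (hoff X Y h) hC0.le
      linarith
  set s : E → Finset E := fun X => insert X (hfin X).toFinset with hs
  have hQs : ∀ X Y, Y ∉ s X → Q X Y = 0 := by
    intro X Y hY
    by_contra hc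
    exact hY (Finset.mem_insert_of_mem ((hfin X).mem_toFinset.2 hc))
  have hks : ∀ X Y, Y ∉ s X → k X Y = 0 := by
    intro X Y hY
    have : X ≠ Y := fun h => hY (h ▸ Finset.mem_insert_self _ _)
    simp only [hk, this, if_false, hQs X Y hY, zero_div, add_zero]
  have hk1 : ∀ X, ∑ Y ∈ s X, k X Y = 1 := by
    intro X
    have h := hsum X
    rw [tsum_eq_sum (hQs X)] at h
    simp only [hk, Finset.sum_add_distrib, ← Finset.sum_div, h, zero_div, add_zero,
      Finset.sum_ite_eq]
    exact if_pos (Finset.mem_insert_self _ _)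
  set K : E → PMF E := fun X => PMF.ofFinset (fun Y => ENNReal.ofReal (k X Y)) (s X)
    (by rw [← ENNReal.ofReal_sum_of_nonneg fun Y _ => hk0 X Y, hk1, ENNReal.ofReal_one])
    (fun Y hY => by rw [hks X Y hY, ENNReal.ofReal_zero]) with hK
  have hKk : ∀ X Y, (K X Y).toReal = k X Y := fun X Y => by
    rw [hK, PMF.ofFinset_apply, ENNReal.toReal_ofReal (hk0 X Y)]
  -- The value 0 at negative times is a dummy.
  set P : ℝ → E → E → ℝ := fun τ X Y =>
    if hτ : 0 ≤ τ then (poissonChain K (C * τ) (mul_nonneg hC0.le hτ) X Y).toReal else 0 with hP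
  have hPpos : ∀ τ (hτ : 0 ≤ τ) X Y,
      P τ X Y = (poissonChain K (C * τ) (mul_nonneg hC0.le hτ) X Y).toReal :=
    fun τ hτ X Y => dif_pos hτ
  have hsumreal : ∀ (f : E → ℝ≥0∞), ∑' Y, f Y ≠ ∞ →
      HasSum (fun Y => (f Y).toReal) (∑' Y, f Y).toReal := by
    intro f hf
    rw [ENNReal.tsum_toReal_eq fun Y => ENNReal.ne_top_of_tsum_ne_top hf Y]
    exact ENNReal.hasSum_toReal hf
  have hzero : ∀ X Y, (chain K 0 X Y).toReal = if X = Y then 1 else 0 := by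
    intro X Y
    change (PMF.pure X Y).toReal = _
    rw [PMF.pure_apply]
    by_cases h : X = Y
    · simp [h]
    · simp [h, Ne.symm h]
  refine ⟨P, ⟨?_, ?_, ?_, ?_⟩, ?_⟩
  · intro τ hτ X Y
    rw [hPpos τ hτ]
    exact ENNReal.toReal_nonneg
  · intro τ hτ X
    simp only [hPpos τ hτ]
    have h := hsumreal (poissonChain K (C * τ) (mul_nonneg hC0.le hτ) X) (PMF.tsum_coe_ne_top _)
    rwa [PMF.tsum_coe, ENNReal.toReal_one] at h
  · intro X Y
    rw [hPpos 0 le_rfl]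
    simp only [mul_zero, poissonChain_zero]
    exact hzero X Y
  · intro τ σ hτ hσ X Z
    simp only [hPpos τ hτ, hPpos σ hσ, hPpos _ (add_nonneg hτ hσ), mul_add,
      poissonChain_add K (mul_nonneg hC0.le hτ) (mul_nonneg hC0.le hσ), PMF.bind_apply,
      ← ENNReal.toReal_mul]
    refine hsumreal _ ?_
    rw [← PMF.bind_apply]
    exact PMF.apply_ne_top _ _
  · intro X Y
    rw [Asymptotics.isLittleO_iff]
    intro c hc
    -- The first bound gives C τ ≤ 1, as the expansion requires; the second makes its error 3 (C τ)²
    -- at most c τ.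
    have hδ : 0 < min (1 / C) (c / (3 * C ^ 2)) := by positivity
    filter_upwards [Ioo_mem_nhdsGT hδ] with τ hτ
    have hτ0 : 0 ≤ τ := hτ.1.le
    have h1 : C * τ ≤ 1 := by
      have := hτ.2.le.trans (min_le_left _ _)
      rwa [le_div_iff₀ hC0, mul_comm] at this
    have h2 : 3 * C ^ 2 * τ ≤ c := by
      have := hτ.2.le.trans (min_le_right _ _)
      rwa [le_div_iff₀ (by positivity), mul_comm] at this
    have h := abs_poissonChain_sub_le K (mul_nonneg hC0.le hτ0) h1 X Y
    rw [hKk, hzero, ← hPpos τ hτ0] at h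
    have e : C * τ * (k X Y - if X = Y then 1 else 0) = Q X Y * τ := by
      simp only [hk]
      field_simp
      ring
    rw [e] at h
    rw [Real.norm_eq_abs, Real.norm_eq_abs, abs_of_nonneg hτ0]
    refine h.trans ?_
    nlinarith [mul_le_mul_of_nonneg_right h2 hτ0]

end

end MacdonaldDynamics

namespace MacdonaldDynamics

noncomputable section

variable {q t : ℝ} {a : ℕ → ℝ} {W : IndepRates} {V : TrigProbs} {N : ℕ}

/-! ### The coherence relation on a slice -/

/-- The relation between the univariate dynamics on two adjacent rows. -/
def SliceCoherent (q t : ℝ) (a : ℕ → ℝ) (W : IndepRates) (V : TrigProbs) (k : ℕ)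
    (x y : Sig (k + 1)) (yb : Sig k) : Prop :=
  ∑ xb ∈ below x, V k x y xb yb * link q t a k x xb * univRate q t a k xb yb +
    W k x y yb * link q t a k x yb = univRate q t a (k + 1) x y * link q t a k y yb

open scoped Classical in
-- In link(x, yb - e_i) times the rate from yb - e_i to `yb`, the polynomial of the intermediate row
-- cancels, leaving a_k T_i link(x, yb). The hypothesis `hG` disposes of the diagonal rate, which no
-- T_i accounts for.
theorem sum_below_mul_link_mul_univRate (hq0 : 0 ≤ q) (hq1 : q < 1) (ht0 : 0 ≤ t) (ht1 : t < 1)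
    {k : ℕ} (ha : ∀ i < k + 1, 0 < a i) (x : Sig (k + 1)) (yb : Sig k) (hyb : Interlaces yb x)
    (G : Sig k → ℝ) (hG : G yb * univRate q t a k yb yb = 0) :
    ∑ xb ∈ below x, G xb * link q t a k x xb * univRate q t a k xb yb =
      a k * link q t a k x yb * ∑ i, if h : Antitone (yb.1 - Pi.single i 1) then
        G ⟨yb.1 - Pi.single i 1, h⟩ * Tcoef q t yb x i else 0 := by
  have ha' : ∀ i < k, 0 < a i := fun i hi => ha i (by omega)
  have hx := (macP_pos hq0 hq1 ht0 ht1 ha x).ne'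
  have e1 : ∀ xb ∈ below x, G xb * link q t a k x xb * univRate q t a k xb yb =
      ∑ i, if IsAddBox xb yb i then
        macP q t a yb / macP q t a x * (G xb * (skewP q t (a k) x xb * psiPrime q t yb xb i))
        else 0 := by
    intro xb _
    by_cases hxy : xb = yb
    · subst hxy
      rw [mul_right_comm, hG, zero_mul]
      symm
      exact Finset.sum_eq_zero fun i _ => if_neg fun h => h.ne rfl
    · have hxb := (macP_pos hq0 hq1 ht0 ht1 ha' xb).ne'
      rw [univRate_of_ne q t a hxy, pieri, Finset.mul_sum, Finset.mul_sum]
      refine Finset.sum_congr rfl fun i _ => ?_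
      split_ifs with h
      · rw [link]
        field_simp
      · simp
  rw [Finset.sum_congr rfl e1, sum_below_eq x yb (fun xb i => macP q t a yb / macP q t a x *
    (G xb * (skewP q t (a k) x xb * psiPrime q t yb xb i))) fun mu j h => by
      rw [skewP_of_not_interlaces _ _ _ h, zero_mul, mul_zero, mul_zero], Finset.mul_sum]
  refine Finset.sum_congr rfl fun i _ => ?_
  split_ifs with h
  · rw [skewP_sub_left hq0 hq1 ht0 ht1 (ha k (by omega)) (isAddBox_sub yb i h) hyb, link]
    ring
  · rw [mul_zero]

theorem univRate_mul_link (hq0 : 0 ≤ q) (hq1 : q < 1) (ht0 : 0 ≤ t) (ht1 : t < 1)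
    {k : ℕ} (ha : ∀ i < k + 1, 0 < a i) {x y : Sig (k + 1)} {yb : Sig k} {j : Fin (k + 1)}
    (hbox : IsAddBox x y j) :
    univRate q t a (k + 1) x y * link q t a k y yb =
      macP q t a yb / macP q t a x * (psiPrime q t y x j * skewP q t (a k) y yb) := by
  have hx := (macP_pos hq0 hq1 ht0 ht1 ha x).ne'
  have hy := (macP_pos hq0 hq1 ht0 ht1 ha y).ne'
  rw [univRate_of_isAddBox q t a hbox, link]
  field_simp

theorem IsAdmissible.V_mul_univRate_self (h : IsAdmissible N W V) {k : ℕ} (hk : k < N)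
    {x y : Sig (k + 1)} {yb : Sig k} (hyb : Interlaces yb x) (hxy : x ≠ y) :
    V k x y yb yb * univRate q t a k yb yb = 0 := by
  rcases Nat.eq_zero_or_pos k with rfl | hk0
  · rw [univRate_zero, mul_zero]
  · rw [h.V_ne k hk0 hk _ _ _ hyb hxy, zero_mul]

open scoped Classical in
/-- When the upper row can jump on its own, coherence is the linear identity of the slice. -/
theorem IsAdmissible.sliceCoherent_iff (h : IsAdmissible N W V) (hq0 : 0 ≤ q) (hq1 : q < 1)
    (ht0 : 0 ≤ t) (ht1 : t < 1) (ha : ∀ k < N, 0 < a k) {k : ℕ} (hk : k < N)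
    {x y : Sig (k + 1)} {yb : Sig k} {j : Fin (k + 1)} (hbox : IsAddBox x y j)
    (hyb : Interlaces yb x) :
    SliceCoherent q t a W V k x y yb ↔
      (∑ i : Fin k, if h : Antitone (yb.1 - Pi.single i 1) then
          V k x y ⟨yb.1 - Pi.single i 1, h⟩ yb * Tcoef q t yb x i else 0) +
        (a k)⁻¹ * W k x y yb = Scoef q t yb x j := by
  have ha' : ∀ i < k + 1, 0 < a i := fun i hi => ha i (by omega)
  have hak := (ha k hk).ne'
  have hl := (link_pos hq0 hq1 ht0 ht1 ha' hyb).ne'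
  have e1 := sum_below_mul_link_mul_univRate hq0 hq1 ht0 ht1 ha' x yb hyb
    (fun xb => V k x y xb yb) (h.V_mul_univRate_self hk hyb hbox.ne)
  have e2 : univRate q t a (k + 1) x y * link q t a k y yb =
      a k * link q t a k x yb * Scoef q t yb x j := by
    rw [univRate_mul_link hq0 hq1 ht0 ht1 ha' hbox,
      skewP_add_right hq0 hq1 ht0 ht1 (ha k hk) hbox hyb, link]
    ring
  rw [SliceCoherent, e1, e2, show W k x y yb * link q t a k x yb =
    a k * link q t a k x yb * ((a k)⁻¹ * W k x y yb) by field_simp, ← mul_add]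
  exact mul_right_inj' (mul_ne_zero hak hl)

/-! ### Necessity of the conditions -/

/-- The only negative univariate rate is the diagonal one, and there the trigger probability is 0
because `x ≠ y`. -/
theorem IsAdmissible.V_mul_link_mul_univRate_nonneg (h : IsAdmissible N W V) (hq0 : 0 ≤ q)
    (hq1 : q < 1) (ht0 : 0 ≤ t) (ht1 : t < 1) (ha : ∀ k < N, 0 < a k) {k : ℕ} (hk : k < N)
    {x y : Sig (k + 1)} {xb yb : Sig k} (hxb : Interlaces xb x) (hxy : x ≠ y) :
    0 ≤ V k x y xb yb * link q t a k x xb * univRate q t a k xb yb := by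
  rcases Nat.eq_zero_or_pos k with rfl | hk0
  · rw [univRate_zero, mul_zero]
  · by_cases hb : xb = yb
    · subst hb
      rw [h.V_ne k hk0 hk _ _ _ hxb hxy, zero_mul, zero_mul]
    · exact mul_nonneg (mul_nonneg (h.V_nonneg k hk0 hk _ _ _ _ hxb)
        (link_pos hq0 hq1 ht0 ht1 (fun i hi => ha i (by omega)) hxb).le)
        (univRate_nonneg hq0 hq1 ht0 ht1 (fun i hi => ha i (by omega)) hb)

/-- For such a target row the univariate rate is 0, so a sum of nonnegative terms vanishes; the
links and one-box rates multiplying `W` and `V` are positive and can be cancelled. -/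
theorem IsAdmissible.oneParticleMoves (h : IsAdmissible N W V) (hq0 : 0 ≤ q)
    (hq1 : q < 1) (ht0 : 0 ≤ t) (ht1 : t < 1) (ha : ∀ k < N, 0 < a k)
    (hcoh : ∀ k < N, ∀ (x y : Sig (k + 1)) (yb : Sig k), Interlaces yb y →
      SliceCoherent q t a W V k x y yb) : OneParticleMoves N W V := by
  have key : ∀ k < N, ∀ (x y : Sig (k + 1)) (yb : Sig k), Interlaces yb y → x ≠ y →
      (∀ j, ¬ IsAddBox x y j) →
      (∀ xb ∈ below x, V k x y xb yb * link q t a k x xb * univRate q t a k xb yb = 0) ∧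
        W k x y yb * link q t a k x yb = 0 := by
    intro k hk x y yb hyb hxy hbox
    have h1 := hcoh k hk x y yb hyb
    rw [SliceCoherent, univRate_eq_zero q t a hxy hbox, zero_mul] at h1
    have h2 : ∀ xb ∈ below x, 0 ≤ V k x y xb yb * link q t a k x xb * univRate q t a k xb yb :=
      fun xb hxb => h.V_mul_link_mul_univRate_nonneg hq0 hq1 ht0 ht1 ha hk (mem_below.1 hxb) hxy
    have h3 : 0 ≤ W k x y yb * link q t a k x yb := by
      by_cases hx : Interlaces yb x
      · exact mul_nonneg (h.W_nonneg k hk _ _ _ hx hxy)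
          (link_pos hq0 hq1 ht0 ht1 (fun i hi => ha i (by omega)) hx).le
      · rw [link_of_not_interlaces q t a hx, mul_zero]
    obtain ⟨h4, h5⟩ := (add_eq_zero_iff_of_nonneg (Finset.sum_nonneg h2) h3).1 h1
    exact ⟨(Finset.sum_eq_zero_iff_of_nonneg h2).1 h4, h5⟩
  constructor
  · intro k hk lam nu lamb hl hne hbox
    by_cases hnu : Interlaces lamb nu
    · exact (mul_eq_zero.1 (key k hk lam nu lamb hnu hne hbox).2).resolve_right
        (link_pos hq0 hq1 ht0 ht1 (fun i hi => ha i (by omega)) hl).ne'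
    · exact h.W_zero k hk _ _ _ hl hnu
  · intro k hk0 hk lam nu lamb nub i hl hi hne hbox
    by_cases hnu : Interlaces nub nu
    · have := (key k hk lam nu nub hnu hne hbox).1 lamb (mem_below.2 hl)
      rw [mul_assoc] at this
      exact (mul_eq_zero.1 this).resolve_right (mul_pos
        (link_pos hq0 hq1 ht0 ht1 (fun i hi => ha i (by omega)) hl)
        (univRate_pos hq0 hq1 ht0 ht1 (fun i hi => ha i (by omega)) hi)).ne'
    · exact h.V_zero k hk0 hk _ _ _ _ hl hnu

/-- If the interlacing is broken, there is only one way to restore it by adding a box. -/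
theorem eq_of_push {k : ℕ} {mu : Sig k} {lam nu nu' : Sig (k + 1)} {i j : Fin (k + 1)}
    (hn : ¬ Interlaces mu lam) (hi : IsAddBox lam nu i) (hj : IsAddBox lam nu' j)
    (h : Interlaces mu nu) (h' : Interlaces mu nu') : nu' = nu := by
  obtain ⟨c, rfl, mu', hmu, -, hc⟩ := exists_push_of_right hj h' hn
  have h1 := hmu.apply_self
  have h2 := (h c).2
  have h3 : c.castSucc = i := by
    by_contra hne
    have := hi.apply_ne hne
    omega
  subst h3
  exact hj.eq_add.trans hi.eq_add.symm

/-- Among moves by at most one box only one target restores the interlacing, and the trigger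
probabilities sum to 1, so all the mass is there. Coherence is used only through condition 0. -/
theorem IsAdmissible.shortRangePushing (h : IsAdmissible N W V) (h0 : OneParticleMoves N W V) :
    ShortRangePushing N V := by
  intro k hk0 hk lam nu lamb nub j hn hbox hnu hb hl
  rw [← h.V_sum k hk0 hk lam lamb nub hl, tsum_eq_single nu]
  intro nu' hne
  by_cases hnu' : Interlaces nub nu'
  · have hlam : lam ≠ nu' := by
      rintro rfl
      exact hn hnu'
    refine h0.2 k hk0 hk lam nu' lamb nub j hl hb hlam fun i hi => hne ?_
    exact eq_of_push hn hbox hi hnu hnu'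
  · exact h.V_zero k hk0 hk _ _ _ _ hl hnu'

theorem IsAdmissible.sliceIdentities (h : IsAdmissible N W V) (hq0 : 0 ≤ q)
    (hq1 : q < 1) (ht0 : 0 ≤ t) (ht1 : t < 1) (ha : ∀ k < N, 0 < a k)
    (hcoh : ∀ k < N, ∀ (x y : Sig (k + 1)) (yb : Sig k), Interlaces yb y →
      SliceCoherent q t a W V k x y yb) : SliceIdentities q t a N W V := by
  intro k hk lam nu nub j hi hj hbox
  exact (h.sliceCoherent_iff hq0 hq1 ht0 ht1 ha hk hbox hi).1
    (hcoh k hk lam nu nub ((hi.isAddBox_right_iff hbox).2 hj))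

theorem IsMultivariateDynamics.sliceCoherent {P : ℝ → GTScheme N → GTScheme N → ℝ}
    (h : IsMultivariateDynamics q t a N W V P) (hq0 : 0 ≤ q)
    (hq1 : q < 1) (ht0 : 0 ≤ t) (ht1 : t < 1) (ha : ∀ k < N, 0 < a k) {k : ℕ} (hk : k < N)
    (x y : Sig (k + 1)) (yb : Sig k) (hyb : Interlaces yb y) :
    SliceCoherent q t a W V k x y yb := by
  have hproj : ∀ xb, proj q t a W V k xb yb = univRate q t a k xb yb := fun xb => by
    rcases Nat.eq_zero_or_pos k with rfl | hk0
    · rw [proj_zero, univRate_zero]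
    · exact h.proj_eq k hk0 hk.le xb yb
  have h1 := h.coherent k hk x y yb
    (link_pos hq0 hq1 ht0 ht1 (fun i hi => ha i (by omega)) hyb).ne'
  rw [h.proj_eq (k + 1) (by omega) hk, tsum_eq_sum_below x _ fun mu hmu => by
    rw [link_of_not_interlaces q t a hmu, mul_zero, zero_mul]] at h1
  simp only [hproj] at h1
  exact h1

/-! ### Sufficiency of the conditions -/

/-- If `yb` already interlaces with `x`, this is condition 2. Otherwise the sum over `xb` reduces to
the row from which `yb` was reached by the push; there `V` is 1, and `skewP_push` matches the two
sides. -/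
theorem IsAdmissible.sliceCoherent_of_isAddBox (h : IsAdmissible N W V) (hq0 : 0 ≤ q)
    (hq1 : q < 1) (ht0 : 0 ≤ t) (ht1 : t < 1) (ha : ∀ k < N, 0 < a k)
    (h1 : ShortRangePushing N V) (h2 : SliceIdentities q t a N W V) {k : ℕ} (hk : k < N)
    {x y : Sig (k + 1)} {yb : Sig k} {j : Fin (k + 1)} (hbox : IsAddBox x y j)
    (hyb : Interlaces yb y) : SliceCoherent q t a W V k x y yb := by
  have ha1 : ∀ i < k + 1, 0 < a i := fun i hi => ha i (by omega)
  by_cases hx : Interlaces yb x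
  · exact (h.sliceCoherent_iff hq0 hq1 ht0 ht1 ha hk hbox hx).2
      (h2 k hk x y yb j hx ((hx.isAddBox_right_iff hbox).1 hyb) hbox)
  · obtain ⟨c, rfl, mu', hmu, hmu', hc⟩ := exists_push_of_right hbox hyb hx
    have hk0 : 1 ≤ k := by have := c.2; omega
    rw [SliceCoherent, link_of_not_interlaces q t a hx, mul_zero, add_zero,
      Finset.sum_eq_single mu']
    · rw [h1 k hk0 hk x y mu' yb c hx hbox hyb hmu hmu', one_mul,
        univRate_mul_link hq0 hq1 ht0 ht1 ha1 hbox,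
        skewP_push hq0 hq1 ht0 ht1 (a k) hmu hbox hmu' hyb hc, univRate_of_isAddBox q t a hmu, link]
      have h3 := (macP_pos hq0 hq1 ht0 ht1 ha1 x).ne'
      have h4 := (macP_pos hq0 hq1 ht0 ht1 (fun i hi => ha1 i (by omega)) mu').ne'
      field_simp
    · intro xb hxb hne
      have hxb := mem_below.1 hxb
      rw [univRate_eq_zero q t a, mul_zero]
      · rintro rfl
        exact hx hxb
      · intro i hi
        apply hne
        have h3 := (exists_push_of_left hi hxb hx).1
        have h4 := hi.apply_self
        have h5 := (hyb i).2
        have h6 : i.castSucc = c.castSucc := by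
          by_contra hne
          have := hbox.apply_ne hne
          omega
        obtain rfl := Fin.castSucc_injective _ h6
        exact hi.eq_sub.trans hmu.eq_sub.symm
    · exact fun hn => absurd (mem_below.2 hmu') hn

theorem sliceCoherent_of_not_isAddBox (h : IsAdmissible N W V) (h0 : OneParticleMoves N W V)
    {k : ℕ} (hk : k < N) {x y : Sig (k + 1)} {yb : Sig k} (hxy : x ≠ y)
    (hbox : ∀ j, ¬ IsAddBox x y j) : SliceCoherent q t a W V k x y yb := by
  rw [SliceCoherent, univRate_eq_zero q t a hxy hbox, zero_mul, Finset.sum_eq_zero, zero_add]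
  · by_cases hx : Interlaces yb x
    · rw [h0.1 k hk x y yb hx hxy hbox, zero_mul]
    · rw [link_of_not_interlaces q t a hx, mul_zero]
  · intro xb hxb
    have hxb := mem_below.1 hxb
    by_cases hb : xb = yb
    · subst hb
      rw [mul_right_comm, h.V_mul_univRate_self hk hxb hxy, zero_mul]
    · by_cases hi : ∃ i, IsAddBox xb yb i
      · obtain ⟨i, hi⟩ := hi
        have hk0 : 1 ≤ k := by have := i.2; omega
        rw [h0.2 k hk0 hk x y xb yb i hxb hi hxy hbox, zero_mul, zero_mul]
      · rw [univRate_eq_zero q t a hb (not_exists.1 hi), mul_zero]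

theorem sliceCoherent_of_not_interlaces (h : IsAdmissible N W V) {k : ℕ} (hk : k < N)
    {x y : Sig (k + 1)} {yb : Sig k} (hyb : ¬ Interlaces yb y) :
    SliceCoherent q t a W V k x y yb := by
  rw [SliceCoherent, link_of_not_interlaces q t a hyb, mul_zero, Finset.sum_eq_zero, zero_add]
  · by_cases hx : Interlaces yb x
    · rw [h.W_zero k hk x y yb hx hyb, zero_mul]
    · rw [link_of_not_interlaces q t a hx, mul_zero]
  · intro xb hxb
    rcases Nat.eq_zero_or_pos k with rfl | hk0
    · rw [univRate_zero, mul_zero]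
    · rw [h.V_zero k hk0 hk x y xb yb (mem_below.1 hxb) hyb, zero_mul, zero_mul]

theorem self_notMem_ups {k : ℕ} (x : Sig k) : x ∉ ups x := fun h => by
  obtain ⟨j, hj⟩ := mem_ups.1 h
  exact hj.ne rfl

theorem IsAdmissible.sum_ups_W (h : IsAdmissible N W V) (h0 : OneParticleMoves N W V) {k : ℕ}
    (hk : k < N) {x : Sig (k + 1)} {yb : Sig k} (hx : Interlaces yb x) :
    ∑ y ∈ ups x, W k x y yb = -W k x x yb := by
  classical
  rw [← h.W_sum k hk x yb hx]
  refine Eq.trans ?_ (tsum_subtype {y | y ≠ x} fun y => W k x y yb).symm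
  rw [tsum_eq_sum (s := ups x)]
  · refine Finset.sum_congr rfl fun y hy => ?_
    rw [Set.indicator_of_mem]
    rintro rfl
    exact self_notMem_ups _ hy
  · intro y hy
    by_cases hyx : y = x
    · exact Set.indicator_of_notMem (by simp [hyx]) _
    · rw [Set.indicator_of_mem (show y ∈ {y | y ≠ x} from hyx)]
      exact h0.1 k hk x y yb hx (Ne.symm hyx) fun j hj => hy (mem_ups.2 ⟨j, hj⟩)

theorem IsAdmissible.sum_ups_V (h : IsAdmissible N W V) (h0 : OneParticleMoves N W V) {k : ℕ}
    (hk0 : 1 ≤ k) (hk : k < N) {x : Sig (k + 1)} {xb yb : Sig k} (hx : Interlaces xb x)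
    (hb : xb = yb ∨ ∃ i, IsAddBox xb yb i) :
    ∑ y ∈ ups x, V k x y xb yb + V k x x xb yb = 1 := by
  classical
  rw [add_comm, ← Finset.sum_insert (f := fun y => V k x y xb yb) (self_notMem_ups x),
    ← h.V_sum k hk0 hk x xb yb hx, tsum_eq_sum]
  intro y hy
  simp only [Finset.mem_insert, mem_ups, not_or, not_exists] at hy
  rcases hb with rfl | ⟨i, hi⟩
  · exact h.V_ne k hk0 hk _ _ _ hx (Ne.symm hy.1)
  · exact h0.2 k hk0 hk x y xb yb i hx hi (Ne.symm hy.1) hy.2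

/-- Sum the relation over `y` in `ups x` and compare with the intertwining by the links. Over all
`y`, the probabilities `V` add up to 1 and the rates `W` to 0, so the missing case `y = x` is what
remains after subtraction. -/
theorem IsAdmissible.sliceCoherent_self (h : IsAdmissible N W V) (hq0 : 0 ≤ q)
    (hq1 : q < 1) (ht0 : 0 ≤ t) (ht1 : t < 1) (ha : ∀ k < N, 0 < a k)
    (h0 : OneParticleMoves N W V) {k : ℕ} (hk : k < N) (x : Sig (k + 1)) (yb : Sig k)
    (hx : Interlaces yb x) (hne : ∀ y ∈ ups x, SliceCoherent q t a W V k x y yb) :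
    SliceCoherent q t a W V k x x yb := by
  have hc := sum_univRate_mul_link hq0 hq1 ht0 ht1 (fun i hi => ha i (by omega)) x yb
    (k := k) (a := a)
  have e1 : ∑ y ∈ ups x, univRate q t a (k + 1) x y * link q t a k y yb =
      ∑ y ∈ ups x, ∑ xb ∈ below x, V k x y xb yb * link q t a k x xb * univRate q t a k xb yb +
        ∑ y ∈ ups x, W k x y yb * link q t a k x yb := by
    rw [← Finset.sum_add_distrib]
    exact Finset.sum_congr rfl fun y hy => (hne y hy).symm
  have e2 : ∑ y ∈ ups x, ∑ xb ∈ below x,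
        V k x y xb yb * link q t a k x xb * univRate q t a k xb yb +
      ∑ xb ∈ below x, V k x x xb yb * link q t a k x xb * univRate q t a k xb yb =
      ∑ xb ∈ below x, link q t a k x xb * univRate q t a k xb yb := by
    rw [Finset.sum_comm, ← Finset.sum_add_distrib]
    refine Finset.sum_congr rfl fun xb hxb => ?_
    have hxb := mem_below.1 hxb
    rcases Nat.eq_zero_or_pos k with rfl | hk0
    · simp [univRate_zero]
    · by_cases hb : xb = yb ∨ ∃ i, IsAddBox xb yb i
      · simp only [mul_assoc]
        rw [← Finset.sum_mul, ← add_mul, h.sum_ups_V h0 hk0 hk hxb hb, one_mul]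
      · push Not at hb
        simp [univRate_eq_zero q t a hb.1 hb.2]
  rw [← Finset.sum_mul, h.sum_ups_W h0 hk hx] at e1
  rw [SliceCoherent]
  linear_combination e2 + e1 - hc

theorem IsAdmissible.sliceCoherent_of_conditions (h : IsAdmissible N W V) (hq0 : 0 ≤ q)
    (hq1 : q < 1) (ht0 : 0 ≤ t) (ht1 : t < 1) (ha : ∀ k < N, 0 < a k)
    (h0 : OneParticleMoves N W V) (h1 : ShortRangePushing N V)
    (h2 : SliceIdentities q t a N W V) {k : ℕ} (hk : k < N) (x y : Sig (k + 1)) (yb : Sig k) :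
    SliceCoherent q t a W V k x y yb := by
  have hbox : ∀ y, y ∈ ups x → SliceCoherent q t a W V k x y yb := by
    intro y hy
    obtain ⟨j, hj⟩ := mem_ups.1 hy
    by_cases hyb : Interlaces yb y
    · exact h.sliceCoherent_of_isAddBox hq0 hq1 ht0 ht1 ha h1 h2 hk hj hyb
    · exact sliceCoherent_of_not_interlaces h hk hyb
  by_cases hxy : x = y
  · subst hxy
    by_cases hx : Interlaces yb x
    · exact h.sliceCoherent_self hq0 hq1 ht0 ht1 ha h0 hk x yb hx hbox
    · exact sliceCoherent_of_not_interlaces h hk hx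
  · by_cases hy : y ∈ ups x
    · exact hbox y hy
    · exact sliceCoherent_of_not_isAddBox h h0 hk hxy (by simpa using hy)

/-! ### Boundedness of the rates -/

theorem card_ups_le {k : ℕ} (x : Sig k) : (ups x).card ≤ k := by
  classical
  have hsub : ups x ⊆ (Finset.univ : Finset (Fin k)).image fun j =>
      if h : Antitone (x.1 + Pi.single j 1) then ⟨x.1 + Pi.single j 1, h⟩ else x := by
    intro y hy
    obtain ⟨j, hj⟩ := mem_ups.1 hy
    exact Finset.mem_image.2 ⟨j, Finset.mem_univ j, by
      rw [dif_pos hj.antitone_add]; exact hj.eq_add.symm⟩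
  exact (Finset.card_le_card hsub).trans (Finset.card_image_le.trans (by simp))

/-- T_i is a ratio of the positive coefficients ψ and ψ', or 0 when removing the box breaks the
interlacing. -/
theorem Tcoef_nonneg (hq0 : 0 ≤ q) (hq1 : q < 1) (ht0 : 0 ≤ t) (ht1 : t < 1)
    {k : ℕ} {mu' mu : Sig k} {lam : Sig (k + 1)} {i : Fin k} (hbox : IsAddBox mu' mu i)
    (h : Interlaces mu lam) : 0 ≤ Tcoef q t mu lam i := by
  by_cases h' : Interlaces mu' lam
  · have e := psi_mul_psiPrime_eq_Tcoef_mul hq0 hq1 ht0 ht1 hbox h' h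
    have hp := mul_pos (psi_pos hq0 hq1 ht0 ht1 h') (psiPrime_pos hq0 hq1 ht0 ht1 hbox)
    rw [e] at hp
    exact (pos_of_mul_pos_left hp (psi_pos hq0 hq1 ht0 ht1 h).le).le
  · rw [Tcoef_eq_zero q t (not_not.1 (mt (h.isAddBox_left_iff hbox).2 h'))]

/-- In condition 2 the triggered terms are nonnegative, hence W ≤ a_k S_j, and S_j is bounded
uniformly. -/
theorem IsAdmissible.exists_W_bound (h : IsAdmissible N W V) (hq0 : 0 ≤ q)
    (hq1 : q < 1) (ht0 : 0 ≤ t) (ht1 : t < 1) (ha : ∀ k < N, 0 < a k)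
    (h0 : OneParticleMoves N W V) (h2 : SliceIdentities q t a N W V) {k : ℕ} (hk : k < N) :
    ∃ C, 0 ≤ C ∧ ∀ lam nu lamb, Interlaces lamb lam → |W k lam nu lamb| ≤ C := by
  set M : ℝ := ((((1 - q) * (1 - t)) * ((1 - q) * (1 - t)))⁻¹) ^ k with hM
  have hM0 : 0 ≤ M := by
    have h1 : 0 < 1 - q := sub_pos.2 hq1
    have h2 : 0 < 1 - t := sub_pos.2 ht1
    positivity
  have hak := ha k hk
  have key : ∀ lam nu lamb, Interlaces lamb lam → nu ∈ ups lam → W k lam nu lamb ≤ a k * M := by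
    intro lam nu lamb hl hnu
    obtain ⟨j, hj⟩ := mem_ups.1 hnu
    by_cases hi : Interlaces lamb nu
    · have hj' := (hl.isAddBox_right_iff hj).1 hi
      have e := h2 k hk lam nu lamb j hl hj' hj
      have hS := Scoef_le hq0 hq1 ht0 ht1 hl hj'
      have hT : 0 ≤ (a k)⁻¹ * W k lam nu lamb ∧ (a k)⁻¹ * W k lam nu lamb ≤ M := by
        refine ⟨mul_nonneg (inv_pos.2 hak).le (h.W_nonneg k hk _ _ _ hl hj.ne), ?_⟩
        refine le_trans ?_ hS
        rw [← e]
        refine le_add_of_nonneg_left (Finset.sum_nonneg fun i _ => ?_)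
        split_ifs with hanti
        · have hb := isAddBox_sub lamb i hanti
          by_cases hint : lamb.1 i = lam.1 i.succ
          · rw [Tcoef_eq_zero q t hint, mul_zero]
          · have hk0 : 1 ≤ k := by have := i.2; omega
            exact mul_nonneg (h.V_nonneg k hk0 hk _ _ _ _ ((hl.isAddBox_left_iff hb).2 hint))
              (Tcoef_nonneg hq0 hq1 ht0 ht1 hb hl)
        · exact le_rfl
      have := hT.2
      rwa [inv_mul_le_iff₀ hak] at this
    · rw [h.W_zero k hk _ _ _ hl hi]
      positivity
  -- The factor k + 1 serves the diagonal entry, minus the sum over at most k + 1 possible jumps.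
  refine ⟨(k + 1) * (a k * M), by positivity, fun lam nu lamb hl => ?_⟩
  by_cases hne : lam = nu
  · subst hne
    have e := h.sum_ups_W h0 hk hl
    have hnn : 0 ≤ ∑ y ∈ ups lam, W k lam y lamb := Finset.sum_nonneg fun y hy => by
      obtain ⟨j, hj⟩ := mem_ups.1 hy
      exact h.W_nonneg k hk _ _ _ hl hj.ne
    have hle := Finset.sum_le_card_nsmul (ups lam) (fun y => W k lam y lamb) (a k * M)
      fun y hy => key lam y lamb hl hy
    rw [nsmul_eq_mul] at hle
    have hcard : ((ups lam).card : ℝ) ≤ k + 1 := by exact_mod_cast card_ups_le lam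
    rw [← abs_neg, ← e, abs_of_nonneg hnn]
    exact hle.trans (mul_le_mul_of_nonneg_right hcard (by positivity))
  · rw [abs_of_nonneg (h.W_nonneg k hk _ _ _ hl hne)]
    by_cases hnu : nu ∈ ups lam
    · refine (key lam nu lamb hl hnu).trans (le_mul_of_one_le_left (by positivity) ?_)
      linarith [(Nat.cast_nonneg k : (0 : ℝ) ≤ k)]
    · rw [h0.1 k hk lam nu lamb hl hne fun j hj => hnu (mem_ups.2 ⟨j, hj⟩)]
      positivity

theorem IsAdmissible.exists_uniform_W_bound (h : IsAdmissible N W V) (hq0 : 0 ≤ q)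
    (hq1 : q < 1) (ht0 : 0 ≤ t) (ht1 : t < 1) (ha : ∀ k < N, 0 < a k)
    (h0 : OneParticleMoves N W V) (h2 : SliceIdentities q t a N W V) :
    ∃ C, 0 ≤ C ∧ ∀ k < N, ∀ lam nu lamb, Interlaces lamb lam → |W k lam nu lamb| ≤ C := by
  choose C hC0 hC using fun k : Fin N => h.exists_W_bound hq0 hq1 ht0 ht1 ha h0 h2 k.2
  refine ⟨∑ k, C k, Finset.sum_nonneg fun k _ => hC0 k, fun k hk lam nu lamb hl => ?_⟩
  exact (hC ⟨k, hk⟩ lam nu lamb hl).trans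
    (Finset.single_le_sum (f := C) (fun k _ => hC0 k) (Finset.mem_univ _))

/-- In the recursion over rows the old rate is multiplied by a probability and one value of `W` is
added, so each row costs at most C. -/
theorem IsAdmissible.abs_jumpRate_le (h : IsAdmissible N W V) {C : ℝ} (hC0 : 0 ≤ C)
    (hC : ∀ k < N, ∀ lam nu lamb, Interlaces lamb lam → |W k lam nu lamb| ≤ C) {m : ℕ}
    (hm : m ≤ N) (X Y : GTScheme m) : |jumpRate W V m X Y| ≤ m * C := by
  classical
  induction m with
  | zero => simp [jumpRate_zero]
  | succ m ih =>
    have hX := X.interlaces_top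
    rw [h.jumpRate_succ hm]
    refine (abs_add_le _ _).trans ?_
    push_cast
    rw [add_mul, one_mul]
    refine add_le_add ?_ ?_
    · rcases Nat.eq_zero_or_pos m with rfl | hm0
      · simp [jumpRate_zero]
      · rw [abs_mul]
        refine (mul_le_of_le_one_right (abs_nonneg _) ?_).trans (ih (by omega) _ _)
        rw [abs_of_nonneg (h.V_nonneg m hm0 hm _ _ _ _ hX)]
        exact h.V_le_one m hm0 hm _ _ _ _ hX
    · split_ifs
      · exact hC m hm _ _ _ hX
      · rwa [abs_zero]

theorem IsAdmissible.jumpRate_nonneg (h : IsAdmissible N W V) {m : ℕ} (hm : m ≤ N)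
    {X Y : GTScheme m} (hXY : X ≠ Y) : 0 ≤ jumpRate W V m X Y := by
  classical
  induction m with
  | zero => exact absurd (GTScheme.eq_of_zero X Y) hXY
  | succ m ih =>
    have hX := X.interlaces_top
    rw [h.jumpRate_succ hm]
    by_cases ht : X.trunc = Y.trunc
    · have htop : X.top ≠ Y.top := fun hh => hXY (GTScheme.eq_iff.2 ⟨ht, hh⟩)
      have hW := h.W_nonneg m hm _ _ _ hX htop
      rw [if_pos ht, ← ht]
      rcases Nat.eq_zero_or_pos m with rfl | hm0
      · rwa [jumpRate_zero, zero_mul, zero_add]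
      · rwa [h.V_ne m hm0 hm _ _ _ hX htop, mul_zero, zero_add]
    · rw [if_neg ht, add_zero]
      rcases Nat.eq_zero_or_pos m with rfl | hm0
      · rw [jumpRate_zero, zero_mul]
      · exact mul_nonneg (ih (by omega) ht) (h.V_nonneg m hm0 hm _ _ _ _ hX)

theorem IsAdmissible.jumpRate_finite (h : IsAdmissible N W V) {m : ℕ} (hm : m ≤ N)
    (X : GTScheme m) : {Y | jumpRate W V m X Y ≠ 0}.Finite := by
  refine ((h.offDiagRate_finite hm X).insert X).subset fun Y hY => ?_
  by_cases hXY : X = Y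
  · exact Or.inl hXY.symm
  · refine Or.inr fun h0 => hY ?_
    rw [jumpRate, if_neg hXY, h0]

theorem IsAdmissible.tsum_jumpRate (h : IsAdmissible N W V) {m : ℕ} (hm : m ≤ N)
    (X : GTScheme m) : ∑' Y, jumpRate W V m X Y = 0 := by
  classical
  have e : ∀ Y, jumpRate W V m X Y = offDiagRate W V m X Y +
      if Y = X then -∑' Z, offDiagRate W V m X Z else 0 := by
    intro Y
    by_cases hXY : Y = X
    · subst hXY
      rw [jumpRate, if_pos rfl, if_pos rfl, offDiagRate_self, zero_add]
    · rw [jumpRate, if_neg (Ne.symm hXY), if_neg hXY, add_zero]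
  have hs : Summable fun Z => offDiagRate W V m X Z :=
    summable_of_hasFiniteSupport (h.offDiagRate_finite hm X)
  rw [tsum_congr e, hs.tsum_add (hasSum_ite_eq X _).summable, tsum_ite_eq, add_neg_cancel]

end

end MacdonaldDynamics

/-! ### The equivalence -/

theorem mainTheorem2 (q t : ℝ) (hq0 : 0 ≤ q) (hq1 : q < 1) (ht0 : 0 ≤ t) (ht1 : t < 1)
    (N : ℕ) (a : ℕ → ℝ) (ha : ∀ k < N, 0 < a k)
    (W : MacdonaldDynamics.IndepRates) (V : MacdonaldDynamics.TrigProbs)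
    (hWV : MacdonaldDynamics.IsAdmissible N W V) :
    (∃ P : ℝ → MacdonaldDynamics.GTScheme N → MacdonaldDynamics.GTScheme N → ℝ,
        MacdonaldDynamics.IsMultivariateDynamics q t a N W V P) ↔
      MacdonaldDynamics.OneParticleMoves N W V ∧
      MacdonaldDynamics.ShortRangePushing N V ∧
      MacdonaldDynamics.SliceIdentities q t a N W V := by
  constructor
  · rintro ⟨P, hP⟩
    have hcoh := fun k (hk : k < N) x y yb => hP.sliceCoherent hq0 hq1 ht0 ht1 ha hk x y yb
    have h0 := hWV.oneParticleMoves hq0 hq1 ht0 ht1 ha hcoh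
    exact ⟨h0, hWV.shortRangePushing h0, hWV.sliceIdentities hq0 hq1 ht0 ht1 ha hcoh⟩
  · rintro ⟨h0, h1, h2⟩
    have hcoh := fun k (hk : k < N) x y yb =>
      hWV.sliceCoherent_of_conditions hq0 hq1 ht0 ht1 ha h0 h1 h2 hk x y yb
    -- Slice coherence with the univariate rates identifies the projections; this turns it back into
    -- the coherence relation for the projections themselves.
    have hproj := fun m (hm : m ≤ N) x y => hWV.proj_eq_univRate hq0 hq1 ht0 ht1 ha
      (fun k hk x y yb _ => hcoh k hk x y yb) hm x y
    obtain ⟨C, hC0, hC⟩ := hWV.exists_uniform_W_bound hq0 hq1 ht0 ht1 ha h0 h2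
    have hbound := fun X Y => hWV.abs_jumpRate_le hC0 hC le_rfl X Y
    -- The uniform bound on `W`, a consequence of condition 2, is what makes the semigroup exist.
    obtain ⟨P, hP, hrates⟩ := MacdonaldDynamics.exists_semigroup
      (MacdonaldDynamics.jumpRate W V N) (hWV.jumpRate_finite le_rfl)
      (fun X Y hXY => hWV.jumpRate_nonneg le_rfl hXY) (hWV.tsum_jumpRate le_rfl)
      (fun X => neg_le_of_abs_le (hbound X X))
    have ha' : ∀ m, m ≤ N → ∀ i < m, 0 < a i := fun m hm i hi => ha i (by omega)
    refine ⟨P, hP, hrates, hWV.jumpRate_finite le_rfl, ⟨_, hbound⟩, hWV, ⟨C, hC⟩, ?_, ?_, ?_, ?_⟩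
    · intro k hk x y yb _
      rw [MacdonaldDynamics.tsum_eq_sum_below x _ fun mu hmu => by
        rw [MacdonaldDynamics.link_of_not_interlaces q t a hmu, mul_zero, zero_mul],
        hproj (k + 1) hk]
      simp only [hproj k hk.le]
      exact hcoh k hk x y yb
    · intro m _ hm x
      simp only [hproj m hm]
      exact MacdonaldDynamics.univRate_finite q t a x
    · intro m _ hm
      refine ⟨∑ i ∈ Finset.range m, a i, fun x y => ?_⟩
      rw [hproj m hm]
      exact MacdonaldDynamics.abs_univRate_le hq0 hq1 ht0 ht1 (ha' m hm) x y
    · exact fun m _ hm x y => hproj m hm x y
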